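/- Let $\mathbb K\in\{\mathbb R,\mathbb C\}$, let $N\ge 1$ and $1\le k\le\left[\frac{N-1}{2}\right]$ be integers, and let $p>1$, $\alpha\neq 0$ and $\omega>\frac{\alpha^2}{(N-2k)^2}$ be real numbers. Let $\mathcal G$ be the star graph of $N$ half-lines $(0,\infty)$ joined at the vertex $0$, let $L^2(\mathcal G)=\bigoplus_{j=1}^N L^2(0,\infty)$ ($\mathbb K$-valued functions, inner product $(\cdot,\cdot)_2$ linear in the first argument), and let $$\mathcal E=\Big\{\mathbf V=(v_j)_{j=1}^N\in \bigoplus_{j=1}^N H^1(0,\infty):\ v_1(0)=\dots=v_N(0)\Big\}.$$ Let $\mathbf\Phi_k=(\varphi_{k,j})_{j=1}^N$ be the profile $$\varphi_{k,j}(x)=\Big[\tfrac{(p+1)\omega}{2}\operatorname{sech}^2\Big(\tfrac{(p-1)\sqrt\omega}{2}x\mp a_k\Big)\Big]^{\frac1{p-1}},\qquad a_k=\tanh^{-1}\Big(\tfrac{\alpha}{(2k-N)\sqrt\omega}\Big),$$ with the sign $-$ for $1\le j\le k$ and the sign $+$ for $k+1\le j\le N$. For $\mathbf F=(f_j)_{j=1}^N$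 and $\mathbf G=(g_j)_{j=1}^N$ in $\mathcal E$ put $$B_{1,k}^\alpha(\mathbf F,\mathbf G)=\sum_{j=1}^N\int_0^\infty\big(f_j'\overline{g_j'}+\omega f_j\overline{g_j}-p\,\varphi_{k,j}^{p-1}f_j\overline{g_j}\big)\,dx+\alpha f_1(0)\overline{g_1(0)},$$ $$B_{2,k}^\alpha(\mathbf F,\mathbf G)=\sum_{j=1}^N\int_0^\infty\big(f_j'\overline{g_j'}+\omega f_j\overline{g_j}-\varphi_{k,j}^{p-1}f_j\overline{g_j}\big)\,dx+\alpha f_1(0)\overline{g_1(0)},$$ and let $\mathbf L_{1,k}^\alpha$, $\mathbf L_{2,k}^\alpha$ be the self-adjoint operators on $L^2(\mathcal G)$ associated with these forms: $\mathbf V\in\mathrm{dom}(\mathbf L_{i,k}^\alpha)$ and $\mathbf L_{i,k}^\alpha\mathbf V=\mathbf W$ mean that $\mathbf V\in\mathcal E$, $\mathbf W\in L^2(\mathcal G)$ and $B_{i,k}^\alpha(\mathbf V,\mathbf Z)=(\mathbf W,\mathbf Z)_2$ for all $\mathbf Z\in\mathcal E$. Then the following assertions hold. (i) $\mathbf\Phi_k\in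 L^2(\mathcal G)$, $\ker(\mathbf L_{2,k}^\alpha)=\operatorname{span}\{\mathbf\Phi_k\}$, and $\mathbf L_{2,k}^\alpha\ge 0$. (ii) $\ker(\mathbf L_{1,k}^\alpha)=\{\mathbf 0\}$. (iii) The positive part of the spectrum of $\mathbf L_{1,k}^\alpha$ and of $\mathbf L_{2,k}^\alpha$ is bounded away from zero, i.e. for $i=1,2$ there is $\delta>0$ with $\sigma(\mathbf L_{i,k}^\alpha)\cap(0,\delta)=\varnothing$; and $\sigma_{\mathrm{ess}}(\mathbf L_{1,k}^\alpha)=\sigma_{\mathrm{ess}}(\mathbf L_{2,k}^\alpha)=[\omega,\infty)$. Here $\sigma_{\mathrm{ess}}$ is the spectrum without its isolated points that are eigenvalues of finite multiplicity. -/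

import Mathlib

open MeasureTheory Set Filter
open scoped ENNReal Topology BoundedContinuousFunction

noncomputable section

/-! ### Unbounded operators: kernel, spectrum, discrete and essential spectrum -/

namespace UnboundedOp

variable {𝕜 H : Type*} [RCLike 𝕜] [NormedAddCommGroup H] [InnerProductSpace 𝕜 H]

/-- The eigenspace `ker (A - l)` of a partially defined operator, as a subspace of `H`. -/
def eigenspace (A : H →ₗ.[𝕜] H) (l : 𝕜) : Submodule 𝕜 H :=
  (LinearMap.eqLocus A.toFun (l • A.domain.subtype)).map A.domain.subtype

/-- The kernel of a partially defined operator, as a subspace of `H`. -/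
def kernel (A : H →ₗ.[𝕜] H) : Submodule 𝕜 H := eigenspace A 0

/-- `A ≥ 0` in the sense of quadratic forms. -/
def Nonneg (A : H →ₗ.[𝕜] H) : Prop :=
  ∀ v : A.domain, 0 ≤ RCLike.re (inner 𝕜 (v : H) (A v))

/-- `l` is in the resolvent set iff `A - l : dom A → H` has a bounded two-sided inverse. -/
def resolventSet (A : H →ₗ.[𝕜] H) : Set 𝕜 :=
  {l | ∃ R : H →L[𝕜] H,
    (∀ u : H, ∃ h : R u ∈ A.domain, A ⟨R u, h⟩ - l • R u = u) ∧
    ∀ v : A.domain, R (A v - l • (v : H)) = v}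

/-- The spectrum of a partially defined operator. -/
def spectrum (A : H →ₗ.[𝕜] H) : Set 𝕜 := (resolventSet A)ᶜ

/-- The discrete spectrum: isolated points of the spectrum which are eigenvalues of finite
multiplicity. -/
def discreteSpectrum (A : H →ₗ.[𝕜] H) : Set 𝕜 :=
  {l | l ∈ spectrum A ∧ (∃ ε > 0, ∀ m ∈ spectrum A, dist m l < ε → m = l) ∧
    eigenspace A l ≠ ⊥ ∧ FiniteDimensional 𝕜 (eigenspace A l)}

/-- The essential spectrum (of a self-adjoint operator): what remains of the spectrum when the
discrete spectrum is removed. -/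
def essentialSpectrum (A : H →ₗ.[𝕜] H) : Set 𝕜 := spectrum A \ discreteSpectrum A

end UnboundedOp

/-! ### Function spaces on the half-line and on the star graph -/

namespace StarGraph

/-- Lebesgue measure on the half-line `(0, ∞)`. -/
abbrev halfLine : Measure ℝ := volume.restrict (Ioi 0)

/-- `L²(0, ∞)`. -/
abbrev L2Half (𝕜 : Type*) [RCLike 𝕜] := Lp 𝕜 2 halfLine

/-- `L²` of the star graph with `N` half-lines: the Hilbert sum of `N` copies of `L²(0, ∞)`. -/
abbrev L2Graph (𝕜 : Type*) [RCLike 𝕜] (N : ℕ) := PiLp 2 (fun _ : Fin N => L2Half 𝕜)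

variable {𝕜 : Type*} [RCLike 𝕜]

/-- Test functions on the open half-line: smooth, with compact support inside `(0, ∞)`. -/
def IsTest (ψ : ℝ → ℝ) : Prop :=
  ContDiff ℝ (⊤ : ℕ∞) ψ ∧ HasCompactSupport ψ ∧ tsupport ψ ⊆ Ioi 0

/-- `g` is the weak (distributional) derivative of `f` on `(0, ∞)`. -/
def HasWeakDeriv (f g : L2Half 𝕜) : Prop :=
  ∀ ψ : ℝ → ℝ, IsTest ψ →
    ∫ x in Ioi (0 : ℝ), deriv ψ x • f x = - ∫ x in Ioi (0 : ℝ), ψ x • g x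

/-- `c` is the boundary value `f(0)` of (the continuous representative on `[0, ∞)` of) `f`. -/
def HasBoundaryValue (f : L2Half 𝕜) (c : 𝕜) : Prop :=
  ∃ F : ℝ → 𝕜, ContinuousOn F (Ici 0) ∧ f =ᵐ[halfLine] F ∧ F 0 = c

lemma integrable_test_smul {ψ : ℝ → ℝ} (hc : Continuous ψ) (hs : HasCompactSupport ψ)
    (f : L2Half 𝕜) : Integrable (fun x => ψ x • f x) halfLine := by
  have h1 : MemLp ψ 2 halfLine := (hc.memLp_of_hasCompactSupport hs).restrict _
  exact memLp_one_iff_integrable.1 ((Lp.memLp f).smul h1)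

lemma IsTest.continuous_deriv {ψ : ℝ → ℝ} (h : IsTest ψ) : Continuous (deriv ψ) :=
  h.1.continuous_deriv (by simp)

lemma HasWeakDeriv.add {f g f' g' : L2Half 𝕜} (hf : HasWeakDeriv f f')
    (hg : HasWeakDeriv g g') : HasWeakDeriv (f + g) (f' + g') := by
  intro ψ hψ
  have i1 := integrable_test_smul hψ.continuous_deriv hψ.2.1.deriv f
  have i2 := integrable_test_smul hψ.continuous_deriv hψ.2.1.deriv g
  have i3 := integrable_test_smul hψ.1.continuous hψ.2.1 f'
  have i4 := integrable_test_smul hψ.1.continuous hψ.2.1 g'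
  have e1 : ∫ x in Ioi (0 : ℝ), deriv ψ x • (f + g) x
      = ∫ x in Ioi (0 : ℝ), (deriv ψ x • f x + deriv ψ x • g x) := by
    refine integral_congr_ae ?_
    filter_upwards [Lp.coeFn_add f g] with x hx
    rw [hx, Pi.add_apply, smul_add]
  have e2 : ∫ x in Ioi (0 : ℝ), ψ x • (f' + g') x
      = ∫ x in Ioi (0 : ℝ), (ψ x • f' x + ψ x • g' x) := by
    refine integral_congr_ae ?_
    filter_upwards [Lp.coeFn_add f' g'] with x hx
    rw [hx, Pi.add_apply, smul_add]
  rw [e1, e2, integral_add i1 i2, integral_add i3 i4, hf ψ hψ, hg ψ hψ, neg_add]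

lemma HasWeakDeriv.smul {f f' : L2Half 𝕜} (c : 𝕜) (hf : HasWeakDeriv f f') :
    HasWeakDeriv (c • f) (c • f') := by
  intro ψ hψ
  have e1 : ∫ x in Ioi (0 : ℝ), deriv ψ x • (c • f) x
      = ∫ x in Ioi (0 : ℝ), c • (deriv ψ x • f x) := by
    refine integral_congr_ae ?_
    filter_upwards [Lp.coeFn_smul c f] with x hx
    rw [hx, Pi.smul_apply, smul_comm]
  have e2 : ∫ x in Ioi (0 : ℝ), ψ x • (c • f') x
      = ∫ x in Ioi (0 : ℝ), c • (ψ x • f' x) := by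
    refine integral_congr_ae ?_
    filter_upwards [Lp.coeFn_smul c f'] with x hx
    rw [hx, Pi.smul_apply, smul_comm]
  rw [e1, e2, integral_smul, integral_smul, hf ψ hψ, smul_neg]

lemma hasWeakDeriv_zero : HasWeakDeriv (0 : L2Half 𝕜) 0 := by
  intro ψ hψ
  have e (φ : ℝ → ℝ) : ∫ x in Ioi (0 : ℝ), φ x • (0 : L2Half 𝕜) x = 0 := by
    rw [integral_congr_ae (g := fun _ => (0 : 𝕜)), integral_zero]
    filter_upwards [Lp.coeFn_zero 𝕜 2 halfLine] with x hx
    rw [hx, Pi.zero_apply, smul_zero]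
  rw [e, e, neg_zero]

/-- An `L²` function orthogonal to all test functions vanishes. -/
lemma eq_zero_of_test {f : L2Half 𝕜}
    (h : ∀ ψ : ℝ → ℝ, IsTest ψ → ∫ x in Ioi (0 : ℝ), ψ x • f x = 0) : f = 0 := by
  have hl : LocallyIntegrable (f : ℝ → 𝕜) halfLine :=
    (Lp.memLp f).locallyIntegrable (by norm_num)
  have := isOpen_Ioi.ae_eq_zero_of_integral_contDiff_smul_eq_zero (U := Ioi (0 : ℝ))
    (μ := halfLine) (hl.locallyIntegrableOn _) (fun g h1 h2 h3 => h g ⟨h1, h2, h3⟩)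
  rw [Lp.eq_zero_iff_ae_eq_zero]
  filter_upwards [this, ae_restrict_mem measurableSet_Ioi] with x hx hx0 using hx hx0

lemma HasWeakDeriv.unique {f g g' : L2Half 𝕜} (h : HasWeakDeriv f g)
    (h' : HasWeakDeriv f g') : g = g' := by
  have h0 : HasWeakDeriv (0 : L2Half 𝕜) (g - g') := by
    have := h.add (h'.smul (-1))
    simpa [sub_eq_add_neg] using this
  refine sub_eq_zero.1 (eq_zero_of_test fun ψ hψ => ?_)
  have h1 := h0 ψ hψ
  have h2 := hasWeakDeriv_zero (𝕜 := 𝕜) ψ hψ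
  rw [h2] at h1
  have e : ∫ x in Ioi (0 : ℝ), ψ x • (0 : L2Half 𝕜) x = 0 := by
    rw [integral_congr_ae (g := fun _ => (0 : 𝕜)), integral_zero]
    filter_upwards [Lp.coeFn_zero 𝕜 2 halfLine] with x hx
    rw [hx, Pi.zero_apply, smul_zero]
  rw [e] at h1
  simpa using h1.symm

/-- The Sobolev space `H¹(0, ∞)`. -/
def H1 (𝕜 : Type*) [RCLike 𝕜] : Submodule 𝕜 (L2Half 𝕜) where
  carrier := {f | ∃ g, HasWeakDeriv f g}
  add_mem' := fun ⟨_, h⟩ ⟨_, h'⟩ => ⟨_, h.add h'⟩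
  zero_mem' := ⟨0, hasWeakDeriv_zero⟩
  smul_mem' := fun c _ ⟨_, h⟩ => ⟨_, h.smul c⟩

/-- The weak derivative `H¹(0, ∞) → L²(0, ∞)`. -/
def weakDeriv : H1 𝕜 →ₗ[𝕜] L2Half 𝕜 where
  toFun f := f.2.choose
  map_add' f g :=
    (f + g).2.choose_spec.unique (f.2.choose_spec.add g.2.choose_spec)
  map_smul' c f := (c • f).2.choose_spec.unique (f.2.choose_spec.smul c)

lemma HasBoundaryValue.add {f g : L2Half 𝕜} {c d : 𝕜} (hf : HasBoundaryValue f c)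
    (hg : HasBoundaryValue g d) : HasBoundaryValue (f + g) (c + d) := by
  obtain ⟨F, hF, hfF, rfl⟩ := hf
  obtain ⟨G, hG, hgG, rfl⟩ := hg
  exact ⟨F + G, hF.add hG, (Lp.coeFn_add f g).trans (hfF.add hgG), rfl⟩

lemma HasBoundaryValue.smul {f : L2Half 𝕜} {c : 𝕜} (a : 𝕜) (hf : HasBoundaryValue f c) :
    HasBoundaryValue (a • f) (a • c) := by
  obtain ⟨F, hF, hfF, rfl⟩ := hf
  exact ⟨a • F, hF.const_smul a, (Lp.coeFn_smul a f).trans (hfF.const_smul a), rfl⟩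

lemma hasBoundaryValue_zero : HasBoundaryValue (0 : L2Half 𝕜) 0 :=
  ⟨0, continuousOn_const, Lp.coeFn_zero _ _ _, rfl⟩

lemma HasBoundaryValue.unique {f : L2Half 𝕜} {c d : 𝕜} (hf : HasBoundaryValue f c)
    (hg : HasBoundaryValue f d) : c = d := by
  obtain ⟨F, hF, hfF, rfl⟩ := hf
  obtain ⟨G, hG, hgG, rfl⟩ := hg
  have hae : F =ᵐ[volume.restrict (Ioi 0)] G := hfF.symm.trans hgG
  have heq : EqOn F G (Ioi 0) :=
    Measure.eqOn_open_of_ae_eq hae isOpen_Ioi (hF.mono Ioi_subset_Ici_self)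
      (hG.mono Ioi_subset_Ici_self)
  have h1 : Tendsto F (𝓝[>] 0) (𝓝 (F 0)) :=
    (hF 0 self_mem_Ici).mono_left (nhdsWithin_mono _ Ioi_subset_Ici_self)
  have h2 : Tendsto G (𝓝[>] 0) (𝓝 (G 0)) :=
    (hG 0 self_mem_Ici).mono_left (nhdsWithin_mono _ Ioi_subset_Ici_self)
  refine tendsto_nhds_unique h1 (h2.congr' ?_)
  filter_upwards [self_mem_nhdsWithin] with x hx using (heq hx).symm

/-- The form domain `ℰ`: vector functions in `H¹` of the graph that are continuous at the
vertex, `v₁(0) = ⋯ = v_N(0)`. -/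
def formDomain (𝕜 : Type*) [RCLike 𝕜] (N : ℕ) : Submodule 𝕜 (L2Graph 𝕜 N) where
  carrier := {V | (∀ j, V j ∈ H1 𝕜) ∧ ∃ c : 𝕜, ∀ j, HasBoundaryValue (V j) c}
  add_mem' := fun ⟨h, c, hc⟩ ⟨h', d, hd⟩ =>
    ⟨fun j => (H1 𝕜).add_mem (h j) (h' j), c + d, fun j => (hc j).add (hd j)⟩
  zero_mem' := ⟨fun _ => (H1 𝕜).zero_mem, 0, fun _ => hasBoundaryValue_zero⟩
  smul_mem' := fun a _ ⟨h, c, hc⟩ =>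
    ⟨fun j => (H1 𝕜).smul_mem a (h j), a • c, fun j => (hc j).smul a⟩

variable {N : ℕ}

/-- The weak derivative on the `j`-th edge. -/
def edgeDeriv (j : Fin N) : formDomain 𝕜 N →ₗ[𝕜] L2Half 𝕜 where
  toFun V := weakDeriv ⟨(V : L2Graph 𝕜 N) j, V.2.1 j⟩
  map_add' V W := weakDeriv.map_add ⟨_, V.2.1 j⟩ ⟨_, W.2.1 j⟩
  map_smul' c V := weakDeriv.map_smul c ⟨_, V.2.1 j⟩

/-- The common value `v₁(0) = ⋯ = v_N(0)` at the vertex. -/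
def vertexValue [NeZero N] : formDomain 𝕜 N →ₗ[𝕜] 𝕜 where
  toFun V := V.2.2.choose
  map_add' V W := ((V + W).2.2.choose_spec 0).unique
    ((V.2.2.choose_spec 0).add (W.2.2.choose_spec 0))
  map_smul' c V := ((c • V).2.2.choose_spec 0).unique ((V.2.2.choose_spec 0).smul c)

/-! ### The quadratic form and the operator it represents -/

/-- The form `∑ⱼ ∫₀^∞ (fⱼ' gⱼ' + qⱼ fⱼ gⱼ) dx + α f₁(0) g₁(0)` on `ℰ`, with complex conjugates on
the second argument (no effect for real scalars). -/
def form [NeZero N] (α : ℝ) (q : Fin N → ℝ →ᵇ ℝ) (F G : formDomain 𝕜 N) : 𝕜 :=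
  (∑ j, ∫ x in Ioi (0 : ℝ),
      (edgeDeriv j F x * star (edgeDeriv j G x)
        + (q j x : 𝕜) * ((F : L2Graph 𝕜 N) j x * star ((G : L2Graph 𝕜 N) j x))))
    + (α : 𝕜) * (vertexValue F * star (vertexValue G))

lemma integrable_mul_star (f g : L2Half 𝕜) :
    Integrable (fun x => f x * star (g x)) halfLine := by
  have h := L2.integrable_inner (𝕜 := 𝕜) g f
  simpa [RCLike.inner_apply] using h

lemma integrable_form_term (q : ℝ →ᵇ ℝ) (f g f' g' : L2Half 𝕜) :
    Integrable (fun x => f' x * star (g' x) + (q x : 𝕜) * (f x * star (g x))) halfLine := by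
  refine (integrable_mul_star f' g').add ?_
  refine (integrable_mul_star f g).bdd_mul (c := ‖q‖) ?_ ?_
  · exact (RCLike.continuous_ofReal.comp q.continuous).aestronglyMeasurable
  · refine Eventually.of_forall fun x => ?_
    rw [RCLike.norm_ofReal]
    exact q.norm_coe_le_norm x

lemma form_add_left [NeZero N] (α : ℝ) (q : Fin N → ℝ →ᵇ ℝ) (F F' G : formDomain 𝕜 N) :
    form α q (F + F') G = form α q F G + form α q F' G := by
  have key : ∀ j, ∫ x in Ioi (0 : ℝ),
      (edgeDeriv j (F + F') x * star (edgeDeriv j G x)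
        + (q j x : 𝕜) * (((F + F' : formDomain 𝕜 N) : L2Graph 𝕜 N) j x
            * star ((G : L2Graph 𝕜 N) j x)))
      = (∫ x in Ioi (0 : ℝ), (edgeDeriv j F x * star (edgeDeriv j G x)
        + (q j x : 𝕜) * ((F : L2Graph 𝕜 N) j x * star ((G : L2Graph 𝕜 N) j x))))
      + ∫ x in Ioi (0 : ℝ), (edgeDeriv j F' x * star (edgeDeriv j G x)
        + (q j x : 𝕜) * ((F' : L2Graph 𝕜 N) j x * star ((G : L2Graph 𝕜 N) j x))) := by
    intro j
    rw [← integral_add (integrable_form_term _ _ _ _ _) (integrable_form_term _ _ _ _ _)]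
    refine integral_congr_ae ?_
    have h1 := Lp.coeFn_add (edgeDeriv j F) (edgeDeriv j F')
    have h2 := Lp.coeFn_add ((F : L2Graph 𝕜 N) j) ((F' : L2Graph 𝕜 N) j)
    filter_upwards [h1, h2] with x hx1 hx2
    rw [map_add, hx1, Submodule.coe_add, PiLp.add_apply, hx2, Pi.add_apply, Pi.add_apply]
    ring
  unfold form
  rw [Finset.sum_congr rfl fun j _ => key j, Finset.sum_add_distrib, map_add]
  ring

lemma form_smul_left [NeZero N] (α : ℝ) (q : Fin N → ℝ →ᵇ ℝ) (c : 𝕜) (F G : formDomain 𝕜 N) :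
    form α q (c • F) G = c * form α q F G := by
  have key : ∀ j, ∫ x in Ioi (0 : ℝ),
      (edgeDeriv j (c • F) x * star (edgeDeriv j G x)
        + (q j x : 𝕜) * (((c • F : formDomain 𝕜 N) : L2Graph 𝕜 N) j x
            * star ((G : L2Graph 𝕜 N) j x)))
      = c * ∫ x in Ioi (0 : ℝ), (edgeDeriv j F x * star (edgeDeriv j G x)
        + (q j x : 𝕜) * ((F : L2Graph 𝕜 N) j x * star ((G : L2Graph 𝕜 N) j x))) := by
    intro j
    rw [← integral_const_mul]
    refine integral_congr_ae ?_
    have h1 := Lp.coeFn_smul c (edgeDeriv j F)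
    have h2 := Lp.coeFn_smul c ((F : L2Graph 𝕜 N) j)
    filter_upwards [h1, h2] with x hx1 hx2
    rw [map_smul, hx1, Submodule.coe_smul, PiLp.smul_apply, hx2, Pi.smul_apply, Pi.smul_apply,
      smul_eq_mul, smul_eq_mul]
    ring
  unfold form
  rw [Finset.sum_congr rfl fun j _ => key j, ← Finset.mul_sum, map_smul, smul_eq_mul]
  ring

lemma isTest_hasBoundaryValue {ψ : ℝ → ℝ} (h : IsTest ψ) {f : L2Half 𝕜}
    (hf : f =ᵐ[halfLine] fun x => (ψ x : 𝕜)) : HasBoundaryValue f 0 := by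
  refine ⟨fun x => (ψ x : 𝕜),
    (RCLike.continuous_ofReal.comp h.1.continuous).continuousOn, hf, ?_⟩
  have : (0 : ℝ) ∉ tsupport ψ := fun h0 => lt_irrefl (0 : ℝ) (h.2.2 h0)
  simp [image_eq_zero_of_notMem_tsupport this]

lemma IsTest.memLp {ψ : ℝ → ℝ} (hc : Continuous ψ) (hs : HasCompactSupport ψ) :
    MemLp (fun x => (ψ x : 𝕜)) 2 halfLine :=
  ((hc.memLp_of_hasCompactSupport hs).restrict _).ofReal

lemma isTest_mem_H1 {ψ : ℝ → ℝ} (h : IsTest ψ) {f : L2Half 𝕜}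
    (hf : f =ᵐ[halfLine] fun x => (ψ x : 𝕜)) : f ∈ H1 𝕜 := by
  have hm := IsTest.memLp (𝕜 := 𝕜) h.continuous_deriv h.2.1.deriv
  refine ⟨hm.toLp _, fun φ hφ => ?_⟩
  have e1 : ∫ x in Ioi (0 : ℝ), deriv φ x • f x
      = ∫ x in Ioi (0 : ℝ), ((deriv φ x * ψ x : ℝ) : 𝕜) := by
    refine integral_congr_ae ?_
    filter_upwards [hf] with x hx
    rw [hx, RCLike.real_smul_eq_coe_mul, RCLike.ofReal_mul]
  have e2 : ∫ x in Ioi (0 : ℝ), φ x • (hm.toLp _ : L2Half 𝕜) x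
      = ∫ x in Ioi (0 : ℝ), ((φ x * deriv ψ x : ℝ) : 𝕜) := by
    refine integral_congr_ae ?_
    filter_upwards [hm.coeFn_toLp] with x hx
    rw [hx, RCLike.real_smul_eq_coe_mul, RCLike.ofReal_mul]
  have hz : ∀ x, x ∉ Ioi (0 : ℝ) → φ x = 0 := fun x hx =>
    image_eq_zero_of_notMem_tsupport fun h' => hx (hφ.2.2 h')
  have hz' : ∀ x, x ∉ Ioi (0 : ℝ) → ψ x = 0 := fun x hx =>
    image_eq_zero_of_notMem_tsupport fun h' => hx (h.2.2 h')
  rw [e1, e2, integral_ofReal, integral_ofReal,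
    setIntegral_eq_integral_of_forall_compl_eq_zero (fun x hx => by rw [hz' x hx, mul_zero]),
    setIntegral_eq_integral_of_forall_compl_eq_zero (fun x hx => by rw [hz x hx, zero_mul])]
  have cφ := hφ.1.continuous
  have cψ := h.1.continuous
  have i1 : Integrable (φ * deriv ψ) :=
    (cφ.mul h.continuous_deriv).integrable_of_hasCompactSupport hφ.2.1.mul_right
  have i2 : Integrable (deriv φ * ψ) :=
    (hφ.continuous_deriv.mul cψ).integrable_of_hasCompactSupport h.2.1.mul_left
  have i3 : Integrable (φ * ψ) :=
    (cφ.mul cψ).integrable_of_hasCompactSupport h.2.1.mul_left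
  have := integral_mul_deriv_eq_deriv_mul_of_integrable
    (u := φ) (v := ψ) (u' := deriv φ) (v' := deriv ψ)
    (fun x _ => (hφ.1.differentiable (by simp) x).hasDerivAt)
    (fun x _ => (h.1.differentiable (by simp) x).hasDerivAt) i1 i2 i3
  rw [this, RCLike.ofReal_neg, neg_neg]

/-- The form domain is dense: only `0` is orthogonal to it. -/
lemma eq_zero_of_inner_formDomain {W : L2Graph 𝕜 N}
    (h : ∀ Z : formDomain 𝕜 N, inner 𝕜 (Z : L2Graph 𝕜 N) W = 0) : W = 0 := by
  ext1 j
  refine eq_zero_of_test fun ψ hψ => ?_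
  have hm := IsTest.memLp (𝕜 := 𝕜) hψ.1.continuous hψ.2.1
  have hmem : (PiLp.single 2 j (hm.toLp _) : L2Graph 𝕜 N) ∈ formDomain 𝕜 N := by
    refine ⟨fun i => ?_, 0, fun i => ?_⟩
    · by_cases hi : i = j
      · subst hi
        simpa using isTest_mem_H1 hψ hm.coeFn_toLp
      · simp [hi]
    · by_cases hi : i = j
      · subst hi
        simpa using isTest_hasBoundaryValue hψ hm.coeFn_toLp
      · simpa [hi] using hasBoundaryValue_zero
  have h1 := h ⟨_, hmem⟩
  simp only [PiLp.inner_apply] at h1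
  rw [Finset.sum_eq_single j (fun i _ hi => by simp [hi]) (by simp)] at h1
  rw [L2.inner_def] at h1
  rw [← h1]
  refine integral_congr_ae ?_
  filter_upwards [hm.coeFn_toLp] with x hx
  simp only [PiLp.single_apply, if_true]
  rw [hx, RCLike.inner_apply, RCLike.conj_ofReal, RCLike.real_smul_eq_coe_mul, mul_comm]

/-- `W` represents the functional `form α q V ·`: for all `Z ∈ ℰ`, `B(V, Z) = (W, Z)`. (Mathlib's
inner product is conjugate-linear in the first slot, so `(W, Z)` reads `inner 𝕜 Z W`.) -/
def Represents [NeZero N] (α : ℝ) (q : Fin N → ℝ →ᵇ ℝ) (V : formDomain 𝕜 N)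
    (W : L2Graph 𝕜 N) : Prop :=
  ∀ Z : formDomain 𝕜 N, form α q V Z = inner 𝕜 (Z : L2Graph 𝕜 N) W

lemma Represents.unique [NeZero N] {α : ℝ} {q : Fin N → ℝ →ᵇ ℝ} {V : formDomain 𝕜 N}
    {W W' : L2Graph 𝕜 N} (h : Represents α q V W) (h' : Represents α q V W') : W = W' := by
  refine sub_eq_zero.1 (eq_zero_of_inner_formDomain fun Z => ?_)
  rw [inner_sub_right, ← h Z, ← h' Z, sub_self]

lemma Represents.add [NeZero N] {α : ℝ} {q : Fin N → ℝ →ᵇ ℝ} {V V' : formDomain 𝕜 N}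
    {W W' : L2Graph 𝕜 N} (h : Represents α q V W) (h' : Represents α q V' W') :
    Represents α q (V + V') (W + W') := fun Z => by
  rw [form_add_left, h Z, h' Z, inner_add_right]

lemma Represents.smul [NeZero N] {α : ℝ} {q : Fin N → ℝ →ᵇ ℝ} {V : formDomain 𝕜 N}
    {W : L2Graph 𝕜 N} (c : 𝕜) (h : Represents α q V W) :
    Represents α q (c • V) (c • W) := fun Z => by
  rw [form_smul_left, h Z, inner_smul_right]

lemma represents_zero [NeZero N] (α : ℝ) (q : Fin N → ℝ →ᵇ ℝ) :
    Represents α q (0 : formDomain 𝕜 N) 0 := fun Z => by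
  have := form_smul_left α q (0 : 𝕜) 0 Z
  rw [zero_smul, zero_mul] at this
  rw [this, inner_zero_right]

/-- The domain of the operator associated with the form: all `V ∈ ℰ` for which there is
`W ∈ L²` with `B(V, Z) = (W, Z)` for every `Z ∈ ℰ`. -/
def opDomain (𝕜 : Type*) [RCLike 𝕜] [NeZero N] (α : ℝ) (q : Fin N → ℝ →ᵇ ℝ) :
    Submodule 𝕜 (L2Graph 𝕜 N) where
  carrier := {V | ∃ V' : formDomain 𝕜 N, (V' : L2Graph 𝕜 N) = V ∧
    ∃ W : L2Graph 𝕜 N, Represents α q V' W}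
  add_mem' := by
    rintro _ _ ⟨V, rfl, W, h⟩ ⟨V', rfl, W', h'⟩
    exact ⟨V + V', rfl, W + W', h.add h'⟩
  zero_mem' := ⟨0, rfl, 0, represents_zero α q⟩
  smul_mem' := by
    rintro c _ ⟨V, rfl, W, h⟩
    exact ⟨c • V, rfl, c • W, h.smul c⟩

lemma exists_represents [NeZero N] {α : ℝ} {q : Fin N → ℝ →ᵇ ℝ} (V : opDomain 𝕜 α q) :
    ∃ W : L2Graph 𝕜 N, ∀ V' : formDomain 𝕜 N,
      (V' : L2Graph 𝕜 N) = V → Represents α q V' W := by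
  obtain ⟨V', h, W, hW⟩ := V.2
  exact ⟨W, fun V'' h'' => by rwa [Subtype.ext (h''.trans h.symm)]⟩

/-- The operator associated with the form (first representation theorem): `V ↦ W`. -/
def formOperator (𝕜 : Type*) [RCLike 𝕜] [NeZero N] (α : ℝ) (q : Fin N → ℝ →ᵇ ℝ) :
    L2Graph 𝕜 N →ₗ.[𝕜] L2Graph 𝕜 N where
  domain := opDomain 𝕜 α q
  toFun :=
    { toFun := fun V => (exists_represents V).choose
      map_add' := fun V V' => by
        obtain ⟨F, hF, -⟩ := V.2
        obtain ⟨F', hF', -⟩ := V'.2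
        refine ((exists_represents (V + V')).choose_spec (F + F') ?_).unique
          (((exists_represents V).choose_spec F hF).add
            ((exists_represents V').choose_spec F' hF'))
        rw [Submodule.coe_add, Submodule.coe_add, hF, hF']
      map_smul' := fun c V => by
        obtain ⟨F, hF, -⟩ := V.2
        refine ((exists_represents (c • V)).choose_spec (c • F) ?_).unique
          (((exists_represents V).choose_spec F hF).smul c)
        rw [Submodule.coe_smul, Submodule.coe_smul, hF] }

lemma formOperator_represents [NeZero N] (α : ℝ) (q : Fin N → ℝ →ᵇ ℝ)
    (V : (formOperator 𝕜 α q).domain) (V' : formDomain 𝕜 N) (h : (V' : L2Graph 𝕜 N) = V) :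
    Represents α q V' (formOperator 𝕜 α q V) :=
  (exists_represents V).choose_spec V' h

/-! ### The standing-wave profiles and the linearized operators -/

/-- The shift `a_k = artanh (α / ((2k - N) √ω))`. -/
def shift (N k : ℕ) (α ω : ℝ) : ℝ :=
  Real.artanh (α / ((2 * (k : ℝ) - N) * √ω))

/-- The `j`-th component of the profile `Φ_k`:
`[(p+1)ω/2 · sech² ((p-1)√ω x / 2 ∓ a_k)]^{1/(p-1)}`, with `-` on the first `k` edges and `+` on
the remaining ones (edges are numbered from `0`). -/
def profile {N : ℕ} (k : ℕ) (p α ω : ℝ) (j : Fin N) (x : ℝ) : ℝ :=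
  ((p + 1) * ω / 2 *
    (1 / Real.cosh ((p - 1) * √ω / 2 * x
      + if (j : ℕ) < k then - shift N k α ω else shift N k α ω)) ^ 2) ^ (1 / (p - 1))

lemma profile_rpow {k : ℕ} {p ω : ℝ} (hp : 1 < p) (hω : 0 < ω) (α : ℝ) (j : Fin N) (x : ℝ) :
    profile k p α ω j x ^ (p - 1) = (p + 1) * ω / 2 *
      (1 / Real.cosh ((p - 1) * √ω / 2 * x
        + if (j : ℕ) < k then - shift N k α ω else shift N k α ω)) ^ 2 := by
  have h0 : 0 ≤ (p + 1) * ω / 2 := by nlinarith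
  unfold profile
  rw [← Real.rpow_mul (mul_nonneg h0 (sq_nonneg _)), one_div_mul_cancel (by linarith),
    Real.rpow_one]

/-- The bounded continuous function `x ↦ ω - c φ_{k,j}(x)^{p-1}`. -/
def potential (k : ℕ) {p ω : ℝ} (hp : 1 < p) (hω : 0 < ω) (α c : ℝ) (j : Fin N) : ℝ →ᵇ ℝ :=
  BoundedContinuousFunction.ofNormedAddCommGroup
    (fun x => ω - c * profile k p α ω j x ^ (p - 1))
    (by
      simp only [profile_rpow hp hω]
      have (x : ℝ) := (Real.cosh_pos x).ne'
      fun_prop (disch := simp [this]))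
    (|ω| + |c| * ((p + 1) * ω / 2))
    (fun x => by
      rw [profile_rpow hp hω]
      have h0 : 0 ≤ (p + 1) * ω / 2 := by nlinarith
      set y := (p - 1) * √ω / 2 * x
        + if (j : ℕ) < k then - shift N k α ω else shift N k α ω
      have h1 : (1 / Real.cosh y) ^ 2 ≤ 1 := by
        have := Real.one_le_cosh y
        have h2 : 1 / Real.cosh y ≤ 1 := by
          rw [div_le_one (by linarith)]; exact this
        have h3 : 0 ≤ 1 / Real.cosh y := by positivity
        exact pow_le_one₀ h3 h2
      have h2 : |(p + 1) * ω / 2 * (1 / Real.cosh y) ^ 2| ≤ (p + 1) * ω / 2 := by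
        rw [abs_of_nonneg (by positivity)]
        nlinarith
      calc ‖ω - c * ((p + 1) * ω / 2 * (1 / Real.cosh y) ^ 2)‖
          ≤ |ω| + |c * ((p + 1) * ω / 2 * (1 / Real.cosh y) ^ 2)| := norm_sub_le _ _
        _ ≤ _ := by
          rw [abs_mul]
          gcongr)

/-- The operator `L_{1,k}`, associated with the form with potential `ω - p φ_{k,j}^{p-1}`. -/
def linOp₁ (𝕜 : Type*) [RCLike 𝕜] (N : ℕ) [NeZero N] (k : ℕ) (α : ℝ) {p ω : ℝ} (hp : 1 < p)
    (hω : 0 < ω) : L2Graph 𝕜 N →ₗ.[𝕜] L2Graph 𝕜 N :=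
  formOperator 𝕜 α (potential k hp hω α p)

/-- The operator `L_{2,k}`, associated with the form with potential `ω - φ_{k,j}^{p-1}`. -/
def linOp₂ (𝕜 : Type*) [RCLike 𝕜] (N : ℕ) [NeZero N] (k : ℕ) (α : ℝ) {p ω : ℝ} (hp : 1 < p)
    (hω : 0 < ω) : L2Graph 𝕜 N →ₗ.[𝕜] L2Graph 𝕜 N :=
  formOperator 𝕜 α (potential k hp hω α 1)

/-- `Φ` is the profile `Φ_k`, as an element of `L²` of the graph. -/
def IsProfile (k : ℕ) (p α ω : ℝ) (Φ : L2Graph 𝕜 N) : Prop :=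
  ∀ j, Φ j =ᵐ[halfLine] fun x => (profile k p α ω j x : 𝕜)

end StarGraph

end

/-!
Write `q` for the potential on an edge, so that `q → ω` at infinity, and `φ` for the profile.

*Spectrum.* Below `ω` the form controls the `L²` norm up to a compact term: the means over a fine
grid of a bounded interval. Hence a point of the spectrum below `ω` is isolated and an eigenvalue
of finite multiplicity. Conversely, for `κ² = r - ω ≥ 0` the wave `cos (κ x)` or `sin (κ x)`, cut
off by a widely dilated test function that escapes to infinity on one edge, is an approximate
eigenfunction for `r`. As `0 < ω`, the point `0` is isolated in the spectrum or outside it, which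
leaves a gap above `0`.

*The operator `L₂`.* The slope `h = φ' / φ` solves the Riccati equation `h' + h² = q`, and its
values at the vertex add up to `α`. Hence `B₂(V, V) = ∑ⱼ ‖vⱼ' - hⱼ vⱼ‖²`, which is nonnegative and
vanishes exactly for the multiples of `φ`.

*The operator `L₁`.* On each edge both `vⱼ`, for `V` in the kernel, and `φ'` solve `u'' = q u` and
decay, so their Wronskian vanishes. This expresses `vⱼ'(0)` through `v(0)`; the vertex condition
`∑ⱼ vⱼ'(0) = α v(0)` then forces `v(0) = 0` and `vⱼ'(0) = 0`, hence `V = 0`.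
-/

noncomputable section

/-! ### Resolvents and isolated eigenvalues -/

namespace UnboundedOp

variable {𝕜 H : Type*} [RCLike 𝕜] [NormedAddCommGroup H] [InnerProductSpace 𝕜 H]
  {A : H →ₗ.[𝕜] H} {R : H →L[𝕜] H} {l z : 𝕜} {c C : ℝ}

section Resolvent

/-- `R` is the resolvent `(A - l)⁻¹`, so that `l ∈ resolventSet A` iff such an `R` exists. -/
def IsResolvent (A : H →ₗ.[𝕜] H) (l : 𝕜) (R : H →L[𝕜] H) : Prop :=
  (∀ u : H, ∃ h : R u ∈ A.domain, A ⟨R u, h⟩ - l • R u = u) ∧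
    ∀ v : A.domain, R (A v - l • (v : H)) = v

lemma mem_eigenspace {u : H} : u ∈ eigenspace A l ↔ ∃ h : u ∈ A.domain, A ⟨u, h⟩ = l • u :=
  ⟨by rintro ⟨v, hv, rfl⟩; exact ⟨v.2, hv⟩, fun ⟨h, hu⟩ => ⟨⟨u, h⟩, hu, rfl⟩⟩

lemma eq_zero_of_bound {v : A.domain} (hc : 0 < c)
    (h : c * ‖(v : H)‖ ≤ ‖A v - l • (v : H)‖) (hv : A v = l • (v : H)) : (v : H) = 0 := by
  rw [hv, sub_self, norm_zero] at h
  exact norm_le_zero_iff.1 (nonpos_of_mul_nonpos_right h hc)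

namespace IsResolvent

lemma apply_eq (hR : IsResolvent A l R) {u : H} (h : R u ∈ A.domain) :
    A ⟨R u, h⟩ = u + l • R u :=
  sub_eq_iff_eq_add.1 (hR.1 u).2

lemma inner_comm (hA : A.IsFormalAdjoint A) {m : ℝ} (hR : IsResolvent A (m : 𝕜) R) (u w : H) :
    inner 𝕜 (R u) w = inner 𝕜 u (R w) := by
  obtain ⟨hu, -⟩ := hR.1 u
  obtain ⟨hw, -⟩ := hR.1 w
  have hsymm := hA ⟨R u, hu⟩ ⟨R w, hw⟩
  rw [hR.apply_eq, hR.apply_eq, inner_add_left, inner_add_right, inner_smul_left,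
    inner_smul_right, RCLike.conj_ofReal] at hsymm
  exact (add_right_cancel hsymm).symm

/-- `(A - z) R = 1 - (z - l) R` and `R (A - z) = 1 - (z - l) R` for `R = (A - l)⁻¹`. -/
lemma mem_resolventSet_of_bijective [CompleteSpace H] (hR : IsResolvent A l R)
    (hbij : Function.Bijective (ContinuousLinearMap.id 𝕜 H - (z - l) • R)) :
    z ∈ resolventSet A := by
  let e := ContinuousLinearEquiv.ofBijective _ (LinearMap.ker_eq_bot.2 hbij.1)
    (LinearMap.range_eq_top.2 hbij.2)
  have e_apply (u : H) : e u = u - (z - l) • R u := rfl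
  refine ⟨R ∘L (e.symm : H →L[𝕜] H), fun u => ?_, fun v => ?_⟩
  · obtain ⟨h, -⟩ := hR.1 (e.symm u)
    refine ⟨h, ?_⟩
    calc A ⟨R (e.symm u), h⟩ - z • R (e.symm u) = e (e.symm u) := by
          rw [hR.apply_eq, e_apply, sub_smul]
          abel
      _ = u := e.apply_symm_apply u
  · have he : e (A v - l • (v : H)) = A v - z • (v : H) := by
      rw [e_apply, hR.2, sub_smul]
      abel
    rw [← he]
    simp [hR.2 v]

lemma norm_le_of_bound (hR : IsResolvent A l R) (hc : 0 < c)
    (hb : ∀ v : A.domain, c * ‖(v : H)‖ ≤ ‖A v - z • (v : H)‖) (u : H) :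
    ‖u‖ ≤ (1 + ‖z - l‖ / c) * ‖u - (z - l) • R u‖ := by
  obtain ⟨h, -⟩ := hR.1 u
  have hRu : ‖R u‖ ≤ ‖u - (z - l) • R u‖ / c := by
    rw [le_div_iff₀' hc]
    refine (hb ⟨R u, h⟩).trans_eq ?_
    rw [hR.apply_eq, add_sub_assoc, ← sub_smul, ← neg_sub z, neg_smul, ← sub_eq_add_neg]
  calc ‖u‖ = ‖u - (z - l) • R u + (z - l) • R u‖ := by rw [sub_add_cancel]
    _ ≤ ‖u - (z - l) • R u‖ + ‖z - l‖ * (‖u - (z - l) • R u‖ / c) :=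
      (norm_add_le _ _).trans (by rw [norm_smul]; gcongr)
    _ = _ := by ring

lemma eq_zero_of_orthogonal_range (hA : A.IsFormalAdjoint A) {m : ℝ}
    (hR : IsResolvent A (m : 𝕜) R)
    (hk : ∀ v : A.domain, A v = star z • (v : H) → (v : H) = 0) {w : H}
    (hw : ∀ u, inner 𝕜 w (u - (z - m) • R u) = 0) : w = 0 := by
  have hwR : w = star (z - m) • R w := ext_inner_right 𝕜 fun u => by
    have hu := hw u
    rw [inner_sub_right, inner_smul_right, sub_eq_zero] at hu
    rw [inner_smul_left, hR.inner_comm hA, hu]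
    simp
  obtain ⟨h, -⟩ := hR.1 w
  have hwd : w ∈ A.domain := hwR ▸ A.domain.smul_mem _ h
  refine hk ⟨w, hwd⟩ ?_
  have hsub : (⟨w, hwd⟩ : A.domain) = star (z - m) • ⟨R w, h⟩ := Subtype.ext hwR
  rw [hsub, A.map_smul, hR.apply_eq, Submodule.coe_smul, smul_add, smul_comm, ← hwR,
    ← add_smul, star_sub]
  simp

/-- A point `z` at which `A - z` is bounded below, and which is not conjugate to an eigenvalue,
is a resolvent point of the self-adjoint operator `A`. -/
lemma mem_resolventSet [CompleteSpace H] (hA : A.IsFormalAdjoint A) {m : ℝ}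
    (hR : IsResolvent A (m : 𝕜) R) (hc : 0 < c)
    (hb : ∀ v : A.domain, c * ‖(v : H)‖ ≤ ‖A v - z • (v : H)‖)
    (hk : ∀ v : A.domain, A v = star z • (v : H) → (v : H) = 0) : z ∈ resolventSet A := by
  refine hR.mem_resolventSet_of_bijective ?_
  rw [ContinuousLinearMap.bijective_iff_dense_range_and_antilipschitz]
  refine ⟨?_, ⟨1 + ‖z - m‖ / c, by positivity⟩, .of_le_mul_dist fun x y => ?_⟩
  · rw [Submodule.topologicalClosure_eq_top_iff, Submodule.eq_bot_iff]
    refine fun w hw => hR.eq_zero_of_orthogonal_range hA hk fun u => ?_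
    exact (Submodule.mem_orthogonal' _ _).1 hw _ ⟨u, rfl⟩
  · rw [dist_eq_norm, dist_eq_norm, ← map_sub]
    exact hR.norm_le_of_bound hc hb _

end IsResolvent

lemma abs_im_mul_norm_le (hA : A.IsFormalAdjoint A) (z : 𝕜) (v : A.domain) :
    |RCLike.im z| * ‖(v : H)‖ ≤ ‖A v - z • (v : H)‖ := by
  have im_inner : RCLike.im (inner 𝕜 (v : H) (A v)) = 0 := by
    have hconj := congrArg RCLike.im (hA v v)
    rw [← inner_conj_symm, RCLike.conj_im] at hconj
    linarith
  have im_inner_sub :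
      RCLike.im (inner 𝕜 (v : H) (A v - z • (v : H))) = -(RCLike.im z * ‖(v : H)‖ ^ 2) := by
    rw [inner_sub_right, map_sub, im_inner, inner_smul_right, inner_self_eq_norm_sq_to_K,
      ← RCLike.ofReal_pow, mul_comm z, RCLike.im_ofReal_mul]
    ring
  have hsq : ‖(v : H)‖ * (|RCLike.im z| * ‖(v : H)‖) ≤ ‖(v : H)‖ * ‖A v - z • (v : H)‖ :=
    calc ‖(v : H)‖ * (|RCLike.im z| * ‖(v : H)‖)
        = |RCLike.im (inner 𝕜 (v : H) (A v - z • (v : H)))| := by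
          rw [im_inner_sub, abs_neg, abs_mul, abs_of_nonneg (sq_nonneg ‖(v : H)‖)]
          ring
      _ ≤ ‖inner 𝕜 (v : H) (A v - z • (v : H))‖ := RCLike.abs_im_le_norm _
      _ ≤ _ := norm_inner_le_norm _ _
  rcases (norm_nonneg (v : H)).eq_or_lt with hv | hv
  · rw [← hv, mul_zero]
    exact norm_nonneg _
  · exact le_of_mul_le_mul_left hsq hv

lemma mem_resolventSet_of_im_ne_zero [CompleteSpace H] (hA : A.IsFormalAdjoint A) {m : ℝ}
    (hm : (m : 𝕜) ∈ resolventSet A) (hz : RCLike.im z ≠ 0) : z ∈ resolventSet A := by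
  obtain ⟨R, hR : IsResolvent A (m : 𝕜) R⟩ := hm
  refine hR.mem_resolventSet hA (abs_pos.2 hz) (abs_im_mul_norm_le hA z) fun v hv => ?_
  refine eq_zero_of_bound (abs_pos.2 ?_) (abs_im_mul_norm_le hA (star z) v) hv
  rwa [RCLike.star_def, RCLike.conj_im, neg_ne_zero]

end Resolvent

section Discreteness

variable {F : Type*} [NormedAddCommGroup F] [NormedSpace 𝕜 F]

/-- `A - l` is bounded below modulo the finitely many functionals `ell`, which are bounded in the
graph norm of `A`. This is the hypothesis of Peetre's lemma, with `ell` in the role of the compact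
operator. -/
structure IsPeetreBound (A : H →ₗ.[𝕜] H) (l : 𝕜) (ell : A.domain →ₗ[𝕜] F) (C : ℝ) : Prop where
  norm_le : ∀ v : A.domain, ‖(v : H)‖ ≤ C * (‖A v - l • (v : H)‖ + ‖ell v‖)
  norm_apply_le : ∀ v : A.domain, ‖ell v‖ ≤ C * (‖(v : H)‖ + ‖A v‖)

lemma exists_unit_approximate_eigenvectors {K : Submodule 𝕜 H}
    (h : ∀ c > 0, ∃ v : A.domain, (v : H) ∈ K ∧ ‖A v - l • (v : H)‖ < c * ‖(v : H)‖) :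
    ∃ v : ℕ → A.domain, (∀ n, (v n : H) ∈ K) ∧ (∀ n, ‖(v n : H)‖ = 1) ∧
      Tendsto (fun n => A (v n) - l • (v n : H)) atTop (𝓝 0) := by
  choose v hvK hv using fun n : ℕ => h (1 / ((n : ℝ) + 1)) (by positivity)
  have hpos (n : ℕ) : 0 < ‖(v n : H)‖ := by
    by_contra! hn
    exact (hv n).not_ge ((mul_nonpos_of_nonneg_of_nonpos (by positivity) hn).trans (norm_nonneg _))
  have norm_inv (n : ℕ) : ‖((‖(v n : H)‖⁻¹ : ℝ) : 𝕜)‖ = ‖(v n : H)‖⁻¹ := by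
    rw [RCLike.norm_ofReal, abs_of_pos (inv_pos.2 (hpos n))]
  refine ⟨fun n => ((‖(v n : H)‖⁻¹ : ℝ) : 𝕜) • v n, fun n => K.smul_mem _ (hvK n), fun n => ?_,
    squeeze_zero_norm (fun n => ?_) tendsto_one_div_add_atTop_nhds_zero_nat⟩
  · rw [Submodule.coe_smul, norm_smul, norm_inv, inv_mul_cancel₀ (hpos n).ne']
  · rw [A.map_smul, Submodule.coe_smul, smul_comm l, ← smul_sub, norm_smul, norm_inv,
      inv_mul_le_iff₀ (hpos n), mul_comm]
    exact (hv n).le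

lemma mem_eigenspace_of_tendsto (hz : z ∈ resolventSet A) {v : ℕ → A.domain} {w : H}
    (hv : Tendsto (fun n => (v n : H)) atTop (𝓝 w))
    (hAv : Tendsto (fun n => A (v n) - l • (v n : H)) atTop (𝓝 0)) : w ∈ eigenspace A l := by
  obtain ⟨R, hR : IsResolvent A z R⟩ := hz
  have hRv (n : ℕ) : R (A (v n) - l • (v n : H) + (l - z) • (v n : H)) = v n := by
    rw [sub_smul, sub_add_sub_cancel, hR.2]
  have hlim := (R.continuous.tendsto _).comp (hAv.add (hv.const_smul (l - z)))
  simp only [Function.comp_def, hRv, zero_add] at hlim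
  have hw : w = R ((l - z) • w) := tendsto_nhds_unique hv hlim
  obtain ⟨h, -⟩ := hR.1 ((l - z) • w)
  have hwd : w ∈ A.domain := hw ▸ h
  have hsub : (⟨w, hwd⟩ : A.domain) = ⟨R ((l - z) • w), h⟩ := Subtype.ext hw
  refine mem_eigenspace.2 ⟨hwd, ?_⟩
  rw [hsub, hR.apply_eq, ← hw, ← add_smul, sub_add_cancel]

namespace IsPeetreBound

variable {ell : A.domain →ₗ[𝕜] F}

lemma finiteDimensional_eigenspace [FiniteDimensional 𝕜 F] (h : IsPeetreBound A l ell C) :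
    FiniteDimensional 𝕜 (eigenspace A l) := by
  let E := LinearMap.eqLocus A.toFun (l • A.domain.subtype)
  have hinj : Function.Injective (ell.domRestrict E) := by
    rw [← LinearMap.ker_eq_bot, LinearMap.ker_eq_bot']
    rintro ⟨v, hv : A v = l • (v : H)⟩ (hell : ell v = 0)
    have hv0 := h.norm_le v
    rw [hv, sub_self, hell, norm_zero, norm_zero, add_zero, mul_zero, norm_le_zero_iff] at hv0
    exact Subtype.ext (Subtype.ext hv0)
  have : FiniteDimensional 𝕜 E := .of_injective _ hinj
  exact inferInstanceAs (FiniteDimensional 𝕜 (E.map A.domain.subtype))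

lemma cauchySeq (h : IsPeetreBound A l ell C) {v : ℕ → A.domain}
    (hA : CauchySeq fun n => A (v n) - l • (v n : H)) (hell : CauchySeq fun n => ell (v n)) :
    CauchySeq fun n => (v n : H) := by
  rw [cauchySeq_iff_tendsto_dist_atTop_0] at hA hell ⊢
  have hsum := (hA.add hell).const_mul C
  rw [add_zero, mul_zero] at hsum
  refine squeeze_zero (fun _ => dist_nonneg) (fun n => ?_) hsum
  have hle := h.norm_le (v n.1 - v n.2)
  rwa [A.map_sub, map_sub, Submodule.coe_sub, smul_sub, sub_sub_sub_comm, ← dist_eq_norm,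
    ← dist_eq_norm, ← dist_eq_norm] at hle

lemma exists_tendsto_subseq [FiniteDimensional 𝕜 F] (h : IsPeetreBound A l ell C)
    {v : ℕ → A.domain} (hv : ∀ n, ‖(v n : H)‖ = 1)
    (hA : Tendsto (fun n => A (v n) - l • (v n : H)) atTop (𝓝 0)) :
    ∃ (φ : ℕ → ℕ) (y : F), StrictMono φ ∧ Tendsto (fun n => ell (v (φ n))) atTop (𝓝 y) := by
  have : ProperSpace F := FiniteDimensional.proper 𝕜 F
  obtain ⟨M, hM⟩ := hA.norm.bddAbove_range
  have hbound (n : ℕ) : ell (v n) ∈ Metric.closedBall 0 (|C| * (1 + (M + ‖l‖))) := by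
    rw [mem_closedBall_zero_iff]
    have hAv : ‖A (v n)‖ ≤ M + ‖l‖ := by
      calc ‖A (v n)‖ = ‖(A (v n) - l • (v n : H)) + l • (v n : H)‖ := by rw [sub_add_cancel]
        _ ≤ M + ‖l‖ := (norm_add_le _ _).trans (by
          rw [norm_smul, hv, mul_one]
          exact add_le_add_left (hM ⟨n, rfl⟩) _)
    calc ‖ell (v n)‖ ≤ C * (‖(v n : H)‖ + ‖A (v n)‖) := h.norm_apply_le _
      _ ≤ |C| * (1 + (M + ‖l‖)) := by
        rw [hv]
        gcongr
        exact le_abs_self C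
  obtain ⟨y, -, φ, hφ, hy⟩ := tendsto_subseq_of_bounded Metric.isBounded_closedBall hbound
  exact ⟨φ, y, hφ, hy⟩

lemma exists_bound_on_orthogonal [CompleteSpace H] [FiniteDimensional 𝕜 F]
    (h : IsPeetreBound A l ell C) (hz : z ∈ resolventSet A) :
    ∃ c > 0, ∀ v : A.domain, (v : H) ∈ (eigenspace A l)ᗮ →
      c * ‖(v : H)‖ ≤ ‖A v - l • (v : H)‖ := by
  by_contra! hcon
  obtain ⟨v, hvE, hv1, hAv⟩ := exists_unit_approximate_eigenvectors hcon
  obtain ⟨φ, y, hφ, hy⟩ := h.exists_tendsto_subseq hv1 hAv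
  have hAvφ := hAv.comp hφ.tendsto_atTop
  obtain ⟨w, hw⟩ := cauchySeq_tendsto_of_complete (h.cauchySeq hAvφ.cauchySeq hy.cauchySeq)
  have hw0 : w = 0 := by
    have hwE : w ∈ (eigenspace A l)ᗮ :=
      (Submodule.isClosed_orthogonal _).mem_of_tendsto hw (.of_forall fun n => hvE _)
    exact inner_self_eq_zero.1 (hwE w (mem_eigenspace_of_tendsto hz hw hAvφ))
  have hw1 : ‖w‖ = 1 := tendsto_nhds_unique hw.norm (by simp only [hv1, tendsto_const_nhds])
  rw [hw0, norm_zero] at hw1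
  exact zero_ne_one hw1

end IsPeetreBound

/-- On `(ker (A - l))ᗮ` the operator `A - z` is bounded below by `c - |z - l|`, on `ker (A - l)` it
is multiplication by `l - z`, and the two images are orthogonal. -/
lemma dist_mul_norm_add_le {l : ℝ} (hA : A.IsFormalAdjoint A)
    (hb : ∀ v : A.domain, (v : H) ∈ (eigenspace A (l : 𝕜))ᗮ →
      c * ‖(v : H)‖ ≤ ‖A v - (l : 𝕜) • (v : H)‖)
    (hz : dist z l ≤ c / 2) {e w : A.domain} (he : (e : H) ∈ eigenspace A (l : 𝕜))
    (hw : (w : H) ∈ (eigenspace A (l : 𝕜))ᗮ) :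
    dist z l * ‖((e + w : A.domain) : H)‖ ≤ ‖A (e + w) - z • ((e + w : A.domain) : H)‖ := by
  have hAe : A e = (l : 𝕜) • (e : H) := (mem_eigenspace.1 he).2
  have bound_w : dist z (l : 𝕜) * ‖(w : H)‖ ≤ ‖A w - z • (w : H)‖ := by
    have htri := norm_add_le (A w - z • (w : H)) ((z - l) • (w : H))
    rw [sub_smul, sub_add_sub_cancel, ← sub_smul, norm_smul, ← dist_eq_norm z] at htri
    nlinarith [hb w hw, norm_nonneg (w : H)]
  have orthogonal_Aw : inner 𝕜 (e : H) (A w - z • (w : H)) = 0 := by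
    rw [inner_sub_right, ← hA e w, hAe, inner_smul_left, inner_smul_right, hw e he, mul_zero,
      mul_zero, sub_zero]
  have hdecomp : A (e + w) - z • ((e + w : A.domain) : H)
      = ((l : 𝕜) - z) • (e : H) + (A w - z • (w : H)) := by
    rw [A.map_add, Submodule.coe_add, hAe, smul_add, sub_smul]
    abel
  rw [hdecomp, Submodule.coe_add]
  refine (sq_le_sq₀ (by positivity) (norm_nonneg _)).1 ?_
  calc (dist z (l : 𝕜) * ‖(e : H) + (w : H)‖) ^ 2
      = (dist z (l : 𝕜) * ‖(e : H)‖) ^ 2 + (dist z (l : 𝕜) * ‖(w : H)‖) ^ 2 := by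
        rw [mul_pow, sq ‖(e : H) + (w : H)‖,
          norm_add_sq_eq_norm_sq_add_norm_sq_of_inner_eq_zero (𝕜 := 𝕜) _ _ (hw e he)]
        ring
    _ ≤ (dist z (l : 𝕜) * ‖(e : H)‖) ^ 2 + ‖A w - z • (w : H)‖ ^ 2 := by gcongr
    _ = ‖((l : 𝕜) - z) • (e : H) + (A w - z • (w : H))‖ ^ 2 := by
        rw [sq ‖((l : 𝕜) - z) • (e : H) + (A w - z • (w : H))‖,
          norm_add_sq_eq_norm_sq_add_norm_sq_of_inner_eq_zero (𝕜 := 𝕜) _ _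
            (by rw [inner_smul_left, orthogonal_Aw, mul_zero]),
          norm_smul, ← dist_eq_norm (l : 𝕜) z, dist_comm]
        ring

lemma dist_mul_norm_le {l : ℝ} (hA : A.IsFormalAdjoint A)
    [(eigenspace A (l : 𝕜)).HasOrthogonalProjection]
    (hb : ∀ v : A.domain, (v : H) ∈ (eigenspace A (l : 𝕜))ᗮ →
      c * ‖(v : H)‖ ≤ ‖A v - (l : 𝕜) • (v : H)‖)
    (hz : dist z l ≤ c / 2) (v : A.domain) : dist z l * ‖(v : H)‖ ≤ ‖A v - z • (v : H)‖ := by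
  have hproj := (eigenspace A (l : 𝕜)).starProjection_apply_mem (v : H)
  let e : A.domain := ⟨_, (mem_eigenspace.1 hproj).1⟩
  have hw : ((v - e : A.domain) : H) ∈ (eigenspace A (l : 𝕜))ᗮ :=
    (eigenspace A (l : 𝕜)).sub_starProjection_mem_orthogonal _
  simpa only [add_sub_cancel] using dist_mul_norm_add_le (e := e) hA hb hz hproj hw

lemma exists_isolated {l : ℝ} [CompleteSpace H] (hA : A.IsFormalAdjoint A) {m : ℝ}
    (hm : (m : 𝕜) ∈ resolventSet A) [(eigenspace A (l : 𝕜)).HasOrthogonalProjection] (hc : 0 < c)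
    (hb : ∀ v : A.domain, (v : H) ∈ (eigenspace A (l : 𝕜))ᗮ →
      c * ‖(v : H)‖ ≤ ‖A v - (l : 𝕜) • (v : H)‖) :
    ∃ ε > 0, ∀ z ∈ spectrum A, dist z (l : 𝕜) < ε → z = l := by
  obtain ⟨R, hR : IsResolvent A (m : 𝕜) R⟩ := hm
  refine ⟨c / 2, half_pos hc, fun z hz hd => ?_⟩
  by_contra hne
  have hpos : 0 < dist z (l : 𝕜) := dist_pos.2 hne
  have dist_star : dist (star z) (l : 𝕜) = dist z (l : 𝕜) := by
    rw [dist_eq_norm, dist_eq_norm, ← norm_star (z - (l : 𝕜)), star_sub]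
    simp
  refine hz (hR.mem_resolventSet hA hpos (dist_mul_norm_le hA hb hd.le) fun v hv => ?_)
  refine eq_zero_of_bound (l := star z) (dist_star ▸ hpos) ?_ hv
  exact dist_mul_norm_le hA hb (dist_star.trans_le hd.le) v

lemma IsPeetreBound.isolated_and_mem_discreteSpectrum [CompleteSpace H] [FiniteDimensional 𝕜 F]
    {l : ℝ} {ell : A.domain →ₗ[𝕜] F} (h : IsPeetreBound A (l : 𝕜) ell C)
    (hA : A.IsFormalAdjoint A) {m : ℝ} (hm : (m : 𝕜) ∈ resolventSet A) :
    (∃ ε > 0, ∀ z ∈ spectrum A, dist z (l : 𝕜) < ε → z = l) ∧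
      ((l : 𝕜) ∈ spectrum A → (l : 𝕜) ∈ discreteSpectrum A) := by
  have hfin := h.finiteDimensional_eigenspace
  obtain ⟨c, hc, hb⟩ := h.exists_bound_on_orthogonal hm
  have hiso := exists_isolated hA hm hc hb
  refine ⟨hiso, fun hl => ⟨hl, hiso, fun hbot => ?_, hfin⟩⟩
  obtain ⟨R, hR : IsResolvent A (m : 𝕜) R⟩ := hm
  have hb' (v : A.domain) : c * ‖(v : H)‖ ≤ ‖A v - (l : 𝕜) • (v : H)‖ :=
    hb v (by rw [hbot, Submodule.bot_orthogonal_eq_top]; trivial)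
  refine hl (hR.mem_resolventSet hA hc hb' fun v hv => eq_zero_of_bound hc (hb' v) ?_)
  rwa [RCLike.star_def, RCLike.conj_ofReal] at hv

end Discreteness

end UnboundedOp

lemma exists_laxMilgram_solution {𝕜 G H : Type*} [RCLike 𝕜] [NormedAddCommGroup G]
    [InnerProductSpace 𝕜 G] [CompleteSpace G] [NormedAddCommGroup H] [InnerProductSpace 𝕜 H]
    [CompleteSpace H] (B : G →L⋆[𝕜] G →L[𝕜] 𝕜) (I : G →L[𝕜] H) {c : ℝ} (hc : 0 < c)
    (coercive : ∀ v, c * ‖v‖ ^ 2 ≤ RCLike.re (B v v)) :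
    ∃ S : H →L[𝕜] G, ∀ u v, S u = v ↔ ∀ w, B v w = inner 𝕜 u (I w) := by
  have inner_T (v w : G) : inner 𝕜 (InnerProductSpace.continuousLinearMapOfBilin B v) w = B v w :=
    InnerProductSpace.continuousLinearMapOfBilin_apply B v w
  obtain ⟨T, hT⟩ : IsUnit (InnerProductSpace.continuousLinearMapOfBilin B) := by
    refine ContinuousLinearMap.isUnit_of_forall_le_norm_inner_map _ (c := ⟨c, hc.le⟩) hc fun v => ?_
    rw [inner_T, mul_comm]
    exact (coercive v).trans (RCLike.re_le_norm _)
  refine ⟨(↑T⁻¹ : G →L[𝕜] G) ∘L ContinuousLinearMap.adjoint I, fun u v => ?_⟩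
  have solution_iff : (↑T⁻¹ : G →L[𝕜] G) (ContinuousLinearMap.adjoint I u) = v
      ↔ ContinuousLinearMap.adjoint I u = (↑T : G →L[𝕜] G) v := by
    constructor <;> rintro h
    · rw [← h, ← mul_apply_eq_comp, Units.mul_inv, one_apply_eq_self]
    · rw [h, ← mul_apply_eq_comp, Units.inv_mul, one_apply_eq_self]
  rw [ContinuousLinearMap.comp_apply, solution_iff, hT, ext_iff_inner_right 𝕜]
  simp only [inner_T, ContinuousLinearMap.adjoint_inner_left, eq_comm]

lemma exists_laxMilgram_solution_of_isClosed_range {𝕜 D K H : Type*} [RCLike 𝕜] [AddCommGroup D]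
    [Module 𝕜 D] [NormedAddCommGroup K] [InnerProductSpace 𝕜 K] [CompleteSpace K]
    [NormedAddCommGroup H] [InnerProductSpace 𝕜 H] [CompleteSpace H] (g : D →ₗ[𝕜] K)
    (hg : Function.Injective g) (hcl : IsClosed (LinearMap.range g : Set K)) (I : K →L[𝕜] H)
    (b : D →ₗ⋆[𝕜] D →ₗ[𝕜] 𝕜) {C c : ℝ} (hc : 0 < c)
    (bounded : ∀ v w, ‖b v w‖ ≤ C * ‖g v‖ * ‖g w‖)
    (coercive : ∀ v, c * ‖g v‖ ^ 2 ≤ RCLike.re (b v v)) :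
    ∃ S : H →L[𝕜] K, (∀ u, S u ∈ LinearMap.range g) ∧
      ∀ u v, S u = g v ↔ ∀ w, b v w = inner 𝕜 u (I (g w)) := by
  have : CompleteSpace (LinearMap.range g) := hcl.completeSpace_coe
  let e : D ≃ₗ[𝕜] LinearMap.range g := LinearEquiv.ofInjective g hg
  have apply_symm (x : LinearMap.range g) : g (e.symm x) = x :=
    congrArg Subtype.val (e.apply_symm_apply x)
  let B : LinearMap.range g →L⋆[𝕜] LinearMap.range g →L[𝕜] 𝕜 :=
    LinearMap.mkContinuous₂ ((b.comp e.symm.toLinearMap).compl₂ e.symm.toLinearMap) C fun v w => by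
      simpa [apply_symm] using bounded (e.symm v) (e.symm w)
  have B_apply (v w : D) : B (e v) (e w) = b v w := by simp [B]
  obtain ⟨S, hS⟩ := exists_laxMilgram_solution B (I ∘L (LinearMap.range g).subtypeL) hc fun x => by
    obtain ⟨v, rfl⟩ := e.surjective x
    exact (B_apply v v).symm ▸ coercive v
  refine ⟨(LinearMap.range g).subtypeL ∘L S, fun u => (S u).2, fun u v => ?_⟩
  have := hS u (e v)
  rw [Subtype.ext_iff, e.surjective.forall] at this
  simp only [B_apply] at this
  exact this

namespace StarGraph

/-! ### Weak derivatives on the half-line -/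

section Primitives

lemma absolutelyContinuousOnInterval_of_dist_le {X Y : Type*} [PseudoMetricSpace X]
    [PseudoMetricSpace Y] {f : ℝ → X} {g : ℝ → Y} {a b : ℝ}
    (hg : AbsolutelyContinuousOnInterval g a b)
    (h : ∀ x ∈ uIcc a b, ∀ y ∈ uIcc a b, dist (f x) (f y) ≤ dist (g x) (g y)) :
    AbsolutelyContinuousOnInterval f a b := by
  refine squeeze_zero' (.of_forall fun I => Finset.sum_nonneg fun i _ => dist_nonneg) ?_ hg
  refine eventually_inf_principal.2 (.of_forall fun I hI => Finset.sum_le_sum fun i hi => ?_)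
  exact h _ (hI.1 i hi).1 _ (hI.1 i hi).2

variable {E : Type*} [NormedAddCommGroup E] [NormedSpace ℝ E]

/-- The primitive `x ↦ c + ∫₀ˣ g` with prescribed value `c` at the end of the half-line. -/
def primitive (c : E) (g : ℝ → E) (x : ℝ) : E := c + ∫ t in (0 : ℝ)..x, g t

@[simp] lemma primitive_zero (c : E) (g : ℝ → E) : primitive c g 0 = c := by simp [primitive]

lemma absolutelyContinuousOnInterval_primitive {p : ℝ → E} {b : ℝ}
    (h : IntervalIntegrable p volume 0 b) (c : E) :
    AbsolutelyContinuousOnInterval (primitive c p) 0 b := by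
  refine absolutelyContinuousOnInterval_of_dist_le
    (h.norm.absolutelyContinuousOnInterval_intervalIntegral left_mem_uIcc) fun x hx y hy => ?_
  have hpx : IntervalIntegrable p volume 0 x := h.mono_set (uIcc_subset_uIcc_left hx)
  have hpy : IntervalIntegrable p volume 0 y := h.mono_set (uIcc_subset_uIcc_left hy)
  rw [primitive, primitive, dist_add_left, dist_eq_norm, Real.dist_eq,
    intervalIntegral.integral_interval_sub_left hpx hpy,
    intervalIntegral.integral_interval_sub_left hpx.norm hpy.norm]
  exact intervalIntegral.norm_integral_le_abs_integral_norm

/-- `P` is absolutely continuous on `[0, ∞)` with derivative `p`, i.e. it is a primitive of the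
locally integrable function `p` there. Nothing is required of `P` and `p` on `(-∞, 0)`. -/
def IsPrimitive (P p : ℝ → E) : Prop :=
  ∀ b : ℝ, 0 ≤ b → IntervalIntegrable p volume 0 b ∧ P b = primitive (P 0) p b

namespace IsPrimitive

variable {P p Q q : ℝ → E}

lemma sub_eq (h : IsPrimitive P p) {a b : ℝ} (ha : 0 ≤ a) (hb : 0 ≤ b) :
    P b - P a = ∫ x in a..b, p x := by
  rw [(h a ha).2, (h b hb).2, primitive, primitive, add_sub_add_left_eq_sub,
    intervalIntegral.integral_interval_sub_left (h b hb).1 (h a ha).1]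

lemma continuousOn (h : IsPrimitive P p) : ContinuousOn P (Ici 0) := by
  intro x (hx : 0 ≤ x)
  have hxb : 0 ≤ x + 1 := by linarith
  have hcont : ContinuousOn (primitive (P 0) p) (uIcc 0 (x + 1)) :=
    (absolutelyContinuousOnInterval_primitive (h _ hxb).1 _).continuousOn
  rw [uIcc_of_le hxb] at hcont
  have hP : ContinuousWithinAt P (Icc 0 (x + 1)) x :=
    (hcont x ⟨hx, by linarith⟩).congr (fun y hy => (h y hy.1).2) (h x hx).2
  refine hP.mono_of_mem_nhdsWithin ?_
  rw [← Ici_inter_Iic]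
  exact inter_mem self_mem_nhdsWithin (mem_nhdsWithin_of_mem_nhds (Iic_mem_nhds (by linarith)))

lemma of_hasDerivAt [CompleteSpace E] (h : ∀ x, HasDerivAt P (p x) x) (hp : Continuous p) :
    IsPrimitive P p := fun b _ => by
  have hi := hp.intervalIntegrable (μ := volume) 0 b
  refine ⟨hi, ?_⟩
  rw [primitive, intervalIntegral.integral_eq_sub_of_hasDerivAt (fun x _ => h x) hi,
    add_sub_cancel]

lemma congr_right (h : IsPrimitive P p) (hq : p =ᵐ[halfLine] q) : IsPrimitive P q :=
    fun b hb => by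
  have hpq : ∀ᵐ x, x ∈ uIoc 0 b → p x = q x := by
    rw [uIoc_of_le hb]
    filter_upwards [(ae_restrict_iff' measurableSet_Ioi).1 hq] with x hx hx' using hx hx'.1
  refine ⟨(h b hb).1.congr_ae ((ae_restrict_iff' measurableSet_uIoc).2 hpq), ?_⟩
  rw [(h b hb).2, primitive, primitive, intervalIntegral.integral_congr_ae hpq]

lemma eq_of_ae_eq_zero (h : IsPrimitive P p) (hp : p =ᵐ[halfLine] 0) {x : ℝ} (hx : 0 ≤ x) :
    P x = P 0 := by
  simpa [primitive] using ((h.congr_right hp) x hx).2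

lemma hasDerivWithinAt [CompleteSpace E] (h : IsPrimitive P p) (hp : ContinuousOn p (Ici 0))
    {x : ℝ} (hx : 0 ≤ x) : HasDerivWithinAt P (p x) (Ici x) x := by
  have hpx : ContinuousOn p (Ioi x) := hp.mono fun y hy => hx.trans (le_of_lt hy)
  have hd := intervalIntegral.integral_hasDerivWithinAt_right (s := Ici x) (t := Ioi x)
    (h x hx).1 (hpx.stronglyMeasurableAtFilter_nhdsWithin measurableSet_Ioi x)
    ((hp x hx).mono fun y hy => hx.trans (le_of_lt hy))
  exact (hd.const_add (P 0)).congr (fun y hy => (h y (hx.trans hy)).2) (h x hx).2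

end IsPrimitive

variable {𝕜 : Type*} [RCLike 𝕜]

lemma IsPrimitive.star {P p : ℝ → 𝕜} (h : IsPrimitive P p) :
    IsPrimitive (fun x => star (P x)) (fun x => star (p x)) := fun b hb => by
  have conj_comp := (RCLike.conjCLE (K := 𝕜)).toContinuousLinearMap.intervalIntegral_comp_comm
    (h b hb).1
  refine ⟨⟨(RCLike.conjCLE (K := 𝕜)).toContinuousLinearMap.integrable_comp (h b hb).1.1,
    (RCLike.conjCLE (K := 𝕜)).toContinuousLinearMap.integrable_comp (h b hb).1.2⟩, ?_⟩
  beta_reduce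
  rw [(h b hb).2, primitive, star_add]
  exact congrArg _ conj_comp.symm

/-- On `[0, b]` the function `P Q - ∫ (p Q + P q)` is absolutely continuous with derivative zero
almost everywhere, hence constant. -/
lemma IsPrimitive.mul {P p Q q : ℝ → 𝕜} (hP : IsPrimitive P p) (hQ : IsPrimitive Q q) :
    IsPrimitive (fun x => P x * Q x) (fun x => p x * Q x + P x * q x) := fun b hb => by
  have continuousOn_uIcc {F f : ℝ → 𝕜} (h : IsPrimitive F f) : ContinuousOn F (uIcc 0 b) := by
    rw [uIcc_of_le hb]
    exact h.continuousOn.mono Icc_subset_Ici_self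
  have hpq : IntervalIntegrable (fun x => p x * Q x + P x * q x) volume 0 b :=
    ((hP b hb).1.mul_continuousOn (continuousOn_uIcc hQ)).add
      ((hQ b hb).1.continuousOn_mul (continuousOn_uIcc hP))
  refine ⟨hpq, ?_⟩
  have hac := ((absolutelyContinuousOnInterval_primitive (hP b hb).1 (P 0)).fun_smul
    (absolutelyContinuousOnInterval_primitive (hQ b hb).1 (Q 0))).fun_sub
    (absolutelyContinuousOnInterval_primitive hpq 0)
  obtain ⟨C, hC⟩ := hac.const_of_ae_hasDerivAt_zero (by
    filter_upwards [(hP b hb).1.ae_hasDerivAt_integral, (hQ b hb).1.ae_hasDerivAt_integral,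
      hpq.ae_hasDerivAt_integral] with x hPx hQx hpqx hx
    have h0 : (0 : ℝ) ∈ uIcc 0 b := left_mem_uIcc
    have hx0 : 0 ≤ x := by
      rw [uIcc_of_le hb] at hx
      exact hx.1
    refine ((((hPx hx 0 h0).const_add (P 0)).mul ((hQx hx 0 h0).const_add (Q 0))).sub
      ((hpqx hx 0 h0).const_add 0)).congr_deriv ?_
    have hPx' := (hP x hx0).2
    have hQx' := (hQ x hx0).2
    rw [primitive] at hPx' hQx'
    rw [← hPx', ← hQx', sub_self])
  have hC0 := hC 0 left_mem_uIcc
  have hCb := hC b right_mem_uIcc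
  simp only [primitive_zero, smul_eq_mul, sub_zero] at hC0
  simp only [smul_eq_mul] at hCb
  rw [← (hP b hb).2, ← (hQ b hb).2, ← hC0, sub_eq_iff_eq_add] at hCb
  beta_reduce
  rw [hCb, primitive, primitive, zero_add]

lemma intervalIntegrable_L2 (g : L2Half 𝕜) {b : ℝ} (hb : 0 ≤ b) :
    IntervalIntegrable g volume 0 b := by
  rw [intervalIntegrable_iff_integrableOn_Ioc_of_le hb]
  have hg : MemLp g 2 (halfLine.restrict (Ioc 0 b)) := (Lp.memLp g).restrict _
  rw [Measure.restrict_restrict_of_subset Ioc_subset_Ioi_self] at hg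
  exact hg.integrable (by norm_num)

lemma isPrimitive_primitive (c : 𝕜) (g : L2Half 𝕜) : IsPrimitive (primitive c g) g :=
  fun _ hb => ⟨intervalIntegrable_L2 g hb, by rw [primitive_zero]⟩

end Primitives

section TestFunctions

lemma intervalIntegral_eq_zero_of_notMem_Icc {φ : ℝ → ℝ} {a b x : ℝ} (ha : 0 < a)
    (hφ : ∀ t ∉ Icc a b, φ t = 0) (hint : ∫ t, φ t = 0) (hx : x ∉ Icc a b) :
    ∫ t in (0 : ℝ)..x, φ t = 0 := by
  rcases lt_or_ge x a with hxa | hxa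
  · refine intervalIntegral.integral_zero_ae (.of_forall fun t ht => hφ t fun hta => ?_)
    exact absurd hta.1 (not_le.2 (ht.2.trans_lt (max_lt ha hxa)))
  · have hbx : b < x := not_le.1 fun hxb => hx ⟨hxa, hxb⟩
    rw [intervalIntegral.integral_of_le (ha.le.trans hxa),
      setIntegral_eq_integral_of_forall_compl_eq_zero, hint]
    exact fun t ht => hφ t fun hta => ht ⟨ha.trans_le hta.1, hta.2.trans hbx.le⟩

namespace IsTest

variable {φ ψ : ℝ → ℝ}

lemma eq_zero (h : IsTest ψ) {x : ℝ} (hx : x ≤ 0) : ψ x = 0 :=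
  image_eq_zero_of_notMem_tsupport fun hx' => absurd (h.2.2 hx') (not_lt.2 hx)

lemma deriv (h : IsTest ψ) : IsTest (deriv ψ) :=
  ⟨((contDiff_infty_iff_deriv (𝕜 := ℝ)).1 h.1).2, h.2.1.deriv,
    tsupport_deriv_subset.trans h.2.2⟩

lemma hasDerivAt (h : IsTest ψ) (x : ℝ) : HasDerivAt ψ (_root_.deriv ψ x) x :=
  (h.1.differentiable (by simp) x).hasDerivAt

lemma sub (h : IsTest φ) (h' : IsTest ψ) : IsTest (φ - ψ) :=
  ⟨h.1.sub h'.1, h.2.1.sub h'.2.1, (tsupport_sub _ _).trans (union_subset h.2.2 h'.2.2)⟩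

lemma mul_contDiff (h : IsTest φ) {u : ℝ → ℝ} (hu : ContDiff ℝ (⊤ : ℕ∞) u) : IsTest (φ * u) :=
  ⟨h.1.mul hu, h.2.1.mul_right, tsupport_mul_subset_left.trans h.2.2⟩

lemma integrable (h : IsTest φ) : Integrable φ :=
  h.1.continuous.integrable_of_hasCompactSupport h.2.1

lemma integral_Ioi (h : IsTest φ) : ∫ x in Ioi (0 : ℝ), φ x = ∫ x, φ x :=
  setIntegral_eq_integral_of_forall_compl_eq_zero fun _ hx => h.eq_zero (not_lt.1 hx)

lemma exists_Icc (h : IsTest φ) : ∃ a b, 0 < a ∧ a ≤ b ∧ ∀ x ∉ Icc a b, φ x = 0 := by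
  rcases (tsupport φ).eq_empty_or_nonempty with he | hne
  · exact ⟨1, 1, one_pos, le_rfl, fun x _ => image_eq_zero_of_notMem_tsupport (by simp [he])⟩
  · obtain ⟨a, ha, ha'⟩ := h.2.1.isCompact.exists_isLeast hne
    obtain ⟨b, hb, hb'⟩ := h.2.1.isCompact.exists_isGreatest hne
    exact ⟨a, b, h.2.2 ha, ha' hb, fun x hx =>
      image_eq_zero_of_notMem_tsupport fun hx' => hx ⟨ha' hx', hb' hx'⟩⟩

lemma exists_deriv_eq (h : IsTest φ) (hint : ∫ x, φ x = 0) :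
    ∃ ψ, IsTest ψ ∧ _root_.deriv ψ = φ := by
  obtain ⟨a, b, ha, -, hφ⟩ := h.exists_Icc
  have hderiv (x : ℝ) : HasDerivAt (fun x => ∫ t in (0 : ℝ)..x, φ t) (φ x) x :=
    (h.1.continuous.integral_hasStrictDerivAt 0 x).hasDerivAt
  have deriv_eq : _root_.deriv (fun x => ∫ t in (0 : ℝ)..x, φ t) = φ :=
    funext fun x => (hderiv x).deriv
  have hsupp (x : ℝ) (hx : x ∉ Icc a b) : ∫ t in (0 : ℝ)..x, φ t = 0 :=
    intervalIntegral_eq_zero_of_notMem_Icc ha hφ hint hx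
  refine ⟨_, ⟨?_, .intro' isCompact_Icc isClosed_Icc hsupp, ?_⟩, deriv_eq⟩
  · rw [contDiff_infty_iff_deriv, deriv_eq]
    exact ⟨fun x => (hderiv x).differentiableAt, h.1⟩
  · refine (closure_minimal (t := Icc a b) (fun x hx => ?_) isClosed_Icc).trans
      fun x hx => ha.trans_le hx.1
    exact not_not.1 fun hn => hx (hsupp x hn)

end IsTest

lemma exists_isTest_integral_eq_one : ∃ η, IsTest η ∧ ∫ x, η x = 1 := by
  let b : ContDiffBump (2 : ℝ) := ⟨1 / 2, 1, by norm_num, by norm_num⟩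
  refine ⟨b.normed volume, ⟨b.contDiff_normed, b.hasCompactSupport_normed, fun x hx => ?_⟩,
    b.integral_normed⟩
  rw [b.tsupport_normed_eq, Real.closedBall_eq_Icc] at hx
  exact lt_of_lt_of_le (by norm_num) (hx.1 : (2 : ℝ) - 1 ≤ x)

/-- Every test function `φ` differs from `(∫ φ) η` by the derivative of a test function, where
`∫ η = 1`. -/
lemma ae_eq_const_of_integral_deriv_smul_eq_zero {E : Type*} [NormedAddCommGroup E]
    [NormedSpace ℝ E] [CompleteSpace E] {w : ℝ → E} (hw : LocallyIntegrable w halfLine)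
    (h : ∀ ψ, IsTest ψ → ∫ x in Ioi (0 : ℝ), deriv ψ x • w x = 0) :
    ∃ c, w =ᵐ[halfLine] fun _ => c := by
  obtain ⟨η, hη, hη1⟩ := exists_isTest_integral_eq_one
  have integrable_smul {φ : ℝ → ℝ} (hφ : IsTest φ) : Integrable (fun x => φ x • w x) halfLine :=
    hw.integrable_smul_left_of_hasCompactSupport hφ.1.continuous hφ.2.1
  set c := ∫ x in Ioi (0 : ℝ), η x • w x
  have integral_smul_eq {φ : ℝ → ℝ} (hφ : IsTest φ) :
      ∫ x in Ioi (0 : ℝ), φ x • w x = (∫ x, φ x) • c := by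
    obtain ⟨ψ, hψ, hψφ⟩ :=
      (hφ.sub (hη.mul_contDiff (contDiff_const (c := ∫ x, φ x)))).exists_deriv_eq (by
        simp only [Pi.sub_apply, Pi.mul_apply]
        rw [integral_sub hφ.integrable (hη.integrable.mul_const _), integral_mul_const, hη1,
          one_mul, sub_self])
    have hzero := h ψ hψ
    simp only [hψφ, Pi.sub_apply, Pi.mul_apply, sub_smul, mul_comm (η _), mul_smul] at hzero
    rwa [integral_sub (integrable_smul hφ) (by exact (integrable_smul hη).smul (∫ x, φ x)),
      integral_smul, sub_eq_zero] at hzero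
  have hae := isOpen_Ioi.ae_eq_zero_of_integral_contDiff_smul_eq_zero (U := Ioi (0 : ℝ))
    (μ := halfLine) (f := fun x => w x - c)
    ((hw.sub (locallyIntegrable_const c)).locallyIntegrableOn _) fun φ h₁ h₂ h₃ => by
      have hφ : IsTest φ := ⟨h₁, h₂, h₃⟩
      simp only [smul_sub]
      rw [integral_sub (integrable_smul hφ) (hφ.integrable.restrict.smul_const c),
        integral_smul_const, hφ.integral_Ioi, integral_smul_eq hφ, sub_self]
  refine ⟨c, ?_⟩
  filter_upwards [hae, ae_restrict_mem measurableSet_Ioi] with x hx hx0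
  exact sub_eq_zero.1 (hx hx0)

end TestFunctions

section WeakDerivatives

variable {𝕜 : Type*} [RCLike 𝕜]

lemma hasDerivAt_ofReal_comp {f : ℝ → ℝ} {f' x : ℝ} (h : HasDerivAt f f' x) :
    HasDerivAt (fun y => (f y : 𝕜)) (f' : 𝕜) x :=
  (RCLike.ofRealCLM (K := 𝕜)).hasFDerivAt.comp_hasDerivAt x h

lemma isPrimitive_ofReal {u u' : ℝ → ℝ} (hu : ∀ x, HasDerivAt u (u' x) x) (hu' : Continuous u') :
    IsPrimitive (fun x => (u x : 𝕜)) fun x => (u' x : 𝕜) :=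
  .of_hasDerivAt (fun x => hasDerivAt_ofReal_comp (hu x)) (RCLike.continuous_ofReal.comp hu')

lemma IsPrimitive.locallyIntegrable {P p : ℝ → 𝕜} (h : IsPrimitive P p) :
    LocallyIntegrable P halfLine := by
  have hP := (locallyIntegrableOn_iff_locallyIntegrable_restrict isClosed_Ici).1
    (h.continuousOn.locallyIntegrableOn (μ := volume) measurableSet_Ici)
  rwa [← restrict_Ioi_eq_restrict_Ici] at hP

lemma IsPrimitive.integral_deriv_smul {P p : ℝ → 𝕜} (h : IsPrimitive P p) {ψ : ℝ → ℝ}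
    (hψ : IsTest ψ) :
    ∫ x in Ioi (0 : ℝ), deriv ψ x • P x = - ∫ x in Ioi (0 : ℝ), ψ x • p x := by
  obtain ⟨a, b, ha, hab, hψ0⟩ := hψ.exists_Icc
  have hb : 0 ≤ b + 1 := by linarith
  have hψ0' (x : ℝ) (hx : x ∉ Ioc 0 (b + 1)) : ψ x = 0 :=
    hψ0 x fun hx' => hx ⟨ha.trans_le hx'.1, by linarith [hx'.2]⟩
  have hdψ0 (x : ℝ) (hx : x ∉ Icc a b) : deriv ψ x = 0 := by
    have hloc : ψ =ᶠ[𝓝 x] fun _ => 0 := by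
      filter_upwards [isClosed_Icc.isOpen_compl.mem_nhds hx] with y hy using hψ0 y hy
    rw [hloc.deriv_eq, deriv_const]
  have hdψ0' (x : ℝ) (hx : x ∉ Ioc 0 (b + 1)) : deriv ψ x = 0 :=
    hdψ0 x fun hx' => hx ⟨ha.trans_le hx'.1, by linarith [hx'.2]⟩
  have integral_eq (φ : ℝ → ℝ) (f : ℝ → 𝕜) (hφ : ∀ x ∉ Ioc 0 (b + 1), φ x = 0) :
      ∫ x in Ioi (0 : ℝ), φ x • f x = ∫ x in (0 : ℝ)..(b + 1), φ x • f x := by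
    rw [intervalIntegral.integral_of_le hb]
    exact (setIntegral_eq_of_subset_of_forall_sdiff_eq_zero measurableSet_Ioi
      (fun x hx => hx.1) fun x hx => by rw [hφ x hx.2, zero_smul])
  have hdψP : IntervalIntegrable (fun x => ((deriv ψ x : ℝ) : 𝕜) * P x) volume 0 (b + 1) :=
    .continuousOn_mul (h.continuousOn.mono (by
      rw [uIcc_of_le hb]; exact Icc_subset_Ici_self)).intervalIntegrable
      (RCLike.continuous_ofReal.comp hψ.continuous_deriv).continuousOn
  have hψp : IntervalIntegrable (fun x => (ψ x : 𝕜) * p x) volume 0 (b + 1) :=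
    (h _ hb).1.continuousOn_mul (RCLike.continuous_ofReal.comp hψ.1.continuous).continuousOn
  have hparts := ((isPrimitive_ofReal hψ.hasDerivAt hψ.continuous_deriv).mul h).sub_eq le_rfl hb
  rw [intervalIntegral.integral_add hdψP hψp, hψ.eq_zero le_rfl,
    hψ0 (b + 1) fun hx => by linarith [hx.2]] at hparts
  simp only [RCLike.ofReal_zero, zero_mul, sub_zero] at hparts
  rw [integral_eq _ _ hψ0', integral_eq _ _ hdψ0']
  simp only [RCLike.real_smul_eq_coe_mul]
  exact eq_neg_of_add_eq_zero_left hparts.symm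

lemma IsPrimitive.hasWeakDeriv {f g : L2Half 𝕜} {F : ℝ → 𝕜} (hF : IsPrimitive F g)
    (hf : f =ᵐ[halfLine] F) : HasWeakDeriv f g := fun ψ hψ => by
  rw [← hF.integral_deriv_smul hψ]
  refine integral_congr_ae ?_
  filter_upwards [hf] with x hx
  rw [hx]

lemma IsPrimitive.hasBoundaryValue {f : L2Half 𝕜} {F p : ℝ → 𝕜} (hF : IsPrimitive F p)
    (hf : f =ᵐ[halfLine] F) : HasBoundaryValue f (F 0) :=
  ⟨F, hF.continuousOn, hf, rfl⟩

lemma HasWeakDeriv.exists_ae_eq_primitive {f g : L2Half 𝕜} (h : HasWeakDeriv f g) :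
    ∃ c, f =ᵐ[halfLine] primitive c g := by
  have hG := isPrimitive_primitive 0 g
  have hf : LocallyIntegrable (f : ℝ → 𝕜) halfLine :=
    (Lp.memLp f).locallyIntegrable (by norm_num)
  obtain ⟨c, hc⟩ := ae_eq_const_of_integral_deriv_smul_eq_zero
    (w := fun x => f x - primitive 0 g x) (hf.sub hG.locallyIntegrable) fun ψ hψ => by
      have hψ' := hψ.deriv
      simp only [smul_sub]
      rw [integral_sub (hf.integrable_smul_left_of_hasCompactSupport hψ'.1.continuous hψ'.2.1)
        (hG.locallyIntegrable.integrable_smul_left_of_hasCompactSupport hψ'.1.continuous hψ'.2.1),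
        h ψ hψ, hG.integral_deriv_smul hψ, sub_self]
  refine ⟨c, ?_⟩
  filter_upwards [hc] with x hx
  rw [sub_eq_iff_eq_add.1 hx, primitive, primitive, zero_add]

lemma HasWeakDeriv.exists_boundaryValue {f g : L2Half 𝕜} (h : HasWeakDeriv f g) :
    ∃ c, HasBoundaryValue f c := by
  obtain ⟨c, hc⟩ := h.exists_ae_eq_primitive
  exact ⟨_, (isPrimitive_primitive c g).hasBoundaryValue hc⟩

lemma HasWeakDeriv.ae_eq_primitive {f g : L2Half 𝕜} (h : HasWeakDeriv f g) {c : 𝕜}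
    (hc : HasBoundaryValue f c) : f =ᵐ[halfLine] primitive c g := by
  obtain ⟨d, hd⟩ := h.exists_ae_eq_primitive
  have hbv := (isPrimitive_primitive d g).hasBoundaryValue hd
  rw [primitive_zero] at hbv
  rwa [hc.unique hbv]

end WeakDerivatives

section HalfLine

variable {𝕜 : Type*} [RCLike 𝕜]

lemma memLp_mul (q : ℝ →ᵇ ℝ) (f : L2Half 𝕜) :
    MemLp (fun x => (q x : 𝕜) * f x) 2 halfLine := by
  refine (Lp.memLp f).of_le_mul (c := ‖q‖) ?_ (.of_forall fun x => ?_)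
  · exact (RCLike.continuous_ofReal.comp q.continuous).aestronglyMeasurable.mul
      (Lp.aestronglyMeasurable f)
  · rw [norm_mul, RCLike.norm_ofReal]
    gcongr
    exact q.norm_coe_le_norm x

/-- Multiplication by the bounded continuous function `q`, as an operator on `L²(0, ∞)`. -/
def mulL2 (q : ℝ →ᵇ ℝ) : L2Half 𝕜 →L[𝕜] L2Half 𝕜 :=
  LinearMap.mkContinuous
    { toFun := fun f => (memLp_mul q f).toLp _
      map_add' := fun f g => Lp.ext <| by
        filter_upwards [(memLp_mul q (f + g)).coeFn_toLp, (memLp_mul q f).coeFn_toLp,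
          (memLp_mul q g).coeFn_toLp, Lp.coeFn_add f g,
          Lp.coeFn_add ((memLp_mul q f).toLp _) ((memLp_mul q g).toLp _)] with x h₁ h₂ h₃ h₄ h₅
        rw [h₅, Pi.add_apply, h₁, h₂, h₃, h₄, Pi.add_apply, mul_add]
      map_smul' := fun c f => Lp.ext <| by
        filter_upwards [(memLp_mul q (c • f)).coeFn_toLp, (memLp_mul q f).coeFn_toLp,
          Lp.coeFn_smul c f, Lp.coeFn_smul c ((memLp_mul q f).toLp _)] with x h₁ h₂ h₃ h₄
        rw [RingHom.id_apply, h₄, Pi.smul_apply, h₁, h₂, h₃, Pi.smul_apply, smul_eq_mul,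
          smul_eq_mul, mul_left_comm] }
    ‖q‖ fun f => Lp.norm_le_mul_norm_of_ae_le_mul <| by
      filter_upwards [(memLp_mul q f).coeFn_toLp] with x hx
      rw [LinearMap.coe_mk, AddHom.coe_mk, hx, norm_mul, RCLike.norm_ofReal]
      gcongr
      exact q.norm_coe_le_norm x

lemma coeFn_mulL2 (q : ℝ →ᵇ ℝ) (f : L2Half 𝕜) :
    mulL2 q f =ᵐ[halfLine] fun x => (q x : 𝕜) * f x := (memLp_mul q f).coeFn_toLp

lemma mulL2_mul (q r : ℝ →ᵇ ℝ) (f : L2Half 𝕜) : mulL2 (q * r) f = mulL2 q (mulL2 r f) := by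
  refine Lp.ext ?_
  filter_upwards [coeFn_mulL2 (q * r) f, coeFn_mulL2 q (mulL2 r f), coeFn_mulL2 r f]
    with x h₁ h₂ h₃
  rw [h₁, h₂, h₃, BoundedContinuousFunction.mul_apply, RCLike.ofReal_mul, mul_assoc]

lemma mulL2_sub (q r : ℝ →ᵇ ℝ) (f : L2Half 𝕜) : mulL2 (q - r) f = mulL2 q f - mulL2 r f := by
  refine Lp.ext ?_
  filter_upwards [coeFn_mulL2 (q - r) f, coeFn_mulL2 q f, coeFn_mulL2 r f,
    Lp.coeFn_sub (mulL2 q f) (mulL2 r f)] with x h₁ h₂ h₃ h₄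
  rw [h₄, Pi.sub_apply, h₁, h₂, h₃, BoundedContinuousFunction.sub_apply, RCLike.ofReal_sub,
    sub_mul]

lemma inner_eq_integral (f g : L2Half 𝕜) :
    inner 𝕜 g f = ∫ x in Ioi (0 : ℝ), f x * star (g x) := by
  rw [L2.inner_def]
  rfl

lemma inner_mulL2_right (q : ℝ →ᵇ ℝ) (f g : L2Half 𝕜) :
    inner 𝕜 g (mulL2 q f) = ∫ x in Ioi (0 : ℝ), (q x : 𝕜) * (f x * star (g x)) := by
  rw [inner_eq_integral]
  refine integral_congr_ae ?_
  filter_upwards [coeFn_mulL2 q f] with x hx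
  rw [hx, mul_assoc]

lemma inner_mulL2_left (q : ℝ →ᵇ ℝ) (f g : L2Half 𝕜) :
    inner 𝕜 (mulL2 q g) f = inner 𝕜 g (mulL2 q f) := by
  rw [inner_mulL2_right, inner_eq_integral]
  refine integral_congr_ae ?_
  filter_upwards [coeFn_mulL2 q g] with x hx
  rw [hx, star_mul', RCLike.star_def, RCLike.conj_ofReal]
  ring

lemma inner_mulL2_self (q : ℝ →ᵇ ℝ) (f : L2Half 𝕜) :
    inner 𝕜 f (mulL2 q f) = ((∫ x in Ioi (0 : ℝ), q x * ‖f x‖ ^ 2 : ℝ) : 𝕜) := by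
  rw [inner_mulL2_right, ← integral_ofReal]
  congr 1 with x
  rw [RCLike.star_def, RCLike.mul_conj, RCLike.ofReal_mul, RCLike.ofReal_pow]

lemma integrable_norm_sq (f : L2Half 𝕜) : Integrable (fun x => ‖f x‖ ^ 2) halfLine :=
  (memLp_two_iff_integrable_sq_norm (Lp.aestronglyMeasurable f)).1 (Lp.memLp f)

lemma norm_sq_eq_integral (f : L2Half 𝕜) : ‖f‖ ^ 2 = ∫ x in Ioi (0 : ℝ), ‖f x‖ ^ 2 := by
  refine RCLike.ofReal_injective (K := 𝕜) ?_
  rw [RCLike.ofReal_pow, ← inner_self_eq_norm_sq_to_K, inner_eq_integral, ← integral_ofReal]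
  congr 1 with x
  rw [RCLike.star_def, RCLike.mul_conj, RCLike.ofReal_pow]

lemma IsPrimitive.integral_Ioi {P p : ℝ → 𝕜} (h : IsPrimitive P p) (hP : Integrable P halfLine)
    (hp : Integrable p halfLine) : ∫ x in Ioi (0 : ℝ), p x = - P 0 := by
  have tendsto_P : Tendsto P atTop (𝓝 (P 0 + ∫ x in Ioi (0 : ℝ), p x)) := by
    refine ((intervalIntegral_tendsto_integral_Ioi 0 hp tendsto_id).const_add _).congr' ?_
    filter_upwards [eventually_ge_atTop 0] with b hb using (h b hb).2.symm
  have integrableAt_P : IntegrableAtFilter P atTop volume := ⟨Ioi 0, Ioi_mem_atTop 0, hP⟩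
  refine eq_neg_of_add_eq_zero_right (integrableAt_P.eq_zero_of_tendsto (fun s hs => ?_) tendsto_P)
  obtain ⟨a, ha⟩ := mem_atTop_sets.1 hs
  exact measure_mono_top (fun x hx => ha x hx : Ici a ⊆ s) Real.volume_Ici

lemma HasWeakDeriv.inner_add_inner {f g f' g' : L2Half 𝕜} {c d : 𝕜} (hf : HasWeakDeriv f f')
    (hc : HasBoundaryValue f c) (hg : HasWeakDeriv g g') (hd : HasBoundaryValue g d) :
    inner 𝕜 g f' + inner 𝕜 g' f = -(c * star d) := by
  have hprod := (isPrimitive_primitive c f').mul (isPrimitive_primitive d g').star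
  have prod_ae : (fun x => f x * star (g x)) =ᵐ[halfLine]
      fun x => primitive c f' x * star (primitive d g' x) := by
    filter_upwards [hf.ae_eq_primitive hc, hg.ae_eq_primitive hd] with x hx hx'
    rw [hx, hx']
  have deriv_ae : (fun x => f' x * star (g x) + f x * star (g' x)) =ᵐ[halfLine]
      fun x => f' x * star (primitive d g' x) + primitive c f' x * star (g' x) := by
    filter_upwards [hf.ae_eq_primitive hc, hg.ae_eq_primitive hd] with x hx hx'
    rw [hx, hx']
  have deriv_integrable := (integrable_mul_star f' g).add (integrable_mul_star f g')
  rw [inner_eq_integral, inner_eq_integral, ← integral_add (integrable_mul_star f' g)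
    (integrable_mul_star f g'), integral_congr_ae deriv_ae,
    hprod.integral_Ioi ((integrable_mul_star f g).congr prod_ae)
    (deriv_integrable.congr deriv_ae), primitive_zero, primitive_zero]

lemma HasWeakDeriv.mulL2 {f f' : L2Half 𝕜} (hf : HasWeakDeriv f f') {u u' : ℝ →ᵇ ℝ}
    (hu : ∀ x, HasDerivAt u (u' x) x) :
    HasWeakDeriv (mulL2 u f) (mulL2 u' f + mulL2 u f') := by
  obtain ⟨c, hc⟩ := hf.exists_ae_eq_primitive
  refine (((isPrimitive_ofReal hu u'.continuous).mul
    (isPrimitive_primitive c f')).congr_right ?_).hasWeakDeriv ?_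
  · filter_upwards [hc, Lp.coeFn_add (StarGraph.mulL2 u' f) (StarGraph.mulL2 u f'),
      coeFn_mulL2 u' f, coeFn_mulL2 u f'] with x h₁ h₂ h₃ h₄
    rw [h₂, Pi.add_apply, h₃, h₄, h₁]
  · filter_upwards [coeFn_mulL2 u f, hc] with x h₁ h₂
    rw [h₁, h₂]

lemma HasBoundaryValue.mulL2 {f : L2Half 𝕜} {c : 𝕜} (hf : HasBoundaryValue f c) (u : ℝ →ᵇ ℝ) :
    HasBoundaryValue (mulL2 u f) (u 0 * c) := by
  obtain ⟨F, hF, hfF, rfl⟩ := hf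
  refine ⟨fun x => u x * F x,
    (RCLike.continuous_ofReal.comp u.continuous).continuousOn.mul hF, ?_, rfl⟩
  filter_upwards [coeFn_mulL2 u f, hfF] with x h₁ h₂
  rw [h₁, h₂]

lemma HasWeakDeriv.norm_sq_boundaryValue_le {f f' : L2Half 𝕜} {c : 𝕜} (hf : HasWeakDeriv f f')
    (hc : HasBoundaryValue f c) : ‖c‖ ^ 2 ≤ 2 * (‖f‖ * ‖f'‖) :=
  calc ‖c‖ ^ 2 = ‖inner 𝕜 f f' + inner 𝕜 f' f‖ := by
        rw [hf.inner_add_inner hc hf hc, norm_neg, norm_mul, norm_star, sq]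
    _ ≤ ‖f‖ * ‖f'‖ + ‖f'‖ * ‖f‖ :=
        (norm_add_le _ _).trans (add_le_add (norm_inner_le_norm _ _) (norm_inner_le_norm _ _))
    _ = 2 * (‖f‖ * ‖f'‖) := by ring

lemma HasWeakDeriv.sub {f g f' g' : L2Half 𝕜} (hf : HasWeakDeriv f f')
    (hg : HasWeakDeriv g g') : HasWeakDeriv (f - g) (f' - g') := by
  simpa [sub_eq_add_neg] using hf.add (hg.smul (-1))

lemma HasBoundaryValue.sub {f g : L2Half 𝕜} {c d : 𝕜} (hf : HasBoundaryValue f c)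
    (hg : HasBoundaryValue g d) : HasBoundaryValue (f - g) (c - d) := by
  simpa [sub_eq_add_neg] using hf.add (hg.smul (-1))

lemma continuous_integral_smul {ψ : ℝ → ℝ} (hc : Continuous ψ) (hs : HasCompactSupport ψ) :
    Continuous fun f : L2Half 𝕜 => ∫ x in Ioi (0 : ℝ), ψ x • f x := by
  have hψ := IsTest.memLp (𝕜 := 𝕜) hc hs
  have eq_inner (f : L2Half 𝕜) :
      ∫ x in Ioi (0 : ℝ), ψ x • f x = inner 𝕜 (hψ.toLp _) f := by
    rw [inner_eq_integral]
    refine integral_congr_ae ?_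
    filter_upwards [hψ.coeFn_toLp] with x hx
    rw [hx, RCLike.star_def, RCLike.conj_ofReal, RCLike.real_smul_eq_coe_mul, mul_comm]
  simp only [eq_inner]
  fun_prop

lemma HasWeakDeriv.of_tendsto {f g : ℕ → L2Half 𝕜} {f₀ g₀ : L2Half 𝕜}
    (h : ∀ n, HasWeakDeriv (f n) (g n)) (hf : Tendsto f atTop (𝓝 f₀))
    (hg : Tendsto g atTop (𝓝 g₀)) : HasWeakDeriv f₀ g₀ := fun ψ hψ => by
  have lim_f := ((continuous_integral_smul (𝕜 := 𝕜) hψ.continuous_deriv hψ.2.1.deriv).tendsto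
    f₀).comp hf
  have lim_g := (((continuous_integral_smul (𝕜 := 𝕜) hψ.1.continuous hψ.2.1).tendsto
    g₀).comp hg).neg
  exact tendsto_nhds_unique lim_f (lim_g.congr fun n => (h n ψ hψ).symm)

lemma tendsto_boundaryValue {f g : ℕ → L2Half 𝕜} {f₀ g₀ : L2Half 𝕜} {c : ℕ → 𝕜} {c₀ : 𝕜}
    (h : ∀ n, HasWeakDeriv (f n) (g n)) (hc : ∀ n, HasBoundaryValue (f n) (c n))
    (hc₀ : HasBoundaryValue f₀ c₀) (hf : Tendsto f atTop (𝓝 f₀)) (hg : Tendsto g atTop (𝓝 g₀)) :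
    Tendsto c atTop (𝓝 c₀) := by
  have trace_le (n : ℕ) : ‖c n - c₀‖ ^ 2 ≤ 2 * (‖f n - f₀‖ * ‖g n - g₀‖) :=
    ((h n).sub (.of_tendsto h hf hg)).norm_sq_boundaryValue_le ((hc n).sub hc₀)
  have lim_bound := ((tendsto_iff_norm_sub_tendsto_zero.1 hf).mul
    (tendsto_iff_norm_sub_tendsto_zero.1 hg)).const_mul 2
  rw [mul_zero, mul_zero] at lim_bound
  rw [tendsto_iff_norm_sub_tendsto_zero]
  simpa using (squeeze_zero (fun n => sq_nonneg _) trace_le lim_bound).sqrt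

end HalfLine

variable {𝕜 : Type*} [RCLike 𝕜] {N : ℕ}

/-! ### The operator of the form -/

section FormOperator

section Edges

lemma hasWeakDeriv_edgeDeriv (j : Fin N) (V : formDomain 𝕜 N) :
    HasWeakDeriv ((V : L2Graph 𝕜 N) j) (edgeDeriv j V) := (V.2.1 j).choose_spec

lemma edgeDeriv_eq {V : formDomain 𝕜 N} {j : Fin N} {g : L2Half 𝕜}
    (h : HasWeakDeriv ((V : L2Graph 𝕜 N) j) g) : edgeDeriv j V = g :=
  (hasWeakDeriv_edgeDeriv j V).unique h

/-- The weak derivative `V ↦ V' = (v₁', …, v_N')` on the form domain. -/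
def graphDeriv : formDomain 𝕜 N →ₗ[𝕜] L2Graph 𝕜 N where
  toFun V := WithLp.toLp 2 fun j => edgeDeriv j V
  map_add' V W := by ext1 j; exact map_add (edgeDeriv j) V W
  map_smul' c V := by ext1 j; exact map_smul (edgeDeriv j) c V

lemma graphDeriv_apply (V : formDomain 𝕜 N) (j : Fin N) : graphDeriv V j = edgeDeriv j V := rfl

/-- Multiplication by the bounded continuous function `q j` on the `j`-th edge. -/
def mulGraph (q : Fin N → ℝ →ᵇ ℝ) : L2Graph 𝕜 N →L[𝕜] L2Graph 𝕜 N :=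
  (PiLp.continuousLinearEquiv 2 𝕜 fun _ : Fin N => L2Half 𝕜).symm.toContinuousLinearMap ∘L
    .pi fun j => mulL2 (q j) ∘L PiLp.proj 2 _ j

lemma mulGraph_apply (q : Fin N → ℝ →ᵇ ℝ) (V : L2Graph 𝕜 N) (j : Fin N) :
    mulGraph q V j = mulL2 (q j) (V j) := rfl

lemma inner_mulGraph_left (q : Fin N → ℝ →ᵇ ℝ) (V W : L2Graph 𝕜 N) :
    inner 𝕜 (mulGraph q V) W = inner 𝕜 V (mulGraph q W) := by
  simp only [PiLp.inner_apply, mulGraph_apply, inner_mulL2_left]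

variable (𝕜 N) in
/-- The map `V ↦ (V, V')` into `L² ⊕ L²`; the norm of `(V, V')` is the `H¹` norm of `V`. -/
def graphMap : formDomain 𝕜 N →ₗ[𝕜] WithLp 2 (L2Graph 𝕜 N × L2Graph 𝕜 N) where
  toFun V := WithLp.toLp 2 ((V : L2Graph 𝕜 N), graphDeriv V)
  map_add' V W := by rw [map_add]; rfl
  map_smul' c V := by rw [map_smul]; rfl

lemma graphMap_injective : Function.Injective (graphMap 𝕜 N) := fun _ _ h =>
  Subtype.ext (congrArg (fun x => x.fst) h)

lemma norm_sq_graphMap (V : formDomain 𝕜 N) :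
    ‖graphMap 𝕜 N V‖ ^ 2 = ‖(V : L2Graph 𝕜 N)‖ ^ 2 + ‖graphDeriv V‖ ^ 2 :=
  WithLp.prod_norm_sq_eq_of_L2 _

lemma norm_le_norm_graphMap (V : formDomain 𝕜 N) : ‖(V : L2Graph 𝕜 N)‖ ≤ ‖graphMap 𝕜 N V‖ :=
  le_of_sq_le_sq (by rw [norm_sq_graphMap]; nlinarith [sq_nonneg ‖graphDeriv V‖]) (norm_nonneg _)

lemma norm_graphDeriv_le_norm_graphMap (V : formDomain 𝕜 N) :
    ‖graphDeriv V‖ ≤ ‖graphMap 𝕜 N V‖ :=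
  le_of_sq_le_sq (by rw [norm_sq_graphMap]; nlinarith [sq_nonneg ‖(V : L2Graph 𝕜 N)‖])
    (norm_nonneg _)

end Edges

variable [NeZero N]

lemma hasBoundaryValue_vertexValue (j : Fin N) (V : formDomain 𝕜 N) :
    HasBoundaryValue ((V : L2Graph 𝕜 N) j) (vertexValue V) := V.2.2.choose_spec j

lemma vertexValue_eq {V : formDomain 𝕜 N} {j : Fin N} {c : 𝕜}
    (h : HasBoundaryValue ((V : L2Graph 𝕜 N) j) c) : vertexValue V = c :=
  (hasBoundaryValue_vertexValue j V).unique h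

lemma norm_sq_vertexValue_le (V : formDomain 𝕜 N) :
    ‖vertexValue V‖ ^ 2 ≤ 2 * (‖(V : L2Graph 𝕜 N)‖ * ‖graphDeriv V‖) :=
  ((hasWeakDeriv_edgeDeriv 0 V).norm_sq_boundaryValue_le (hasBoundaryValue_vertexValue 0 V)).trans
    (by gcongr; exacts [PiLp.norm_apply_le (V : L2Graph 𝕜 N) 0,
      PiLp.norm_apply_le (graphDeriv V) 0])

section Form

variable (α : ℝ) (q : Fin N → ℝ →ᵇ ℝ)

lemma form_eq (F G : formDomain 𝕜 N) :
    form α q F G = inner 𝕜 (graphDeriv G) (graphDeriv F)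
      + inner 𝕜 (G : L2Graph 𝕜 N) (mulGraph q F) + α * (vertexValue F * star (vertexValue G)) := by
  rw [form, PiLp.inner_apply, PiLp.inner_apply, ← Finset.sum_add_distrib]
  congr 1
  refine Finset.sum_congr rfl fun j _ => ?_
  rw [graphDeriv_apply, graphDeriv_apply, mulGraph_apply, inner_eq_integral, inner_mulL2_right,
    ← integral_add (integrable_mul_star _ _)]
  exact (integrable_mul_star _ _).bdd_mul (c := ‖q j‖)
    (RCLike.continuous_ofReal.comp (q j).continuous).aestronglyMeasurable
    (.of_forall fun x => (RCLike.norm_ofReal _).trans_le ((q j).norm_coe_le_norm x))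

lemma form_star (F G : formDomain 𝕜 N) : star (form α q F G) = form α q G F := by
  rw [form_eq, form_eq, star_add, star_add, RCLike.star_def, inner_conj_symm, inner_conj_symm,
    inner_mulGraph_left]
  simp only [map_mul, RCLike.conj_ofReal, RCLike.conj_conj]
  ring

lemma form_add_right (F G G' : formDomain 𝕜 N) :
    form α q F (G + G') = form α q F G + form α q F G' := by
  rw [← form_star, form_add_left, star_add, form_star, form_star]

lemma form_smul_right (c : 𝕜) (F G : formDomain 𝕜 N) :
    form α q F (c • G) = star c * form α q F G := by
  rw [← form_star, form_smul_left, star_mul', form_star]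

lemma re_form_self (F : formDomain 𝕜 N) :
    RCLike.re (form α q F F) = ‖graphDeriv F‖ ^ 2
      + RCLike.re (inner 𝕜 (F : L2Graph 𝕜 N) (mulGraph q F)) + α * ‖vertexValue F‖ ^ 2 := by
  rw [form_eq, map_add, map_add, inner_self_eq_norm_sq, RCLike.re_ofReal_mul, RCLike.star_def,
    RCLike.mul_conj, ← RCLike.ofReal_pow, RCLike.ofReal_re]

lemma le_re_form_self (F : formDomain 𝕜 N) :
    ‖graphDeriv F‖ ^ 2 / 2
        - (‖mulGraph (𝕜 := 𝕜) q‖ + 2 * α ^ 2) * ‖(F : L2Graph 𝕜 N)‖ ^ 2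
      ≤ RCLike.re (form α q F F) := by
  have potential_le := (norm_inner_le_norm (𝕜 := 𝕜) (F : L2Graph 𝕜 N) (mulGraph q F)).trans
    (mul_le_mul_of_nonneg_left ((mulGraph (𝕜 := 𝕜) q).le_opNorm (F : L2Graph 𝕜 N)) (norm_nonneg _))
  have le_potential := (abs_le.1 ((RCLike.abs_re_le_norm _).trans potential_le)).1
  have vertex_le := mul_le_mul_of_nonneg_left (norm_sq_vertexValue_le F) (abs_nonneg α)
  have le_vertex := mul_le_mul_of_nonneg_right (neg_abs_le α) (sq_nonneg ‖vertexValue F‖)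
  rw [re_form_self]
  nlinarith [sq_nonneg (‖graphDeriv F‖ - 2 * |α| * ‖(F : L2Graph 𝕜 N)‖), sq_abs α]

end Form

lemma norm_vertexValue_le_norm_graphMap (V : formDomain 𝕜 N) :
    ‖vertexValue V‖ ≤ ‖graphMap 𝕜 N V‖ := by
  refine le_of_sq_le_sq ?_ (norm_nonneg _)
  rw [norm_sq_graphMap]
  nlinarith [norm_sq_vertexValue_le V, sq_nonneg (‖(V : L2Graph 𝕜 N)‖ - ‖graphDeriv V‖)]

lemma isClosed_range_graphMap :
    IsClosed (LinearMap.range (graphMap 𝕜 N) : Set (WithLp 2 (L2Graph 𝕜 N × L2Graph 𝕜 N))) := by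
  refine IsSeqClosed.isClosed fun x y hx hy => ?_
  choose V hV using hx
  obtain rfl : (fun n => graphMap 𝕜 N (V n)) = x := funext hV
  have tendsto_fst (j : Fin N) : Tendsto (fun n => (V n : L2Graph 𝕜 N) j) atTop (𝓝 (y.fst j)) :=
    (((PiLp.continuous_apply 2 _ j).comp (WithLp.prod_continuous_ofLp 2 _ _).fst).tendsto y).comp hy
  have tendsto_snd (j : Fin N) : Tendsto (fun n => edgeDeriv j (V n)) atTop (𝓝 (y.snd j)) :=
    (((PiLp.continuous_apply 2 _ j).comp (WithLp.prod_continuous_ofLp 2 _ _).snd).tendsto y).comp hy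
  have hasWeakDeriv (j : Fin N) : HasWeakDeriv (y.fst j) (y.snd j) :=
    .of_tendsto (fun n => hasWeakDeriv_edgeDeriv j (V n)) (tendsto_fst j) (tendsto_snd j)
  choose c hc using fun j => (hasWeakDeriv j).exists_boundaryValue
  have tendsto_vertexValue (j : Fin N) : Tendsto (fun n => vertexValue (V n)) atTop (𝓝 (c j)) :=
    tendsto_boundaryValue (fun n => hasWeakDeriv_edgeDeriv j (V n))
      (fun n => hasBoundaryValue_vertexValue j (V n)) (hc j) (tendsto_fst j) (tendsto_snd j)
  have c_eq (j : Fin N) : c j = c 0 :=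
    tendsto_nhds_unique (tendsto_vertexValue j) (tendsto_vertexValue 0)
  let W : formDomain 𝕜 N := ⟨y.fst, fun j => ⟨_, hasWeakDeriv j⟩, c 0, fun j => c_eq j ▸ hc j⟩
  have graphDeriv_W : graphDeriv W = y.snd := by
    ext1 j
    exact edgeDeriv_eq (V := W) (hasWeakDeriv j)
  exact ⟨W, congrArg (fun d => WithLp.toLp 2 (y.fst, d)) graphDeriv_W⟩

section Operator

variable (α : ℝ) (q : Fin N → ℝ →ᵇ ℝ)

lemma norm_form_le (F G : formDomain 𝕜 N) :
    ‖form α q F G‖ ≤ (1 + ‖mulGraph (𝕜 := 𝕜) q‖ + |α|)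
      * ‖graphMap 𝕜 N F‖ * ‖graphMap 𝕜 N G‖ := by
  have deriv_le : ‖inner 𝕜 (graphDeriv G) (graphDeriv F)‖
      ≤ ‖graphMap 𝕜 N F‖ * ‖graphMap 𝕜 N G‖ := by
    rw [mul_comm]
    exact (norm_inner_le_norm _ _).trans (mul_le_mul (norm_graphDeriv_le_norm_graphMap G)
      (norm_graphDeriv_le_norm_graphMap F) (norm_nonneg _) (norm_nonneg _))
  have potential_le : ‖inner 𝕜 (G : L2Graph 𝕜 N) (mulGraph q (F : L2Graph 𝕜 N))‖
      ≤ ‖graphMap 𝕜 N G‖ * (‖mulGraph (𝕜 := 𝕜) q‖ * ‖graphMap 𝕜 N F‖) :=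
    (norm_inner_le_norm _ _).trans (mul_le_mul (norm_le_norm_graphMap G)
      ((mulGraph (𝕜 := 𝕜) q).le_opNorm_of_le (norm_le_norm_graphMap F)) (norm_nonneg _)
      (norm_nonneg _))
  have vertex_le : ‖(α : 𝕜) * (vertexValue F * star (vertexValue G))‖
      ≤ |α| * (‖graphMap 𝕜 N F‖ * ‖graphMap 𝕜 N G‖) := by
    rw [norm_mul, norm_mul, norm_star, RCLike.norm_ofReal]
    gcongr <;> exact norm_vertexValue_le_norm_graphMap _
  rw [form_eq]
  linarith [norm_add₃_le.trans (add_le_add_three deriv_le potential_le vertex_le)]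

variable {α q} in
lemma Represents.exists_formOperator_eq {V : formDomain 𝕜 N} {W : L2Graph 𝕜 N}
    (h : Represents α q V W) :
    ∃ hV : (V : L2Graph 𝕜 N) ∈ (formOperator 𝕜 α q).domain, formOperator 𝕜 α q ⟨V, hV⟩ = W :=
  ⟨⟨V, rfl, W, h⟩, (formOperator_represents α q _ V rfl).unique h⟩

variable {α q} in
lemma exists_formDomain_of_domain (v : (formOperator 𝕜 α q).domain) :
    ∃ V : formDomain 𝕜 N, (V : L2Graph 𝕜 N) = v ∧ Represents α q V (formOperator 𝕜 α q v) := by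
  obtain ⟨V, hV, -⟩ := v.2
  exact ⟨V, hV, formOperator_represents α q v V hV⟩

lemma isFormalAdjoint_formOperator :
    (formOperator 𝕜 α q).IsFormalAdjoint (formOperator 𝕜 α q) := fun v w => by
  obtain ⟨V, hV, hV'⟩ := exists_formDomain_of_domain v
  obtain ⟨W, hW, hW'⟩ := exists_formDomain_of_domain w
  rw [← hV, ← hW, ← inner_conj_symm, ← hV' W, ← hW' V, ← form_star α q V W]
  rfl

/-- The sesquilinear form `(V, W) ↦ form α q W V + M ⟪V, W⟫`, conjugate-linear in `V` as Mathlib's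
inner product. -/
def shiftedForm (M : ℝ) : formDomain 𝕜 N →ₗ⋆[𝕜] formDomain 𝕜 N →ₗ[𝕜] 𝕜 :=
  LinearMap.mk₂'ₛₗ (starRingEnd 𝕜) (RingHom.id 𝕜)
    (fun V W => form α q W V + M * inner 𝕜 (V : L2Graph 𝕜 N) (W : L2Graph 𝕜 N))
    (fun V V' W => by rw [form_add_right, Submodule.coe_add, inner_add_left]; ring)
    (fun c V W => by
      rw [form_smul_right, Submodule.coe_smul, inner_smul_left, RCLike.star_def, smul_eq_mul]
      ring)
    (fun V W W' => by rw [form_add_left, Submodule.coe_add, inner_add_right]; ring)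
    (fun c V W => by
      rw [form_smul_left, Submodule.coe_smul, inner_smul_right, RingHom.id_apply, smul_eq_mul]
      ring)

lemma shiftedForm_apply (M : ℝ) (V W : formDomain 𝕜 N) : shiftedForm α q M V W
    = form α q W V + M * inner 𝕜 (V : L2Graph 𝕜 N) (W : L2Graph 𝕜 N) := rfl

lemma norm_shiftedForm_le (M : ℝ) (V W : formDomain 𝕜 N) :
    ‖shiftedForm α q M V W‖ ≤ (1 + ‖mulGraph (𝕜 := 𝕜) q‖ + |α| + |M|)
      * ‖graphMap 𝕜 N V‖ * ‖graphMap 𝕜 N W‖ := by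
  have shift_le : ‖(M : 𝕜) * inner 𝕜 (V : L2Graph 𝕜 N) (W : L2Graph 𝕜 N)‖
      ≤ |M| * (‖graphMap 𝕜 N V‖ * ‖graphMap 𝕜 N W‖) := by
    rw [norm_mul, RCLike.norm_ofReal]
    exact mul_le_mul_of_nonneg_left ((norm_inner_le_norm _ _).trans (mul_le_mul
      (norm_le_norm_graphMap V) (norm_le_norm_graphMap W) (norm_nonneg _) (norm_nonneg _)))
      (abs_nonneg M)
  rw [shiftedForm_apply]
  linarith [(norm_add_le _ _).trans (add_le_add (norm_form_le α q W V) shift_le)]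

lemma exists_coercive_shiftedForm : ∃ M : ℝ, ∀ V : formDomain 𝕜 N,
    1 / 2 * ‖graphMap 𝕜 N V‖ ^ 2 ≤ RCLike.re (shiftedForm α q M V V) := by
  refine ⟨‖mulGraph (𝕜 := 𝕜) q‖ + 2 * α ^ 2 + 1 / 2, fun V => ?_⟩
  rw [shiftedForm_apply, map_add, RCLike.re_ofReal_mul, inner_self_eq_norm_sq, norm_sq_graphMap]
  linarith [le_re_form_self α q V]

variable {α q} in
lemma represents_sub_smul_iff {M : ℝ} {V : formDomain 𝕜 N} {U : L2Graph 𝕜 N} :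
    Represents α q V (U - (M : 𝕜) • (V : L2Graph 𝕜 N))
      ↔ ∀ W : formDomain 𝕜 N, shiftedForm α q M V W = inner 𝕜 U (W : L2Graph 𝕜 N) := by
  refine forall_congr' fun W => ?_
  rw [shiftedForm_apply, ← star_inj, form_star, inner_sub_right, inner_smul_right, star_sub,
    star_mul', RCLike.star_def, inner_conj_symm, inner_conj_symm, RCLike.conj_ofReal,
    eq_sub_iff_add_eq]

lemma exists_mem_resolventSet_formOperator :
    ∃ m : ℝ, (m : 𝕜) ∈ UnboundedOp.resolventSet (formOperator 𝕜 α q) := by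
  obtain ⟨M, coercive⟩ := exists_coercive_shiftedForm (𝕜 := 𝕜) α q
  let fst := WithLp.fstL 2 𝕜 (L2Graph 𝕜 N) (L2Graph 𝕜 N)
  obtain ⟨S, S_mem, hS⟩ := exists_laxMilgram_solution_of_isClosed_range (graphMap 𝕜 N)
    graphMap_injective isClosed_range_graphMap fst (shiftedForm α q M) one_half_pos
    (norm_shiftedForm_le α q M) coercive
  have solution_iff (U : L2Graph 𝕜 N) (V : formDomain 𝕜 N) :
      S U = graphMap 𝕜 N V ↔ Represents α q V (U - (M : 𝕜) • (V : L2Graph 𝕜 N)) :=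
    (hS U V).trans represents_sub_smul_iff.symm
  refine ⟨-M, fst ∘L S, fun U => ?_, fun v => ?_⟩
  · obtain ⟨V, hV⟩ := S_mem U
    obtain ⟨V_mem, op_V⟩ := ((solution_iff U V).1 hV.symm).exists_formOperator_eq
    have fst_S : (fst ∘L S) U = V := congrArg fst hV.symm
    rw [fst_S]
    refine ⟨V_mem, ?_⟩
    rw [op_V, RCLike.ofReal_neg, neg_smul, sub_neg_eq_add, sub_add_cancel]
  · obtain ⟨V, hV, hrep⟩ := exists_formDomain_of_domain v
    have S_eq : S (formOperator 𝕜 α q v - ((-M : ℝ) : 𝕜) • (v : L2Graph 𝕜 N))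
        = graphMap 𝕜 N V := by
      rwa [solution_iff, hV, RCLike.ofReal_neg, neg_smul, sub_neg_eq_add, add_sub_cancel_right]
    exact (congrArg fst S_eq).trans hV

end Operator

end FormOperator

/-! ### The spectrum below `ω` -/

lemma halfLine_Ioc_ne_top (a b : ℝ) : halfLine (Ioc a b) ≠ ∞ :=
  ((Measure.restrict_apply_le _ _).trans_lt measure_Ioc_lt_top).ne

/-- The functional `f ↦ ∫ f` over `(a, b]`, for `0 ≤ a ≤ b`. -/
def integralL2 (a b : ℝ) : L2Half 𝕜 →L[𝕜] 𝕜 :=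
  innerSL 𝕜 (indicatorConstLp 2 measurableSet_Ioc (halfLine_Ioc_ne_top a b) (1 : 𝕜))

lemma integralL2_apply (f : L2Half 𝕜) {a b : ℝ} (ha : 0 ≤ a) (hab : a ≤ b) :
    integralL2 a b f = ∫ t in a..b, f t := by
  rw [integralL2, innerSL_apply_apply, L2.inner_indicatorConstLp_one,
    intervalIntegral.integral_of_le hab,
    show halfLine.restrict (Ioc a b) = volume.restrict (Ioc a b) from
      Measure.restrict_restrict_of_subset fun x hx => ha.trans_lt hx.1]

lemma norm_integral_le_sqrt_mul_norm (g : L2Half 𝕜) {a b : ℝ} (ha : 0 ≤ a) (hab : a ≤ b) :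
    ‖∫ t in a..b, g t‖ ≤ √(b - a) * ‖g‖ := by
  have Ioc_subset : Ioc a b ⊆ Ioi 0 := fun x hx => ha.trans_lt hx.1
  rw [← integralL2_apply g ha hab, integralL2, innerSL_apply_apply]
  refine (norm_inner_le_norm _ _).trans_eq ?_
  rw [norm_indicatorConstLp (by norm_num) (by norm_num), norm_one, one_mul, measureReal_def,
    Measure.restrict_apply measurableSet_Ioc, inter_eq_left.2 Ioc_subset, Real.volume_Ioc,
    ENNReal.toReal_ofReal (sub_nonneg.2 hab), Real.sqrt_eq_rpow]
  norm_num

lemma norm_primitive_sub_le (c : 𝕜) (g : L2Half 𝕜) {a b x y : ℝ} (ha : 0 ≤ a)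
    (hx : x ∈ Icc a b) (hy : y ∈ Icc a b) :
    ‖primitive c g x - primitive c g y‖ ≤ √(b - a) * ‖g‖ := by
  wlog hyx : y ≤ x generalizing x y
  · rw [norm_sub_rev]
    exact this hy hx (le_of_not_ge hyx)
  have hy0 := ha.trans hy.1
  rw [(isPrimitive_primitive c g).sub_eq hy0 (hy0.trans hyx)]
  refine (norm_integral_le_sqrt_mul_norm g hy0 hyx).trans ?_
  gcongr
  exacts [hx.2, hy.1]

lemma HasWeakDeriv.norm_sub_integralL2_le {f g : L2Half 𝕜} {c : 𝕜} (h : HasWeakDeriv f g)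
    (hc : HasBoundaryValue f c) {a b x : ℝ} (ha : 0 ≤ a) (hab : a < b) (hx : x ∈ Icc a b) :
    ‖primitive c g x - ((b - a)⁻¹ : ℝ) • integralL2 a b f‖ ≤ √(b - a) * ‖g‖ := by
  have hba : 0 < b - a := sub_pos.2 hab
  have integral_f : integralL2 a b f = ∫ t in a..b, primitive c g t := by
    rw [integralL2_apply f ha hab.le]
    refine intervalIntegral.integral_congr_ae ?_
    filter_upwards [(ae_restrict_iff' measurableSet_Ioi).1 (h.ae_eq_primitive hc)] with t ht hta
    rw [uIoc_of_le hab.le] at hta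
    exact ht (ha.trans_lt hta.1)
  have integrable : IntervalIntegrable (primitive c g) volume a b :=
    ((isPrimitive_primitive c g).continuousOn.mono
      (by rw [uIcc_of_le hab.le]; exact fun t ht => ha.trans ht.1)).intervalIntegrable
  have integral_sub : ∫ t in a..b, (primitive c g x - primitive c g t)
      = (b - a) • (primitive c g x - ((b - a)⁻¹ : ℝ) • integralL2 a b f) := by
    rw [intervalIntegral.integral_sub intervalIntegrable_const integrable,
      intervalIntegral.integral_const, smul_sub, smul_inv_smul₀ hba.ne', integral_f]
  have norm_le := intervalIntegral.norm_integral_le_of_norm_le_const fun t ht =>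
    norm_primitive_sub_le c g ha hx (Ioc_subset_Icc_self (uIoc_of_le hab.le ▸ ht))
  rw [integral_sub, norm_smul, Real.norm_of_nonneg hba.le, abs_of_pos hba, mul_comm] at norm_le
  exact le_of_mul_le_mul_right norm_le hba

lemma exists_grid_cell {δ x : ℝ} {n : ℕ} (hδ : 0 < δ) (hx : x ∈ Ico 0 (n * δ)) :
    ∃ i : Fin n, i * δ ≤ x ∧ x < (i + 1) * δ := by
  have quotient_nonneg : 0 ≤ x / δ := div_nonneg hx.1 hδ.le
  have floor_lt : ⌊x / δ⌋₊ < n := (Nat.floor_lt quotient_nonneg).2 ((div_lt_iff₀ hδ).2 hx.2)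
  exact ⟨⟨_, floor_lt⟩, (le_div_iff₀ hδ).1 (Nat.floor_le quotient_nonneg),
    (div_lt_iff₀ hδ).1 (Nat.lt_floor_add_one _)⟩

/-- The means over a fine grid of `[0, R]` control `f` uniformly on `[0, R]` up to a small multiple
of `‖f'‖`: this is the compactness of the restriction `H¹(0, ∞) → C[0, R]`. -/
lemma exists_norm_sq_primitive_le {R ε : ℝ} (hR : 0 < R) (hε : 0 < ε) :
    ∃ (n : ℕ) (L : L2Half 𝕜 →L[𝕜] (Fin n → 𝕜)), ∀ {f g : L2Half 𝕜} {c : 𝕜},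
      HasWeakDeriv f g → HasBoundaryValue f c → ∀ x ∈ Ico 0 R,
        ‖primitive c g x‖ ^ 2 ≤ 2 * ‖L f‖ ^ 2 + ε * ‖g‖ ^ 2 := by
  obtain ⟨n, hn⟩ := exists_nat_gt (2 * R / ε)
  have n_pos : (0 : ℝ) < n := lt_trans (by positivity) hn
  set δ := R / n with hδ
  have δ_pos : 0 < δ := by positivity
  have two_δ_le : 2 * δ ≤ ε := by
    rw [div_lt_iff₀ hε] at hn
    rw [hδ, ← mul_div_assoc, div_le_iff₀ n_pos]
    linarith
  let L : L2Half 𝕜 →L[𝕜] (Fin n → 𝕜) :=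
    .pi fun i => ((δ⁻¹ : ℝ) : 𝕜) • integralL2 (i * δ) ((i + 1) * δ)
  refine ⟨n, L, fun {f g c} h hc x hx => ?_⟩
  obtain ⟨i, hi, hi'⟩ := exists_grid_cell (n := n) δ_pos
    (by rwa [hδ, mul_div_cancel₀ _ n_pos.ne'])
  have width : ((i : ℕ) + 1 : ℝ) * δ - (i : ℕ) * δ = δ := by ring
  have sub_mean_le : ‖primitive c g x - L f i‖ ≤ √δ * ‖g‖ := by
    have := h.norm_sub_integralL2_le hc (by positivity) (sub_pos.1 (δ_pos.trans_eq width.symm))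
      ⟨hi, hi'.le⟩
    rw [width, RCLike.real_smul_eq_coe_smul (K := 𝕜)] at this
    exact this
  calc ‖primitive c g x‖ ^ 2 ≤ (‖L f i‖ + ‖primitive c g x - L f i‖) ^ 2 := by
        gcongr
        exact norm_le_norm_add_norm_sub' _ _
    _ ≤ (‖L f‖ + √δ * ‖g‖) ^ 2 := by
        gcongr
        exact norm_le_pi_norm (L f) i
    _ ≤ 2 * (‖L f‖ ^ 2 + (√δ * ‖g‖) ^ 2) := add_sq_le
    _ = 2 * ‖L f‖ ^ 2 + 2 * δ * ‖g‖ ^ 2 := by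
        rw [mul_pow, Real.sq_sqrt δ_pos.le]
        ring
    _ ≤ 2 * ‖L f‖ ^ 2 + ε * ‖g‖ ^ 2 := by gcongr

lemma HasWeakDeriv.setIntegral_norm_sq_le {f g : L2Half 𝕜} {c : 𝕜} (h : HasWeakDeriv f g)
    (hc : HasBoundaryValue f c) {R B : ℝ} (hR : 0 ≤ R)
    (hB : ∀ x ∈ Ico 0 R, ‖primitive c g x‖ ^ 2 ≤ B) : ∫ x in Ioo 0 R, ‖f x‖ ^ 2 ≤ R * B := by
  refine (setIntegral_mono_on_ae (g := fun _ => B)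
    ((integrable_norm_sq f).mono_measure (Measure.restrict_mono Ioo_subset_Ioi_self le_rfl))
    (integrableOn_const measure_Ioo_lt_top.ne) measurableSet_Ioo ?_).trans_eq ?_
  · filter_upwards [(ae_restrict_iff' measurableSet_Ioi).1 (h.ae_eq_primitive hc)] with x hx hxR
    rw [hx hxR.1]
    exact hB x ⟨hxR.1.le, hxR.2⟩
  · rw [setIntegral_const, Real.volume_real_Ioo_of_le hR, sub_zero, smul_eq_mul]

lemma mul_norm_sq_sub_setIntegral_le (q : ℝ →ᵇ ℝ) {m R : ℝ} (hq : ∀ x, R ≤ x → m ≤ q x)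
    (f : L2Half 𝕜) :
    m * ‖f‖ ^ 2 - (‖q‖ + |m|) * ∫ x in Ioo 0 R, ‖f x‖ ^ 2
      ≤ RCLike.re (inner 𝕜 f (mulL2 q f)) := by
  have integrable := integrable_norm_sq f
  have integrable_Ioo := (integrable.indicator (measurableSet_Ioo (a := 0) (b := R))).const_mul
    (‖q‖ + |m|)
  have setIntegral_eq : ∫ x in Ioo 0 R, ‖f x‖ ^ 2
      = ∫ x in Ioi (0 : ℝ), (Ioo 0 R).indicator (fun x => ‖f x‖ ^ 2) x := by
    rw [integral_indicator measurableSet_Ioo,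
      Measure.restrict_restrict_of_subset Ioo_subset_Ioi_self]
  rw [inner_mulL2_self, RCLike.ofReal_re, norm_sq_eq_integral, setIntegral_eq,
    ← integral_const_mul, ← integral_const_mul, ← integral_sub (integrable.const_mul _)
      integrable_Ioo]
  refine setIntegral_mono_on ((integrable.const_mul _).sub integrable_Ioo)
    (integrable.bdd_mul (c := ‖q‖) q.continuous.aestronglyMeasurable
      (.of_forall q.norm_coe_le_norm)) measurableSet_Ioi fun x hx => ?_
  rcases le_or_gt R x with hRx | hxR
  · rw [indicator_of_notMem (fun h => hRx.not_gt h.2), mul_zero, sub_zero]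
    gcongr
    exact hq x hRx
  · rw [indicator_of_mem (show x ∈ Ioo 0 R from ⟨hx, hxR⟩), ← sub_mul]
    gcongr
    linarith [(abs_le.1 (q.norm_coe_le_norm x)).1, le_abs_self m]

lemma exists_mul_norm_sq_le_edge {q : ℝ →ᵇ ℝ} {ω m A : ℝ} (hq : Tendsto q atTop (𝓝 ω))
    (hm : m < ω) (hA : 0 ≤ A) :
    ∃ (n : ℕ) (L : L2Half 𝕜 →L[𝕜] (Fin n → 𝕜)), ∀ {f g : L2Half 𝕜} {c : 𝕜},
      HasWeakDeriv f g → HasBoundaryValue f c →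
        m * ‖f‖ ^ 2 + A * ‖c‖ ^ 2
          ≤ ‖g‖ ^ 2 + RCLike.re (inner 𝕜 f (mulL2 q f)) + ‖L f‖ ^ 2 := by
  obtain ⟨R, R_pos, le_q⟩ : ∃ R : ℝ, 0 < R ∧ ∀ x, R ≤ x → m ≤ q x := by
    obtain ⟨R, hR⟩ := eventually_atTop.1 (hq.eventually_const_le hm)
    exact ⟨max R 1, by positivity, fun x hx => hR x ((le_max_left _ _).trans hx)⟩
  let K := (‖q‖ + |m|) * R + A
  obtain ⟨n, L, hL⟩ := exists_norm_sq_primitive_le (𝕜 := 𝕜) R_pos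
    (one_div_pos.2 (show 0 < K + 1 by positivity))
  refine ⟨n, ((√(2 * K) : ℝ) : 𝕜) • L, fun {f g c} h hc => ?_⟩
  set B := 2 * ‖L f‖ ^ 2 + 1 / (K + 1) * ‖g‖ ^ 2
  have boundary_le : ‖c‖ ^ 2 ≤ B := by
    simpa only [primitive_zero] using hL h hc 0 ⟨le_rfl, R_pos⟩
  have setIntegral_le : ∫ x in Ioo 0 R, ‖f x‖ ^ 2 ≤ R * B :=
    h.setIntegral_norm_sq_le hc R_pos.le (hL h hc)
  have K_mul_le : K * B ≤ ‖((√(2 * K) : ℝ) : 𝕜) • L f‖ ^ 2 + ‖g‖ ^ 2 := by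
    have : K * (1 / (K + 1)) ≤ 1 := by
      rw [mul_one_div, div_le_one (by positivity)]
      linarith
    rw [norm_smul, RCLike.norm_ofReal, mul_pow, sq_abs, Real.sq_sqrt (by positivity)]
    nlinarith [mul_le_mul_of_nonneg_right this (sq_nonneg ‖g‖)]
  have potential := mul_norm_sq_sub_setIntegral_le q le_q f
  have := mul_le_mul_of_nonneg_left setIntegral_le (show 0 ≤ ‖q‖ + |m| by positivity)
  have := mul_le_mul_of_nonneg_left boundary_le hA
  rw [smul_apply]
  nlinarith

lemma le_mul_add_of_mul_sq_le {η a b e : ℝ} (hη : 0 < η) (hb : 0 ≤ b) (he : 0 ≤ e)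
    (h : η * a ^ 2 ≤ a * b + e ^ 2) : a ≤ (1 + 2 / η) * (b + e) := by
  by_contra! hlt
  have two_lt : 2 * (b + e) < η * a := by
    rw [add_mul, one_mul, div_mul_eq_mul_div] at hlt
    have : 2 * (b + e) / η < a := by linarith
    rw [div_lt_iff₀ hη] at this
    linarith
  have lt : b + e < a := by
    have : 0 ≤ 2 / η * (b + e) := by positivity
    linarith
  nlinarith

section Graph

variable [NeZero N] {α : ℝ} {q : Fin N → ℝ →ᵇ ℝ}

lemma exists_mul_norm_sq_le_form (α : ℝ) {ω m : ℝ} (hq : ∀ j, Tendsto (q j) atTop (𝓝 ω))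
    (hm : m < ω) :
    ∃ (n : Fin N → ℕ) (L : L2Graph 𝕜 N →L[𝕜] PiLp 2 fun j => Fin (n j) → 𝕜),
      ∀ V : formDomain 𝕜 N,
        m * ‖(V : L2Graph 𝕜 N)‖ ^ 2 ≤ RCLike.re (form α q V V) + ‖L V‖ ^ 2 := by
  choose n L hL using fun j => exists_mul_norm_sq_le_edge (𝕜 := 𝕜) (hq j) hm (abs_nonneg α)
  let L' : L2Graph 𝕜 N →L[𝕜] PiLp 2 fun j => Fin (n j) → 𝕜 :=
    (PiLp.continuousLinearEquiv 2 𝕜 fun j => Fin (n j) → 𝕜).symm.toContinuousLinearMap ∘L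
      .pi fun j => L j ∘L PiLp.proj 2 _ j
  refine ⟨n, L', fun V => ?_⟩
  have sum_le := Finset.sum_le_sum fun j (_ : j ∈ Finset.univ) =>
    hL j (hasWeakDeriv_edgeDeriv j V) (hasBoundaryValue_vertexValue j V)
  have norm_L' : ‖L' V‖ ^ 2 = ∑ j, ‖L j ((V : L2Graph 𝕜 N) j)‖ ^ 2 := PiLp.norm_sq_eq_of_L2 _ _
  have norm_graphDeriv : ‖graphDeriv V‖ ^ 2 = ∑ j, ‖edgeDeriv j V‖ ^ 2 :=
    PiLp.norm_sq_eq_of_L2 _ _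
  have vertex_le : -(α * ‖vertexValue V‖ ^ 2) ≤ N * (|α| * ‖vertexValue V‖ ^ 2) := by
    have one_le : (1 : ℝ) ≤ N := Nat.one_le_cast.2 (NeZero.one_le)
    nlinarith [neg_abs_le α, sq_nonneg ‖vertexValue V‖, mul_nonneg (abs_nonneg α)
      (sq_nonneg ‖vertexValue V‖)]
  simp only [Finset.sum_add_distrib, ← Finset.mul_sum, Finset.sum_const, Finset.card_univ,
    Fintype.card_fin, nsmul_eq_mul, ← norm_L', ← norm_graphDeriv, ← map_sum] at sum_le
  rw [PiLp.norm_sq_eq_of_L2, re_form_self, PiLp.inner_apply]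
  simp only [mulGraph_apply]
  linarith

lemma Represents.re_form_le {V : formDomain 𝕜 N} {W : L2Graph 𝕜 N} (h : Represents α q V W)
    (l : ℝ) : RCLike.re (form α q V V) ≤ l * ‖(V : L2Graph 𝕜 N)‖ ^ 2
      + ‖(V : L2Graph 𝕜 N)‖ * ‖W - (l : 𝕜) • (V : L2Graph 𝕜 N)‖ := by
  have cauchy_schwarz := (RCLike.re_le_norm _).trans (norm_inner_le_norm (𝕜 := 𝕜)
    (V : L2Graph 𝕜 N) (W - (l : 𝕜) • (V : L2Graph 𝕜 N)))
  rw [inner_sub_right, inner_smul_right, inner_self_eq_norm_sq_to_K, ← RCLike.ofReal_pow,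
    ← RCLike.ofReal_mul, map_sub, RCLike.ofReal_re, ← h V] at cauchy_schwarz
  linarith

lemma exists_isPeetreBound_formOperator (α : ℝ) {ω l : ℝ}
    (hq : ∀ j, Tendsto (q j) atTop (𝓝 ω)) (hl : l < ω) :
    ∃ (n : Fin N → ℕ) (L : L2Graph 𝕜 N →L[𝕜] PiLp 2 fun j => Fin (n j) → 𝕜) (C : ℝ),
      UnboundedOp.IsPeetreBound (formOperator 𝕜 α q) (l : 𝕜)
        (L.toLinearMap ∘ₗ (formOperator 𝕜 α q).domain.subtype) C := by
  obtain ⟨m, hlm, hmω⟩ := exists_between hl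
  obtain ⟨n, L, hL⟩ := exists_mul_norm_sq_le_form (𝕜 := 𝕜) α hq hmω
  refine ⟨n, L, max (1 + 2 / (m - l)) ‖L‖, fun v => ?_, fun v => ?_⟩
  · obtain ⟨V, hV, hrep⟩ := exists_formDomain_of_domain v
    have quadratic : (m - l) * ‖(v : L2Graph 𝕜 N)‖ ^ 2 ≤ ‖(v : L2Graph 𝕜 N)‖
        * ‖formOperator 𝕜 α q v - (l : 𝕜) • (v : L2Graph 𝕜 N)‖ + ‖L v‖ ^ 2 := by
      rw [← hV]
      linarith [hL V, hrep.re_form_le l]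
    refine (le_mul_add_of_mul_sq_le (sub_pos.2 hlm) (norm_nonneg _) (norm_nonneg _)
      quadratic).trans ?_
    gcongr ?_ * (_ + ?_)
    exacts [le_max_left _ _, le_rfl]
  · refine (L.le_opNorm v).trans ?_
    gcongr
    · exact le_max_right _ _
    · exact le_add_of_nonneg_right (norm_nonneg _)

lemma isolated_and_mem_discreteSpectrum_of_lt (α : ℝ) {ω l : ℝ}
    (hq : ∀ j, Tendsto (q j) atTop (𝓝 ω)) (hl : l < ω) :
    (∃ ε > 0, ∀ z ∈ UnboundedOp.spectrum (formOperator 𝕜 α q), dist z (l : 𝕜) < ε → z = l) ∧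
      ((l : 𝕜) ∈ UnboundedOp.spectrum (formOperator 𝕜 α q) →
        (l : 𝕜) ∈ UnboundedOp.discreteSpectrum (formOperator 𝕜 α q)) := by
  obtain ⟨m, hm⟩ := exists_mem_resolventSet_formOperator (𝕜 := 𝕜) α q
  obtain ⟨n, L, C, bound⟩ := exists_isPeetreBound_formOperator (𝕜 := 𝕜) α hq hl
  exact bound.isolated_and_mem_discreteSpectrum (isFormalAdjoint_formOperator α q) hm

end Graph

/-! ### The essential spectrum -/

lemma norm_sq_eq_integral_of_ae_eq_ofReal {f : L2Half 𝕜} {u : ℝ → ℝ}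
    (hf : f =ᵐ[halfLine] fun x => (u x : 𝕜)) : ‖f‖ ^ 2 = ∫ x in Ioi (0 : ℝ), u x ^ 2 := by
  rw [norm_sq_eq_integral]
  refine integral_congr_ae ?_
  filter_upwards [hf] with x hx
  rw [hx, RCLike.norm_ofReal, sq_abs]

namespace IsTest

variable {ψ : ℝ → ℝ}

variable (𝕜) in
/-- The test function `ψ` as an element of `L²(0, ∞)`. -/
def toL2 (h : IsTest ψ) : L2Half 𝕜 :=
  (memLp (𝕜 := 𝕜) h.1.continuous h.2.1).toLp _

lemma coeFn_toL2 (h : IsTest ψ) : h.toL2 𝕜 =ᵐ[halfLine] fun x => (ψ x : 𝕜) :=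
  MemLp.coeFn_toLp _

lemma hasWeakDeriv_toL2 (h : IsTest ψ) : HasWeakDeriv (h.toL2 𝕜) (h.deriv.toL2 𝕜) :=
  ((isPrimitive_ofReal h.hasDerivAt h.continuous_deriv).congr_right
    h.deriv.coeFn_toL2.symm).hasWeakDeriv h.coeFn_toL2

lemma hasBoundaryValue_toL2 (h : IsTest ψ) : HasBoundaryValue (h.toL2 𝕜) 0 :=
  isTest_hasBoundaryValue h h.coeFn_toL2

variable (𝕜) in
/-- The test function `ψ` on the `j`-th edge, extended by zero to the other edges, as an element
of the form domain. -/
def toFormDomain (h : IsTest ψ) (j : Fin N) : formDomain 𝕜 N := by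
  refine ⟨PiLp.single 2 j (h.toL2 𝕜), fun i => ?_, 0, fun i => ?_⟩ <;> by_cases hi : i = j
  · subst hi
    simpa using isTest_mem_H1 h h.coeFn_toL2
  · simp [hi]
  · subst hi
    simpa using h.hasBoundaryValue_toL2
  · simpa [hi] using hasBoundaryValue_zero

lemma coe_toFormDomain (h : IsTest ψ) (j : Fin N) :
    (h.toFormDomain 𝕜 j : L2Graph 𝕜 N) = PiLp.single 2 j (h.toL2 𝕜) := rfl

lemma vertexValue_toFormDomain [NeZero N] (h : IsTest ψ) (j : Fin N) :
    vertexValue (h.toFormDomain 𝕜 j) = 0 :=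
  vertexValue_eq (j := j) (by simpa [h.coe_toFormDomain] using h.hasBoundaryValue_toL2)

lemma graphDeriv_toFormDomain (h : IsTest ψ) (j : Fin N) :
    graphDeriv (h.toFormDomain 𝕜 j) = PiLp.single 2 j (h.deriv.toL2 𝕜) := by
  ext1 i
  refine edgeDeriv_eq ?_
  rw [h.coe_toFormDomain]
  by_cases hi : i = j
  · subst hi
    simpa using h.hasWeakDeriv_toL2
  · simpa [hi] using hasWeakDeriv_zero

end IsTest

lemma inner_single_right (Z : L2Graph 𝕜 N) (j : Fin N) (f : L2Half 𝕜) :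
    inner 𝕜 Z (PiLp.single 2 j f : L2Graph 𝕜 N) = inner 𝕜 (Z j) f := by
  rw [PiLp.inner_apply, Finset.sum_eq_single j (fun i _ hi => by simp [hi]) (by simp)]
  simp

lemma IsTest.represents [NeZero N] (α : ℝ) (q : Fin N → ℝ →ᵇ ℝ) {ψ : ℝ → ℝ} (h : IsTest ψ)
    (j : Fin N) : Represents α q (h.toFormDomain 𝕜 j)
      (PiLp.single 2 j (mulL2 (q j) (h.toL2 𝕜) - h.deriv.deriv.toL2 𝕜)) := fun Z => by
  have green := h.deriv.hasWeakDeriv_toL2.inner_add_inner h.deriv.hasBoundaryValue_toL2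
    (hasWeakDeriv_edgeDeriv j Z) (hasBoundaryValue_vertexValue j Z)
  rw [form_eq, h.vertexValue_toFormDomain, h.graphDeriv_toFormDomain, h.coe_toFormDomain,
    ← inner_mulGraph_left, inner_single_right, inner_single_right, inner_single_right,
    graphDeriv_apply, mulGraph_apply, inner_mulL2_left, inner_sub_right]
  linear_combination green

/-- The Schrödinger expression `-ψ'' + Q ψ`. -/
def schrodinger (Q ψ : ℝ → ℝ) (x : ℝ) : ℝ := - deriv (deriv ψ) x + Q x * ψ x

lemma IsTest.continuous_schrodinger {ψ Q : ℝ → ℝ} (h : IsTest ψ) (hQ : Continuous Q) :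
    Continuous (schrodinger Q ψ) :=
  h.deriv.continuous_deriv.neg.add (hQ.mul h.1.continuous)

lemma IsTest.hasCompactSupport_schrodinger {ψ : ℝ → ℝ} (h : IsTest ψ) (Q : ℝ → ℝ) :
    HasCompactSupport (schrodinger Q ψ) :=
  h.2.1.deriv.deriv.neg.add h.2.1.mul_left

lemma integrable_sq_of_hasCompactSupport {u : ℝ → ℝ} (hc : Continuous u)
    (hs : HasCompactSupport u) : Integrable (fun x => u x ^ 2) halfLine :=
  (hc.memLp_of_hasCompactSupport hs).integrable_sq.restrict

lemma exists_integral_sq_le_schrodinger [NeZero N] {α : ℝ} {q : Fin N → ℝ →ᵇ ℝ} {r : ℝ}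
    (hr : (r : 𝕜) ∈ UnboundedOp.resolventSet (formOperator 𝕜 α q)) (j : Fin N) :
    ∃ C : ℝ, ∀ ψ : ℝ → ℝ, IsTest ψ → ∫ x in Ioi (0 : ℝ), ψ x ^ 2
      ≤ C * ∫ x in Ioi (0 : ℝ), schrodinger (fun x => q j x - r) ψ x ^ 2 := by
  obtain ⟨R, hR : UnboundedOp.IsResolvent _ _ R⟩ := hr
  refine ⟨‖R‖ ^ 2, fun ψ hψ => ?_⟩
  let w : L2Half 𝕜 := mulL2 (q j) (hψ.toL2 𝕜) - hψ.deriv.deriv.toL2 𝕜 - (r : 𝕜) • hψ.toL2 𝕜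
  have w_ae : w =ᵐ[halfLine] fun x => (schrodinger (fun x => q j x - r) ψ x : 𝕜) := by
    filter_upwards [coeFn_mulL2 (q j) (hψ.toL2 𝕜), hψ.coeFn_toL2 (𝕜 := 𝕜),
      hψ.deriv.deriv.coeFn_toL2 (𝕜 := 𝕜), Lp.coeFn_smul (r : 𝕜) (hψ.toL2 𝕜),
      Lp.coeFn_sub (mulL2 (q j) (hψ.toL2 𝕜)) (hψ.deriv.deriv.toL2 𝕜),
      Lp.coeFn_sub (mulL2 (q j) (hψ.toL2 𝕜) - hψ.deriv.deriv.toL2 𝕜) ((r : 𝕜) • hψ.toL2 𝕜)]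
      with x h₁ h₂ h₃ h₄ h₅ h₆
    rw [h₆, Pi.sub_apply, h₅, Pi.sub_apply, h₄, Pi.smul_apply, h₁, h₂, h₃, schrodinger,
      smul_eq_mul]
    push_cast
    ring
  obtain ⟨hdom, hA⟩ := (hψ.represents (𝕜 := 𝕜) α q j).exists_formOperator_eq
  have resolvent_eq : R (PiLp.single 2 j w) = PiLp.single 2 j (hψ.toL2 𝕜) := by
    have hRψ := hR.2 ⟨_, hdom⟩
    rw [hA] at hRψ
    have single_smul : (PiLp.single 2 j ((r : 𝕜) • hψ.toL2 𝕜) : L2Graph 𝕜 N)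
        = (r : 𝕜) • PiLp.single 2 j (hψ.toL2 𝕜) :=
      congrArg (WithLp.toLp 2) (Pi.single_smul j _ _)
    simpa only [hψ.coe_toFormDomain, ← single_smul, ← PiLp.single_sub] using hRψ
  have norm_le := R.le_opNorm (PiLp.single 2 j w)
  rw [resolvent_eq, PiLp.norm_single, PiLp.norm_single] at norm_le
  rw [← norm_sq_eq_integral_of_ae_eq_ofReal (𝕜 := 𝕜) hψ.coeFn_toL2,
    ← norm_sq_eq_integral_of_ae_eq_ofReal w_ae, ← mul_pow]
  exact pow_le_pow_left₀ (norm_nonneg _) norm_le 2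

lemma schrodinger_mul {χ u v Q : ℝ → ℝ} {κ : ℝ} (h : IsTest χ)
    (hu : ∀ x, HasDerivAt u (κ * v x) x) (hv : ∀ x, HasDerivAt v (-(κ * u x)) x) (x : ℝ) :
    schrodinger (fun x => Q x - κ ^ 2) (χ * u) x
      = schrodinger Q χ x * u x - 2 * κ * deriv χ x * v x := by
  have deriv_eq : deriv (χ * u) = fun x => deriv χ x * u x + χ x * (κ * v x) :=
    funext fun x => ((h.hasDerivAt x).mul (hu x)).deriv
  have deriv_deriv_eq := (((h.deriv.hasDerivAt x).mul (hu x)).add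
    ((h.hasDerivAt x).mul ((hv x).const_mul κ))).deriv
  rw [schrodinger, schrodinger, deriv_eq, Pi.mul_apply]
  refine (congrArg (fun t => -t + _) deriv_deriv_eq).trans ?_
  ring

/-- Adding the bounds for the two modulations `χ cos (κ x)` and `χ sin (κ x)` removes the
oscillation. -/
lemma IsTest.integral_sq_le_of_modulation {χ Q : ℝ → ℝ} (hχ : IsTest χ) (hQ : Continuous Q)
    {κ C : ℝ} (hC : ∀ ψ : ℝ → ℝ, IsTest ψ → ∫ x in Ioi (0 : ℝ), ψ x ^ 2
      ≤ C * ∫ x in Ioi (0 : ℝ), schrodinger (fun x => Q x - κ ^ 2) ψ x ^ 2) :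
    ∫ x in Ioi (0 : ℝ), χ x ^ 2
      ≤ C * ∫ x in Ioi (0 : ℝ), (schrodinger Q χ x ^ 2 + (2 * κ * _root_.deriv χ x) ^ 2) := by
  let c : ℝ → ℝ := fun x => Real.cos (κ * x)
  let s : ℝ → ℝ := fun x => Real.sin (κ * x)
  have sq_add_sq (x : ℝ) : c x ^ 2 + s x ^ 2 = 1 := Real.cos_sq_add_sin_sq _
  have hlin (x : ℝ) : HasDerivAt (fun x => κ * x) κ x := by
    simpa using (hasDerivAt_id x).const_mul κ
  have hc (x : ℝ) : HasDerivAt c (-(κ * s x)) x := (hlin x).cos.congr_deriv (by ring)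
  have hs (x : ℝ) : HasDerivAt s (κ * c x) x := (hlin x).sin.congr_deriv (by ring)
  have hχc : IsTest (χ * c) := hχ.mul_contDiff (by fun_prop)
  have hχs : IsTest (χ * s) := hχ.mul_contDiff (by fun_prop)
  have integrable_sq {ψ : ℝ → ℝ} (h : IsTest ψ) : Integrable (fun x => ψ x ^ 2) halfLine :=
    integrable_sq_of_hasCompactSupport h.1.continuous h.2.1
  have integrable_sq_schrodinger {ψ : ℝ → ℝ} (h : IsTest ψ) :
      Integrable (fun x => schrodinger (fun x => Q x - κ ^ 2) ψ x ^ 2) halfLine :=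
    integrable_sq_of_hasCompactSupport (h.continuous_schrodinger (hQ.sub continuous_const))
      (h.hasCompactSupport_schrodinger _)
  have schrodinger_c := schrodinger_mul (Q := Q) hχ (u := c) (v := -s)
    (fun x => (hc x).congr_deriv (by simp)) fun x => (hs x).neg
  have schrodinger_s := schrodinger_mul (Q := Q) hχ (u := s) (v := c) hs hc
  have sum_le := add_le_add (hC _ hχc) (hC _ hχs)
  rw [← mul_add, ← integral_add (integrable_sq hχc) (integrable_sq hχs),
    ← integral_add (integrable_sq_schrodinger hχc) (integrable_sq_schrodinger hχs)] at sum_le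
  have sq_eq (x : ℝ) : (χ * c) x ^ 2 + (χ * s) x ^ 2 = χ x ^ 2 := by
    rw [Pi.mul_apply, Pi.mul_apply, mul_pow, mul_pow, ← mul_add, sq_add_sq, mul_one]
  have schrodinger_sq_eq (x : ℝ) : schrodinger (fun x => Q x - κ ^ 2) (χ * c) x ^ 2
      + schrodinger (fun x => Q x - κ ^ 2) (χ * s) x ^ 2
      = schrodinger Q χ x ^ 2 + (2 * κ * _root_.deriv χ x) ^ 2 := by
    rw [schrodinger_c, schrodinger_s, Pi.neg_apply]
    linear_combination
      (schrodinger Q χ x ^ 2 + (2 * κ * _root_.deriv χ x) ^ 2) * sq_add_sq x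
  simpa only [sq_eq, schrodinger_sq_eq] using sum_le

lemma IsTest.comp_mul_left {φ : ℝ → ℝ} (h : IsTest φ) {ε : ℝ} (hε : 0 < ε) :
    IsTest fun x => φ (ε * x) := by
  have tsupport_eq :
      tsupport (fun x => φ (ε * x)) = (Homeomorph.mulLeft₀ ε hε.ne') ⁻¹' tsupport φ :=
    tsupport_comp_eq_preimage φ (Homeomorph.mulLeft₀ ε hε.ne')
  refine ⟨h.1.comp (contDiff_const.mul contDiff_id),
    h.2.1.comp_homeomorph (Homeomorph.mulLeft₀ ε hε.ne'), fun x hx => ?_⟩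
  rw [tsupport_eq] at hx
  exact pos_of_mul_pos_right (h.2.2 hx) hε.le

lemma schrodinger_comp_mul_left (Q φ : ℝ → ℝ) (ε x : ℝ) :
    schrodinger Q (fun x => φ (ε * x)) x
      = -(ε ^ 2 * deriv (deriv φ) (ε * x)) + Q x * φ (ε * x) := by
  have deriv_eq : deriv (fun x => φ (ε * x)) = fun x => ε * deriv φ (ε * x) :=
    funext fun x => deriv_comp_mul_left ε φ x
  rw [schrodinger, deriv_eq, deriv_const_mul_field, deriv_comp_mul_left, smul_eq_mul]
  ring

/-- The integrand `(schrodinger Q χ)² + (2 κ χ')²` at `x / ε` for the dilated test function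
`χ x = φ (ε x)`. -/
def dilatedResidual (Q φ : ℝ → ℝ) (κ ε x : ℝ) : ℝ :=
  (-(ε ^ 2 * deriv (deriv φ) x) + Q (x / ε) * φ x) ^ 2 + (2 * κ * (ε * deriv φ x)) ^ 2

lemma IsTest.integral_sq_le_of_dilation {φ Q : ℝ → ℝ} (hφ : IsTest φ) {κ C ε : ℝ} (hε : 0 < ε)
    (hC : ∀ χ : ℝ → ℝ, IsTest χ → ∫ x in Ioi (0 : ℝ), χ x ^ 2
      ≤ C * ∫ x in Ioi (0 : ℝ), (schrodinger Q χ x ^ 2 + (2 * κ * _root_.deriv χ x) ^ 2)) :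
    ∫ x in Ioi (0 : ℝ), φ x ^ 2 ≤ C * ∫ x in Ioi (0 : ℝ), dilatedResidual Q φ κ ε x := by
  have scaled := hC _ (hφ.comp_mul_left hε)
  have scale (g : ℝ → ℝ) :
      ∫ x in Ioi (0 : ℝ), g (ε * x) = ε⁻¹ * ∫ x in Ioi (0 : ℝ), g x := by
    simpa using integral_comp_mul_left_Ioi g 0 hε
  have integrand_eq (x : ℝ) : schrodinger Q (fun x => φ (ε * x)) x ^ 2
      + (2 * κ * _root_.deriv (fun x => φ (ε * x)) x) ^ 2 = dilatedResidual Q φ κ ε (ε * x) := by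
    rw [dilatedResidual, schrodinger_comp_mul_left, deriv_comp_mul_left,
      mul_div_cancel_left₀ x hε.ne', smul_eq_mul]
  simp only [integrand_eq] at scaled
  rw [scale fun x => φ x ^ 2, scale (dilatedResidual Q φ κ ε), mul_left_comm] at scaled
  exact le_of_mul_le_mul_left scaled (inv_pos.2 hε)

lemma dilatedResidual_le (Q : ℝ →ᵇ ℝ) (φ : ℝ → ℝ) (κ x : ℝ) {ε : ℝ} (hε : ε ∈ Ioo (0 : ℝ) 1) :
    dilatedResidual Q φ κ ε x ≤ (|deriv (deriv φ) x| + ‖Q‖ * |φ x|) ^ 2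
      + (2 * κ * deriv φ x) ^ 2 := by
  have first_le : |-(ε ^ 2 * deriv (deriv φ) x) + Q (x / ε) * φ x|
      ≤ |deriv (deriv φ) x| + ‖Q‖ * |φ x| := by
    refine (abs_add_le _ _).trans (add_le_add ?_ ?_)
    · rw [abs_neg, abs_mul, abs_sq]
      exact mul_le_of_le_one_left (abs_nonneg _) (pow_le_one₀ hε.1.le hε.2.le)
    · rw [abs_mul]
      gcongr
      exact Q.norm_coe_le_norm _
  refine add_le_add ((sq_abs _).symm.trans_le (by gcongr)) (sq_le_sq.2 ?_)
  rw [mul_left_comm, abs_mul, abs_of_pos hε.1]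
  exact mul_le_of_le_one_left (abs_nonneg _) hε.2.le

lemma IsTest.tendsto_integral_dilation {φ : ℝ → ℝ} (hφ : IsTest φ) {Q : ℝ →ᵇ ℝ}
    (hQ : Tendsto Q atTop (𝓝 0)) (κ : ℝ) :
    Tendsto (fun ε : ℝ => ∫ x in Ioi (0 : ℝ), dilatedResidual Q φ κ ε x) (𝓝[>] 0) (𝓝 0) := by
  have cφ := hφ.1.continuous
  have cφ' := hφ.continuous_deriv
  have cφ'' := hφ.deriv.continuous_deriv
  have bound_integrable : Integrable (fun x => (|_root_.deriv (_root_.deriv φ) x| + ‖Q‖ * |φ x|) ^ 2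
      + (2 * κ * _root_.deriv φ x) ^ 2) halfLine :=
    (integrable_sq_of_hasCompactSupport (cφ''.abs.add (continuous_const.mul cφ.abs))
      (hφ.2.1.deriv.deriv.abs.add hφ.2.1.abs.mul_left)).add
      (integrable_sq_of_hasCompactSupport (continuous_const.mul cφ') hφ.2.1.deriv.mul_left)
  suffices lim_eq : Tendsto (fun ε : ℝ => ∫ x in Ioi (0 : ℝ), dilatedResidual Q φ κ ε x)
      (𝓝[>] 0) (𝓝 (∫ _ in Ioi (0 : ℝ), (0 : ℝ))) by
    rwa [integral_zero] at lim_eq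
  refine tendsto_integral_filter_of_dominated_convergence _ (.of_forall fun ε => ?_) ?_
    bound_integrable ?_
  · unfold dilatedResidual
    exact Continuous.aestronglyMeasurable (by fun_prop)
  · filter_upwards [Ioo_mem_nhdsGT one_pos] with ε hε
    refine .of_forall fun x => ?_
    rw [Real.norm_of_nonneg (by unfold dilatedResidual; positivity)]
    exact dilatedResidual_le Q φ κ x hε
  · filter_upwards [ae_restrict_mem measurableSet_Ioi] with x hx
    have hε : Tendsto (fun ε : ℝ => ε) (𝓝[>] 0) (𝓝 0) := nhdsWithin_le_nhds
    have hQx : Tendsto (fun ε => Q (x / ε)) (𝓝[>] 0) (𝓝 0) :=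
      hQ.comp (tendsto_inv_nhdsGT_zero.const_mul_atTop hx)
    have lim := (((hε.pow 2).mul_const (_root_.deriv (_root_.deriv φ) x)).neg.add
      (hQx.mul_const (φ x))).pow 2 |>.add
      (((hε.mul_const (_root_.deriv φ x)).const_mul (2 * κ)).pow 2)
    simpa [dilatedResidual] using lim

lemma mem_spectrum_of_le [NeZero N] (α : ℝ) {q : Fin N → ℝ →ᵇ ℝ} {j : Fin N} {ω r : ℝ}
    (hq : Tendsto (q j) atTop (𝓝 ω)) (hr : ω ≤ r) :
    (r : 𝕜) ∈ UnboundedOp.spectrum (formOperator 𝕜 α q) := fun hres => by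
  obtain ⟨C, hC⟩ := exists_integral_sq_le_schrodinger hres j
  let Q : ℝ →ᵇ ℝ := q j - .const ℝ ω
  let κ := √(r - ω)
  have shift_eq : (fun x => q j x - r) = fun x => Q x - κ ^ 2 := by
    ext x
    rw [Real.sq_sqrt (sub_nonneg.2 hr)]
    exact (sub_sub_sub_cancel_right _ _ _).symm
  have hQ : Tendsto Q atTop (𝓝 0) := by
    have lim := hq.sub_const ω
    rwa [sub_self] at lim
  rw [shift_eq] at hC
  obtain ⟨φ, hφ, integral_φ⟩ := exists_isTest_integral_eq_one
  have integral_sq_nonpos : ∫ x in Ioi (0 : ℝ), φ x ^ 2 ≤ 0 := by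
    have lim := (hφ.tendsto_integral_dilation hQ κ).const_mul C
    rw [mul_zero] at lim
    refine ge_of_tendsto lim ?_
    filter_upwards [self_mem_nhdsWithin] with ε hε
    exact hφ.integral_sq_le_of_dilation hε fun χ hχ =>
      hχ.integral_sq_le_of_modulation Q.continuous hC
  have φ_ae_zero : (fun x => φ x ^ 2) =ᵐ[halfLine] 0 :=
    (integral_eq_zero_iff_of_nonneg (fun x => sq_nonneg (φ x))
      (integrable_sq_of_hasCompactSupport hφ.1.continuous hφ.2.1)).1
      (integral_sq_nonpos.antisymm (integral_nonneg fun x => sq_nonneg (φ x)))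
  rw [← hφ.integral_Ioi, integral_eq_zero_of_ae
    (φ_ae_zero.mono fun x hx => pow_eq_zero_iff two_ne_zero |>.1 hx)] at integral_φ
  exact zero_ne_one integral_φ

theorem essentialSpectrum_formOperator [NeZero N] (α : ℝ) {q : Fin N → ℝ →ᵇ ℝ} {ω : ℝ}
    (hq : ∀ j, Tendsto (q j) atTop (𝓝 ω)) :
    UnboundedOp.essentialSpectrum (formOperator 𝕜 α q) = (fun l : ℝ => (l : 𝕜)) '' Ici ω := by
  ext z
  constructor
  · rintro ⟨hz, hd⟩
    obtain ⟨m, hm⟩ := exists_mem_resolventSet_formOperator (𝕜 := 𝕜) α q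
    have im_z : RCLike.im z = 0 := by
      by_contra h
      exact hz (UnboundedOp.mem_resolventSet_of_im_ne_zero (isFormalAdjoint_formOperator α q) hm h)
    obtain ⟨l, rfl⟩ : ∃ l : ℝ, (l : 𝕜) = z := ⟨RCLike.re z, RCLike.conj_eq_iff_re.1
      (RCLike.conj_eq_iff_im.2 im_z)⟩
    refine ⟨l, mem_Ici.2 (not_lt.1 fun hl => ?_), rfl⟩
    exact hd ((isolated_and_mem_discreteSpectrum_of_lt α hq hl).2 hz)
  · rintro ⟨r, hr : ω ≤ r, rfl⟩
    refine ⟨mem_spectrum_of_le α (hq 0) hr, fun ⟨_, ⟨ε, hε, isolated⟩, _⟩ => ?_⟩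
    have eq_r := isolated ((r + ε / 2 : ℝ) : 𝕜) (mem_spectrum_of_le α (hq 0) (by linarith)) (by
      rw [dist_eq_norm, ← RCLike.ofReal_sub, RCLike.norm_ofReal, add_sub_cancel_left,
        abs_of_pos (by positivity)]
      linarith)
    linarith [RCLike.ofReal_injective eq_r]

lemma exists_spectral_gap [NeZero N] (α : ℝ) {q : Fin N → ℝ →ᵇ ℝ} {ω : ℝ} (hω : 0 < ω)
    (hq : ∀ j, Tendsto (q j) atTop (𝓝 ω)) : ∃ δ : ℝ, 0 < δ ∧ ∀ l : ℝ, 0 < l →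
      (l : 𝕜) ∈ UnboundedOp.spectrum (formOperator 𝕜 α q) → δ ≤ l := by
  obtain ⟨⟨ε, hε, isolated⟩, -⟩ := isolated_and_mem_discreteSpectrum_of_lt (𝕜 := 𝕜) α hq hω
  refine ⟨ε, hε, fun l hl hs => not_lt.1 fun hlε => hl.ne' ?_⟩
  refine RCLike.ofReal_injective (isolated _ hs ?_)
  rwa [dist_eq_norm, ← RCLike.ofReal_sub, RCLike.norm_ofReal, sub_zero, abs_of_pos hl]

/-! ### Riccati equations and Wronskians -/

lemma mem_kernel_formOperator [NeZero N] {α : ℝ} {q : Fin N → ℝ →ᵇ ℝ} {V : L2Graph 𝕜 N} :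
    V ∈ UnboundedOp.kernel (formOperator 𝕜 α q) ↔
      ∃ V' : formDomain 𝕜 N, (V' : L2Graph 𝕜 N) = V ∧ Represents α q V' 0 := by
  rw [UnboundedOp.kernel, UnboundedOp.mem_eigenspace]
  constructor
  · rintro ⟨hV, op_V⟩
    obtain ⟨V', hV', represents_V'⟩ := exists_formDomain_of_domain ⟨V, hV⟩
    rw [op_V, zero_smul] at represents_V'
    exact ⟨V', hV', represents_V'⟩
  · rintro ⟨V', rfl, represents_V'⟩
    obtain ⟨hV', op_V'⟩ := represents_V'.exists_formOperator_eq
    exact ⟨hV', by rw [op_V', zero_smul]⟩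

section Riccati

lemma inner_sub_mulL2_of_riccati {f f' g g' : L2Half 𝕜} {c d : 𝕜} (hf : HasWeakDeriv f f')
    (hc : HasBoundaryValue f c) (hg : HasWeakDeriv g g') (hd : HasBoundaryValue g d)
    {q h : ℝ →ᵇ ℝ} (hh : ∀ x, HasDerivAt h (q x - h x ^ 2) x) :
    inner 𝕜 (g' - mulL2 h g) (f' - mulL2 h f)
      = inner 𝕜 g' f' + inner 𝕜 g (mulL2 q f) + h 0 * (c * star d) := by
  have deriv_h (x : ℝ) : HasDerivAt h ((q - h * h) x) x :=
    (hh x).congr_deriv (congrArg (q x - ·) (sq (h x)))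
  have green := (hf.mulL2 deriv_h).inner_add_inner (hc.mulL2 h) hg hd
  rw [mulL2_sub, mulL2_mul, inner_add_right, inner_sub_right] at green
  rw [inner_sub_left, inner_sub_right, inner_sub_right, inner_mulL2_left, inner_mulL2_left]
  linear_combination -green

variable [NeZero N] {α : ℝ} {q h : Fin N → ℝ →ᵇ ℝ}

/-- The ground state representation: a solution `h` of the Riccati equation `h' + h² = q`, the
logarithmic derivative of a positive solution of `u'' = q u`, factorizes `-d²/dx² + q` as
`(d/dx - h)* (d/dx - h)`. -/
lemma form_eq_of_riccati (hh : ∀ j x, HasDerivAt (h j) (q j x - h j x ^ 2) x)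
    (hα : ∑ j, h j 0 = α) (V Z : formDomain 𝕜 N) :
    form α q V Z = ∑ j, inner 𝕜 (edgeDeriv j Z - mulL2 (h j) ((Z : L2Graph 𝕜 N) j))
      (edgeDeriv j V - mulL2 (h j) ((V : L2Graph 𝕜 N) j)) := by
  simp only [fun j => inner_sub_mulL2_of_riccati (hasWeakDeriv_edgeDeriv j V)
    (hasBoundaryValue_vertexValue j V) (hasWeakDeriv_edgeDeriv j Z)
    (hasBoundaryValue_vertexValue j Z) (hh j)]
  rw [Finset.sum_add_distrib, Finset.sum_add_distrib, ← Finset.sum_mul, ← RCLike.ofReal_sum, hα,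
    form_eq, PiLp.inner_apply, PiLp.inner_apply]
  rfl

lemma nonneg_of_riccati (hh : ∀ j x, HasDerivAt (h j) (q j x - h j x ^ 2) x)
    (hα : ∑ j, h j 0 = α) : UnboundedOp.Nonneg (formOperator 𝕜 α q) := fun v => by
  obtain ⟨V, hV, represents_V⟩ := exists_formDomain_of_domain v
  rw [← hV, ← represents_V V, form_eq_of_riccati hh hα, map_sum]
  exact Finset.sum_nonneg fun j _ => inner_self_nonneg

lemma represents_zero_iff_of_riccati (hh : ∀ j x, HasDerivAt (h j) (q j x - h j x ^ 2) x)
    (hα : ∑ j, h j 0 = α) {V : formDomain 𝕜 N} :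
    Represents α q V 0 ↔ ∀ j, edgeDeriv j V = mulL2 (h j) ((V : L2Graph 𝕜 N) j) := by
  refine ⟨fun hV => ?_, fun hV Z => ?_⟩
  · have form_self := congrArg RCLike.re (hV V)
    rw [form_eq_of_riccati hh hα, inner_zero_right, map_sum, map_zero,
      Finset.sum_eq_zero_iff_of_nonneg fun j _ => inner_self_nonneg] at form_self
    intro j
    rw [← sub_eq_zero, ← re_inner_self_nonpos (𝕜 := 𝕜)]
    exact (form_self j (Finset.mem_univ j)).le
  · rw [form_eq_of_riccati hh hα, inner_zero_right]
    exact Finset.sum_eq_zero fun j _ => by rw [hV j, sub_self, inner_zero_right]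

end Riccati

section Solutions

lemma IsPrimitive.ofReal_inv {u h : ℝ → ℝ} (hu : ∀ x, HasDerivAt u (h x * u x) x)
    (hh : Continuous h) (u_ne : ∀ x, u x ≠ 0) :
    IsPrimitive (fun x => ((u x)⁻¹ : 𝕜)) fun x => -(h x : 𝕜) * (u x : 𝕜)⁻¹ := by
  have ofReal_ne (x : ℝ) : (u x : 𝕜) ≠ 0 := by exact_mod_cast u_ne x
  have continuous_u : Continuous u := continuous_iff_continuousAt.2 fun x => (hu x).continuousAt
  refine .of_hasDerivAt (fun x => ?_) ((RCLike.continuous_ofReal.comp hh).neg.mul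
    ((RCLike.continuous_ofReal.comp continuous_u).inv₀ ofReal_ne))
  have deriv_inv := hasDerivAt_ofReal_comp (𝕜 := 𝕜) ((hu x).inv (u_ne x))
  refine (deriv_inv.congr_deriv ?_).congr_of_eventuallyEq (.of_forall fun y => ?_)
  · have := ofReal_ne x
    push_cast
    field_simp
  · exact (RCLike.ofReal_inv _).symm

lemma HasWeakDeriv.ae_eq_of_eq_mulL2 {f : L2Half 𝕜} {c : 𝕜} {h : ℝ →ᵇ ℝ}
    (hf : HasWeakDeriv f (StarGraph.mulL2 h f)) (hc : HasBoundaryValue f c) {u : ℝ → ℝ}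
    (hu : ∀ x, HasDerivAt u (h x * u x) x) (u_ne : ∀ x, u x ≠ 0) :
    f =ᵐ[halfLine] fun x => c / u 0 * u x := by
  have f_ae := hf.ae_eq_primitive hc
  have primitive_quotient := (isPrimitive_primitive c (StarGraph.mulL2 h f)).mul
    (IsPrimitive.ofReal_inv hu h.continuous u_ne)
  have quotient_deriv_ae : (fun x => StarGraph.mulL2 h f x * (u x : 𝕜)⁻¹
      + primitive c (StarGraph.mulL2 h f) x * (-(h x : 𝕜) * (u x : 𝕜)⁻¹)) =ᵐ[halfLine] 0 := by
    filter_upwards [f_ae, coeFn_mulL2 h f] with x h₁ h₂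
    rw [h₂, ← h₁, Pi.zero_apply]
    ring
  filter_upwards [f_ae, ae_restrict_mem measurableSet_Ioi] with x h₁ hx
  have quotient_eq := primitive_quotient.eq_of_ae_eq_zero quotient_deriv_ae (le_of_lt hx)
  have ofReal_ne : (u x : 𝕜) ≠ 0 := by exact_mod_cast u_ne x
  rw [primitive_zero] at quotient_eq
  rw [h₁, div_eq_mul_inv, ← quotient_eq, inv_mul_cancel_right₀ ofReal_ne]

lemma IsTest.inner_toL2 {ψ : ℝ → ℝ} (h : IsTest ψ) (f : L2Half 𝕜) :
    inner 𝕜 (h.toL2 𝕜) f = ∫ x in Ioi (0 : ℝ), ψ x • f x := by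
  rw [inner_eq_integral]
  refine integral_congr_ae ?_
  filter_upwards [h.coeFn_toL2 (𝕜 := 𝕜)] with x hx
  rw [hx, RCLike.star_def, RCLike.conj_ofReal, RCLike.real_smul_eq_coe_mul, mul_comm]

lemma boundaryValue_wronskian {f f' g g' : L2Half 𝕜} {c c' d d' : 𝕜} {q : ℝ →ᵇ ℝ}
    (hf : HasWeakDeriv f f') (hc : HasBoundaryValue f c) (hf' : HasWeakDeriv f' (mulL2 q f))
    (hc' : HasBoundaryValue f' c') (hg : HasWeakDeriv g g') (hd : HasBoundaryValue g d)
    (hg' : HasWeakDeriv g' (mulL2 q g)) (hd' : HasBoundaryValue g' d') :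
    c' * star d = c * star d' := by
  have green := hf'.inner_add_inner hc' hg hd
  have green' := hf.inner_add_inner hc hg' hd'
  rw [inner_mulL2_left] at green'
  linear_combination green - green'

lemma eq_zero_of_boundaryValue_zero {f f' : L2Half 𝕜} {q : ℝ →ᵇ ℝ} (hf : HasWeakDeriv f f')
    (hc : HasBoundaryValue f 0) (hf' : HasWeakDeriv f' (mulL2 q f))
    (hc' : HasBoundaryValue f' 0) : f = 0 := by
  have f_ae := hf.ae_eq_primitive hc
  let F := primitive 0 f'
  let G := primitive 0 (mulL2 q f)
  have primitive_F : IsPrimitive F G :=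
    (isPrimitive_primitive 0 f').congr_right (hf'.ae_eq_primitive hc')
  have primitive_G : IsPrimitive G fun x => (q x : 𝕜) * F x :=
    (isPrimitive_primitive 0 (mulL2 q f)).congr_right <| by
      filter_upwards [coeFn_mulL2 q f, f_ae] with x h₁ h₂
      rw [h₁, h₂]
  have continuousOn_F := primitive_F.continuousOn
  have continuousOn_G := primitive_G.continuousOn
  have continuousOn_qF : ContinuousOn (fun x => (q x : 𝕜) * F x) (Ici 0) :=
    (RCLike.continuous_ofReal.comp q.continuous).continuousOn.mul continuousOn_F
  have norm_deriv_le (y : ℝ) : ‖(G y, (q y : 𝕜) * F y)‖ ≤ max 1 ‖q‖ * ‖(F y, G y)‖ := by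
    refine max_le ?_ ?_
    · calc ‖G y‖ = 1 * ‖G y‖ := (one_mul _).symm
        _ ≤ _ := mul_le_mul (le_max_left _ _) (le_max_right _ _) (norm_nonneg _) (by positivity)
    · rw [norm_mul, RCLike.norm_ofReal]
      exact mul_le_mul ((q.norm_coe_le_norm y).trans (le_max_right _ _)) (le_max_left _ _)
        (norm_nonneg _) (by positivity)
  have F_eq_zero (x : ℝ) (hx : 0 ≤ x) : F x = 0 :=
    congrArg Prod.fst <| eq_zero_of_abs_deriv_le_mul_abs_self_of_eq_zero_right
      ((continuousOn_F.prodMk continuousOn_G).mono Icc_subset_Ici_self)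
      (fun y hy => (primitive_F.hasDerivWithinAt continuousOn_G hy.1).prodMk
        (primitive_G.hasDerivWithinAt continuousOn_qF hy.1))
      (Prod.ext (primitive_zero 0 _) (primitive_zero 0 _)) (fun y _ => norm_deriv_le y) x
      (right_mem_Icc.2 hx)
  rw [Lp.eq_zero_iff_ae_eq_zero]
  filter_upwards [f_ae, ae_restrict_mem measurableSet_Ioi] with x h₁ hx
  exact h₁.trans (F_eq_zero x (le_of_lt hx))

variable [NeZero N] {α : ℝ} {q : Fin N → ℝ →ᵇ ℝ} {V : formDomain 𝕜 N}

lemma Represents.hasWeakDeriv_edgeDeriv_of_zero (hV : Represents α q V 0) (j : Fin N) :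
    HasWeakDeriv (edgeDeriv j V) (mulL2 (q j) ((V : L2Graph 𝕜 N) j)) := fun ψ hψ => by
  have form_test := form_star α q V (hψ.toFormDomain 𝕜 j)
  rw [hV, inner_zero_right, star_zero, form_eq, hψ.vertexValue_toFormDomain,
    hψ.graphDeriv_toFormDomain, hψ.coe_toFormDomain, ← inner_mulGraph_left, inner_single_right,
    inner_single_right, graphDeriv_apply, mulGraph_apply, zero_mul, mul_zero, add_zero,
    ← inner_conj_symm (edgeDeriv j V), ← inner_conj_symm (mulL2 _ _), ← map_add, eq_comm,
    map_eq_zero, hψ.inner_toL2, hψ.deriv.inner_toL2] at form_test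
  exact eq_neg_of_add_eq_zero_left form_test

/-- The vertex condition `∑ⱼ vⱼ'(0) = α v₁(0)`, tested against the vertex value of `Z`. -/
lemma Represents.sum_boundaryValue_mul_star (hV : Represents α q V 0) {d : Fin N → 𝕜}
    (hd : ∀ j, HasBoundaryValue (edgeDeriv j V) (d j)) (Z : formDomain 𝕜 N) :
    (∑ j, d j) * star (vertexValue Z) = α * vertexValue V * star (vertexValue Z) := by
  have green (j : Fin N) : inner 𝕜 (edgeDeriv j Z) (edgeDeriv j V)
        + inner 𝕜 ((Z : L2Graph 𝕜 N) j) (mulL2 (q j) ((V : L2Graph 𝕜 N) j))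
      = -(d j * star (vertexValue Z)) := by
    rw [add_comm]
    exact (hV.hasWeakDeriv_edgeDeriv_of_zero j).inner_add_inner (hd j)
      (hasWeakDeriv_edgeDeriv j Z) (hasBoundaryValue_vertexValue j Z)
  have form_zero := hV Z
  simp only [form_eq, PiLp.inner_apply, graphDeriv_apply, mulGraph_apply] at form_zero
  rw [← Finset.sum_add_distrib, Finset.sum_congr rfl fun j _ => green j, Finset.sum_neg_distrib,
    ← Finset.sum_mul] at form_zero
  simp only [PiLp.zero_apply, inner_zero_right, Finset.sum_const_zero] at form_zero
  linear_combination -form_zero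

end Solutions

/-! ### The profile -/

/-- The sign of the shift on the `j`-th edge: the bump of the profile lies inside the first `k`
edges (for `α < 0`), and outside the others. -/
def edgeSign (k : ℕ) (j : Fin N) : ℝ := if (j : ℕ) < k then 1 else -1

/-- The argument of `sech` in the profile. -/
def phase (k : ℕ) (p α ω : ℝ) (j : Fin N) (x : ℝ) : ℝ :=
  (p - 1) * √ω / 2 * x - edgeSign k j * shift N k α ω

/-- The logarithmic derivative of the profile, as a solution of the Riccati equation
`h' = q - h ^ 2` with `q` the potential of `L_{2,k}`. -/
def slope (k : ℕ) (p α ω : ℝ) (j : Fin N) (x : ℝ) : ℝ :=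
  -(√ω * Real.tanh (phase k p α ω j x))

/-- The logarithmic derivative at the vertex of the profile on the first `k` edges; it is the
opposite number on the other edges. -/
def vertexSlope (N k : ℕ) (α : ℝ) : ℝ := α / (2 * (k : ℝ) - N)

lemma edgeSign_eq_or (k : ℕ) (j : Fin N) : edgeSign k j = 1 ∨ edgeSign k j = -1 := by
  unfold edgeSign
  split_ifs <;> simp

lemma edgeSign_mul_self (k : ℕ) (j : Fin N) : edgeSign k j * edgeSign k j = 1 := by
  obtain h | h := edgeSign_eq_or k j <;> rw [h] <;> norm_num

lemma sum_edgeSign {k : ℕ} (hk : k ≤ N) : ∑ j : Fin N, edgeSign k j = 2 * k - N := by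
  unfold edgeSign
  rw [Fin.sum_univ_eq_sum_range (fun i => if i < k then (1 : ℝ) else -1) N]
  obtain ⟨r, rfl⟩ := Nat.exists_eq_add_of_le hk
  rw [Finset.sum_range_add,
    Finset.sum_congr rfl (g := fun _ => (1 : ℝ)) fun i hi => if_pos (Finset.mem_range.1 hi),
    Finset.sum_congr (s₁ := Finset.range r) rfl (g := fun _ => (-1 : ℝ))
      fun i _ => if_neg (by omega)]
  simp only [Finset.sum_const, Finset.card_range, nsmul_eq_mul, Nat.cast_add]
  ring

lemma sq_one_div_cosh (y : ℝ) : (1 / Real.cosh y) ^ 2 = 1 - Real.tanh y ^ 2 := by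
  have cosh_ne := (Real.cosh_pos y).ne'
  rw [Real.tanh_eq_sinh_div_cosh]
  field_simp
  linarith [Real.cosh_sq y]

lemma one_div_cosh_le (y : ℝ) : 1 / Real.cosh y ≤ 2 * Real.exp (-y) := by
  have exp_mul : Real.exp (-y) * Real.exp y = 1 := by
    rw [← Real.exp_add, neg_add_cancel, Real.exp_zero]
  rw [div_le_iff₀ (Real.cosh_pos y), Real.cosh_eq]
  nlinarith [Real.exp_pos (-y)]

lemma hasDerivAt_tanh (y : ℝ) : HasDerivAt Real.tanh (1 - Real.tanh y ^ 2) y := by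
  have cosh_ne := (Real.cosh_pos y).ne'
  have tanh_eq : Real.tanh = Real.sinh / Real.cosh := funext Real.tanh_eq_sinh_div_cosh
  rw [tanh_eq]
  refine ((Real.hasDerivAt_sinh y).div (Real.hasDerivAt_cosh y) cosh_ne).congr_deriv ?_
  simp only [Pi.div_apply]
  field_simp

lemma hasDerivAt_phase (k : ℕ) (p α ω : ℝ) (j : Fin N) (x : ℝ) :
    HasDerivAt (phase k p α ω j) ((p - 1) * √ω / 2) x :=
  (((hasDerivAt_id x).const_mul _).sub_const _).congr_deriv (mul_one _)

section Profile

variable {k : ℕ} {p ω : ℝ}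

lemma abs_slope_le (k : ℕ) (p α ω : ℝ) (j : Fin N) (x : ℝ) : |slope k p α ω j x| ≤ √ω := by
  rw [slope, abs_neg, abs_mul, abs_of_nonneg (Real.sqrt_nonneg _)]
  exact mul_le_of_le_one_right (Real.sqrt_nonneg _) (Real.abs_tanh_lt_one _).le

lemma slope_sq_lt (hω : 0 < ω) (p α : ℝ) (j : Fin N) (x : ℝ) : slope k p α ω j x ^ 2 < ω := by
  rw [slope, neg_sq, mul_pow, Real.sq_sqrt hω.le]
  exact mul_lt_of_lt_one_right hω ((sq_lt_one_iff_abs_lt_one _).2 (Real.abs_tanh_lt_one _))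

lemma hasDerivAt_slope (hω : 0 ≤ ω) (p α : ℝ) (j : Fin N) (x : ℝ) :
    HasDerivAt (slope k p α ω j) ((p - 1) / 2 * (slope k p α ω j x ^ 2 - ω)) x := by
  refine (((hasDerivAt_tanh _).comp x
    (hasDerivAt_phase k p α ω j x)).const_mul √ω).neg.congr_deriv ?_
  rw [slope]
  linear_combination ((1 - p) / 2) * Real.mul_self_sqrt hω

lemma profile_eq_sech (k : ℕ) (p α ω : ℝ) (j : Fin N) (x : ℝ) :
    profile k p α ω j x
      = ((p + 1) * ω / 2 * (1 / Real.cosh (phase k p α ω j x)) ^ 2) ^ (1 / (p - 1)) := by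
  unfold profile phase edgeSign
  split_ifs
  · rw [one_mul, ← sub_eq_add_neg]
  · rw [neg_one_mul, sub_neg_eq_add]

lemma profile_eq_slope (hω : 0 ≤ ω) (p α : ℝ) (j : Fin N) (x : ℝ) :
    profile k p α ω j x = ((p + 1) / 2 * (ω - slope k p α ω j x ^ 2)) ^ (1 / (p - 1)) := by
  rw [profile_eq_sech, sq_one_div_cosh, slope, neg_sq, mul_pow, Real.sq_sqrt hω]
  congr 1
  ring

lemma profile_pos (hp : 1 < p) (hω : 0 < ω) (α : ℝ) (j : Fin N) (x : ℝ) :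
    0 < profile k p α ω j x := by
  have slope_lt := sub_pos.2 (slope_sq_lt (k := k) hω p α j x)
  rw [profile_eq_slope hω.le]
  positivity

lemma profile_rpow_eq_slope (hp : 1 < p) (hω : 0 < ω) (α : ℝ) (j : Fin N) (x : ℝ) :
    profile k p α ω j x ^ (p - 1) = (p + 1) / 2 * (ω - slope k p α ω j x ^ 2) := by
  have slope_lt := sub_pos.2 (slope_sq_lt (k := k) hω p α j x)
  rw [profile_eq_slope hω.le, ← Real.rpow_mul (by positivity),
    one_div_mul_cancel (sub_pos.2 hp).ne', Real.rpow_one]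

lemma hasDerivAt_profile (hp : 1 < p) (hω : 0 < ω) (α : ℝ) (j : Fin N) (x : ℝ) :
    HasDerivAt (profile k p α ω j) (slope k p α ω j x * profile k p α ω j x) x := by
  have slope_lt := sub_pos.2 (slope_sq_lt (k := k) hω p α j x)
  have base_pos : 0 < (p + 1) / 2 * (ω - slope k p α ω j x ^ 2) := by positivity
  have p_sub_one_ne := (sub_pos.2 hp).ne'
  have deriv_rpow := ((((hasDerivAt_slope hω.le p α j x).pow 2).const_sub ω).const_mul
    ((p + 1) / 2)).rpow_const (p := 1 / (p - 1)) (Or.inl base_pos.ne')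
  rw [show profile k p α ω j = _ from funext (profile_eq_slope hω.le p α j)]
  refine deriv_rpow.congr_deriv ?_
  simp only [Pi.pow_apply]
  rw [Real.rpow_sub base_pos, Real.rpow_one]
  field_simp
  ring

lemma continuous_profile (hp : 1 < p) (hω : 0 < ω) (α : ℝ) (j : Fin N) :
    Continuous (profile k p α ω j) :=
  continuous_iff_continuousAt.2 fun x => (hasDerivAt_profile hp hω α j x).continuousAt

lemma continuous_slope (hω : 0 ≤ ω) (p α : ℝ) (j : Fin N) : Continuous (slope k p α ω j) :=
  continuous_iff_continuousAt.2 fun x => (hasDerivAt_slope hω p α j x).continuousAt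

lemma exists_profile_le (hp : 1 < p) (hω : 0 < ω) (α : ℝ) (j : Fin N) :
    ∃ C, 0 ≤ C ∧ ∀ x, profile k p α ω j x ≤ C * Real.exp (-√ω * x) := by
  have p_sub_one_pos := sub_pos.2 hp
  let s := edgeSign k j * shift N k α ω
  let A := (p + 1) * ω / 2 * (2 * Real.exp s) ^ 2
  refine ⟨A ^ (1 / (p - 1)), by positivity, fun x => ?_⟩
  have base_le : (p + 1) * ω / 2 * (1 / Real.cosh (phase k p α ω j x)) ^ 2
      ≤ A * Real.exp (-√ω * x) ^ (p - 1) := by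
    rw [mul_assoc ((p + 1) * ω / 2)]
    gcongr
    calc (1 / Real.cosh (phase k p α ω j x)) ^ 2
        ≤ (2 * Real.exp (-phase k p α ω j x)) ^ 2 :=
          pow_le_pow_left₀ (one_div_nonneg.2 (Real.cosh_pos _).le) (one_div_cosh_le _) 2
      _ = (2 * Real.exp s) ^ 2 * Real.exp (-√ω * x) ^ (p - 1) := by
          rw [mul_pow, mul_pow, mul_assoc, ← Real.exp_mul, ← Real.exp_nat_mul,
            ← Real.exp_nat_mul, ← Real.exp_add, phase]
          congr 2
          push_cast
          ring
  calc profile k p α ω j x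
      ≤ (A * Real.exp (-√ω * x) ^ (p - 1)) ^ (1 / (p - 1)) := by
        rw [profile_eq_sech]
        exact Real.rpow_le_rpow (by positivity) base_le (by positivity)
    _ = A ^ (1 / (p - 1)) * Real.exp (-√ω * x) := by
        rw [Real.mul_rpow (by positivity) (by positivity), ← Real.rpow_mul (Real.exp_pos _).le,
          mul_one_div_cancel p_sub_one_pos.ne', Real.rpow_one]

lemma memLp_profile (hp : 1 < p) (hω : 0 < ω) (α : ℝ) (j : Fin N) :
    MemLp (profile k p α ω j) 2 halfLine := by
  obtain ⟨C, C_nonneg, profile_le⟩ := exists_profile_le (k := k) hp hω α j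
  have memLp_exp : MemLp (fun x => C * Real.exp (-√ω * x)) 2 halfLine := by
    rw [memLp_two_iff_integrable_sq (by fun_prop)]
    refine ((exp_neg_integrableOn_Ioi 0 (b := 2 * √ω) (by positivity)).const_mul (C ^ 2)).congr
      (.of_forall fun x => ?_)
    simp only [mul_pow, ← Real.exp_nat_mul]
    congr 2
    push_cast
    ring
  refine memLp_exp.of_le (continuous_profile hp hω α j).aestronglyMeasurable
    (.of_forall fun x => ?_)
  rw [Real.norm_of_nonneg (profile_pos hp hω α j x).le, Real.norm_of_nonneg (by positivity)]
  exact profile_le x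

lemma tendsto_profile (hp : 1 < p) (hω : 0 < ω) (α : ℝ) (j : Fin N) :
    Tendsto (profile k p α ω j) atTop (𝓝 0) := by
  obtain ⟨C, -, profile_le⟩ := exists_profile_le (k := k) hp hω α j
  have exp_tendsto : Tendsto (fun x => Real.exp (-√ω * x)) atTop (𝓝 0) :=
    Real.tendsto_exp_atBot.comp
      (tendsto_id.const_mul_atTop_of_neg (neg_lt_zero.2 (Real.sqrt_pos.2 hω)))
  refine squeeze_zero (fun x => (profile_pos hp hω α j x).le) profile_le ?_
  simpa only [mul_zero] using exp_tendsto.const_mul C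

lemma tendsto_potential (hp : 1 < p) (hω : 0 < ω) (α c : ℝ) (j : Fin N) :
    Tendsto (potential k hp hω α c j) atTop (𝓝 ω) := by
  have rpow_tendsto := (tendsto_profile (k := k) hp hω α j).rpow_const (p := p - 1)
    (Or.inr (sub_pos.2 hp).le)
  rw [Real.zero_rpow (sub_pos.2 hp).ne'] at rpow_tendsto
  have potential_tendsto := (rpow_tendsto.const_mul c).const_sub ω
  rwa [mul_zero, sub_zero] at potential_tendsto

lemma potential_eq_slope (hp : 1 < p) (hω : 0 < ω) (α c : ℝ) (j : Fin N) (x : ℝ) :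
    potential k hp hω α c j x = ω - c * ((p + 1) / 2 * (ω - slope k p α ω j x ^ 2)) := by
  rw [← profile_rpow_eq_slope hp hω]
  rfl

/-- The logarithmic derivative of the profile as a bounded continuous function. -/
def slopeBCF (k : ℕ) (p : ℝ) {ω : ℝ} (hω : 0 < ω) (α : ℝ) (j : Fin N) : ℝ →ᵇ ℝ :=
  BoundedContinuousFunction.ofNormedAddCommGroup (slope k p α ω j) (continuous_slope hω.le p α j)
    √ω (abs_slope_le k p α ω j)

lemma slopeBCF_apply (hω : 0 < ω) (α : ℝ) (j : Fin N) (x : ℝ) :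
    slopeBCF k p hω α j x = slope k p α ω j x := rfl

lemma hasDerivAt_slopeBCF (hp : 1 < p) (hω : 0 < ω) (α : ℝ) (j : Fin N) (x : ℝ) :
    HasDerivAt (slopeBCF k p hω α j)
      (potential k hp hω α 1 j x - slopeBCF k p hω α j x ^ 2) x := by
  refine (hasDerivAt_slope hω.le p α j x).congr_deriv ?_
  rw [potential_eq_slope, slopeBCF_apply]
  ring

lemma hasDerivAt_potential (hp : 1 < p) (hω : 0 < ω) (α : ℝ) (j : Fin N) (x : ℝ) :
    HasDerivAt (potential k hp hω α 1 j)
      ((potential k hp hω α p j x - potential k hp hω α 1 j x) * slopeBCF k p hω α j x) x := by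
  have potential_eq : ⇑(potential k hp hω α 1 j)
      = fun y => ω - 1 * ((p + 1) / 2 * (ω - slope k p α ω j y ^ 2)) :=
    funext (potential_eq_slope hp hω α 1 j)
  rw [potential_eq]
  refine (((((hasDerivAt_slope hω.le p α j x).pow 2).const_sub ω).const_mul
    ((p + 1) / 2)).const_mul 1 |>.const_sub ω).congr_deriv ?_
  rw [potential_eq_slope, slopeBCF_apply]
  push_cast
  ring

end Profile

section Vertex

variable {k : ℕ} {p α ω : ℝ}

lemma vertexSlope_sq_lt (hω : α ^ 2 / ((N : ℝ) - 2 * k) ^ 2 < ω) :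
    vertexSlope N k α ^ 2 < ω := by
  rwa [vertexSlope, div_pow, ← neg_sub, neg_sq]

lemma tanh_shift (hω0 : 0 < ω) (hω : α ^ 2 / ((N : ℝ) - 2 * k) ^ 2 < ω) :
    Real.tanh (shift N k α ω) = vertexSlope N k α / √ω := by
  have sq_lt_one : (vertexSlope N k α / √ω) ^ 2 < 1 := by
    rw [div_pow, Real.sq_sqrt hω0.le, div_lt_one hω0]
    exact vertexSlope_sq_lt hω
  rw [shift, ← div_div]
  exact Real.tanh_artanh (abs_lt.1 ((sq_lt_one_iff_abs_lt_one _).1 sq_lt_one))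

lemma slope_zero (hω0 : 0 < ω) (hω : α ^ 2 / ((N : ℝ) - 2 * k) ^ 2 < ω) (p : ℝ) (j : Fin N) :
    slope k p α ω j 0 = edgeSign k j * vertexSlope N k α := by
  rw [slope, phase, mul_zero, zero_sub, Real.tanh_neg]
  obtain h | h := edgeSign_eq_or k j
  · rw [h, one_mul, tanh_shift hω0 hω]
    field_simp
  · rw [h, neg_one_mul, Real.tanh_neg, tanh_shift hω0 hω]
    field_simp

lemma slope_zero_sq (hω0 : 0 < ω) (hω : α ^ 2 / ((N : ℝ) - 2 * k) ^ 2 < ω) (p : ℝ) (j : Fin N) :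
    slope k p α ω j 0 ^ 2 = vertexSlope N k α ^ 2 := by
  rw [slope_zero hω0 hω]
  linear_combination vertexSlope N k α ^ 2 * edgeSign_mul_self k j

lemma profile_zero_eq (hω0 : 0 < ω) (hω : α ^ 2 / ((N : ℝ) - 2 * k) ^ 2 < ω) (p : ℝ)
    (i j : Fin N) : profile k p α ω i 0 = profile k p α ω j 0 := by
  rw [profile_eq_slope hω0.le, profile_eq_slope hω0.le, slope_zero_sq hω0 hω,
    slope_zero_sq hω0 hω]

lemma sum_slope_zero (hk : k ≤ N) (h2k : 2 * k ≠ N) (hω0 : 0 < ω)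
    (hω : α ^ 2 / ((N : ℝ) - 2 * k) ^ 2 < ω) (p : ℝ) :
    ∑ j : Fin N, slopeBCF k p hω0 α j 0 = α := by
  have two_mul_sub_ne : 2 * (k : ℝ) - N ≠ 0 := sub_ne_zero.2 (by exact_mod_cast h2k)
  simp only [slopeBCF_apply, slope_zero hω0 hω]
  rw [← Finset.sum_mul, sum_edgeSign hk, vertexSlope, mul_div_cancel₀ _ two_mul_sub_ne]

end Vertex

section ProfileL2

/-- The profile on the `j`-th edge, as an element of `L²(0, ∞)`. -/
def profileL2 (𝕜 : Type*) [RCLike 𝕜] (k : ℕ) {p ω : ℝ} (hp : 1 < p) (hω : 0 < ω) (α : ℝ)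
    (j : Fin N) : L2Half 𝕜 :=
  (memLp_profile (k := k) hp hω α j).ofReal.toLp (fun x => (profile k p α ω j x : 𝕜))

variable {k : ℕ} {p ω : ℝ} (hp : 1 < p) (hω : 0 < ω) (α : ℝ) (j : Fin N)

lemma coeFn_profileL2 :
    profileL2 𝕜 k hp hω α j =ᵐ[halfLine] fun x => (profile k p α ω j x : 𝕜) :=
  MemLp.coeFn_toLp _

lemma coeFn_mulL2_profileL2 (q : ℝ →ᵇ ℝ) : mulL2 q (profileL2 𝕜 k hp hω α j) =ᵐ[halfLine]
    fun x => ((q x * profile k p α ω j x : ℝ) : 𝕜) := by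
  filter_upwards [coeFn_mulL2 q (profileL2 𝕜 k hp hω α j),
    coeFn_profileL2 (𝕜 := 𝕜) hp hω α j] with x h₁ h₂
  rw [h₁, h₂, RCLike.ofReal_mul]

lemma isPrimitive_profile : IsPrimitive (fun x => (profile k p α ω j x : 𝕜))
    (mulL2 (slopeBCF k p hω α j) (profileL2 𝕜 k hp hω α j)) :=
  (isPrimitive_ofReal (hasDerivAt_profile hp hω α j)
    ((continuous_slope hω.le p α j).mul (continuous_profile hp hω α j))).congr_right
    (coeFn_mulL2_profileL2 hp hω α j (slopeBCF k p hω α j)).symm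

lemma isPrimitive_slope_mul_profile :
    IsPrimitive (fun x => ((slopeBCF k p hω α j x * profile k p α ω j x : ℝ) : 𝕜))
      (mulL2 (potential k hp hω α 1 j) (profileL2 𝕜 k hp hω α j)) := by
  refine (isPrimitive_ofReal (u' := fun x => potential k hp hω α 1 j x * profile k p α ω j x)
    (fun x => ?_) ((potential k hp hω α 1 j).continuous.mul (continuous_profile hp hω α j))
    ).congr_right (coeFn_mulL2_profileL2 hp hω α j _).symm
  refine ((hasDerivAt_slopeBCF hp hω α j x).mul (hasDerivAt_profile hp hω α j x)).congr_deriv ?_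
  rw [slopeBCF_apply]
  ring

lemma isPrimitive_potential_mul_profile :
    IsPrimitive (fun x => ((potential k hp hω α 1 j x * profile k p α ω j x : ℝ) : 𝕜))
      (mulL2 (potential k hp hω α p j)
        (mulL2 (slopeBCF k p hω α j) (profileL2 𝕜 k hp hω α j))) := by
  rw [← mulL2_mul]
  let q := potential k hp hω α p j * slopeBCF k p hω α j
  refine (isPrimitive_ofReal (u' := fun x => q x * profile k p α ω j x) (fun x => ?_)
    (q.continuous.mul (continuous_profile hp hω α j))
    ).congr_right (coeFn_mulL2_profileL2 hp hω α j q).symm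
  refine ((hasDerivAt_potential hp hω α j x).mul (hasDerivAt_profile hp hω α j x)).congr_deriv ?_
  rw [BoundedContinuousFunction.mul_apply, slopeBCF_apply]
  ring

end ProfileL2

/-! ### The kernels -/

section Kernels

variable {k : ℕ} {p α ω : ℝ}

/-- The profile as an element of the form domain. -/
def profileForm (𝕜 : Type*) [RCLike 𝕜] [NeZero N] (hp : 1 < p) (hω0 : 0 < ω)
    (hω : α ^ 2 / ((N : ℝ) - 2 * k) ^ 2 < ω) : formDomain 𝕜 N :=
  ⟨WithLp.toLp 2 fun j => profileL2 𝕜 k hp hω0 α j,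
    fun j => ⟨_, (isPrimitive_profile hp hω0 α j).hasWeakDeriv (coeFn_profileL2 hp hω0 α j)⟩,
    (profile k p α ω (0 : Fin N) 0 : 𝕜), fun j => by
      rw [profile_zero_eq hω0 hω p 0 j]
      exact (isPrimitive_profile hp hω0 α j).hasBoundaryValue (coeFn_profileL2 hp hω0 α j)⟩

/-- The value at the vertex of the potential of `L_{2,k}`, the same on all edges. -/
def vertexPotential (N k : ℕ) (p α ω : ℝ) : ℝ :=
  ω - (p + 1) / 2 * (ω - vertexSlope N k α ^ 2)

lemma potential_zero (hp : 1 < p) (hω0 : 0 < ω) (hω : α ^ 2 / ((N : ℝ) - 2 * k) ^ 2 < ω)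
    (j : Fin N) : potential k hp hω0 α 1 j 0 = vertexPotential N k p α ω := by
  rw [potential_eq_slope, slope_zero_sq hω0 hω, one_mul, vertexPotential]

lemma vertexPotential_lt (hp : 1 < p) (hω : α ^ 2 / ((N : ℝ) - 2 * k) ^ 2 < ω) :
    vertexPotential N k p α ω < vertexSlope N k α ^ 2 := by
  have slope_gap := sub_pos.2 (vertexSlope_sq_lt hω)
  rw [vertexPotential]
  linarith [mul_pos (sub_pos.2 hp) slope_gap]

variable [NeZero N] {V : formDomain 𝕜 N}

/-- Wronskian identity between an element of `ker L_{1,k}` and `φ'`, which solves the same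
differential equation on every edge. -/
lemma Represents.boundaryValue_mul_vertexSlope {hp : 1 < p} {hω0 : 0 < ω}
    (hV : Represents α (potential k hp hω0 α p) V 0)
    (hω : α ^ 2 / ((N : ℝ) - 2 * k) ^ 2 < ω) {j : Fin N} {d : 𝕜}
    (hd : HasBoundaryValue (edgeDeriv j V) d) :
    d * vertexSlope N k α = edgeSign k j * (vertexValue V * vertexPotential N k p α ω) := by
  have slope_profile := coeFn_mulL2_profileL2 (𝕜 := 𝕜) (k := k) hp hω0 α j (slopeBCF k p hω0 α j)
  have potential_profile :=
    coeFn_mulL2_profileL2 (𝕜 := 𝕜) (k := k) hp hω0 α j (potential k hp hω0 α 1 j)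
  have primitive_slope := isPrimitive_slope_mul_profile (𝕜 := 𝕜) (k := k) hp hω0 α j
  have primitive_potential := isPrimitive_potential_mul_profile (𝕜 := 𝕜) (k := k) hp hω0 α j
  have wronskian := boundaryValue_wronskian (hasWeakDeriv_edgeDeriv j V)
    (hasBoundaryValue_vertexValue j V) (hV.hasWeakDeriv_edgeDeriv_of_zero j) hd
    (primitive_slope.hasWeakDeriv slope_profile) (primitive_slope.hasBoundaryValue slope_profile)
    (primitive_potential.hasWeakDeriv potential_profile)
    (primitive_potential.hasBoundaryValue potential_profile)
  have profile_ne : (profile k p α ω j 0 : 𝕜) ≠ 0 := by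
    exact_mod_cast (profile_pos hp hω0 α j 0).ne'
  have sign_sq : (edgeSign k j : 𝕜) * edgeSign k j = 1 := by
    exact_mod_cast edgeSign_mul_self k j
  rw [RCLike.star_def, RCLike.conj_ofReal, RCLike.conj_ofReal, slopeBCF_apply,
    slope_zero hω0 hω, potential_zero hp hω0 hω, RCLike.ofReal_mul, RCLike.ofReal_mul,
    RCLike.ofReal_mul] at wronskian
  have sign_mul : d * (edgeSign k j * vertexSlope N k α)
      = vertexValue V * vertexPotential N k p α ω :=
    mul_right_cancel₀ profile_ne (by linear_combination wronskian)
  linear_combination (edgeSign k j : 𝕜) * sign_mul - d * vertexSlope N k α * sign_sq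

/-- Summing the Wronskian identities turns the vertex condition into
`(N - 2k) (m² - κ) v(0) = 0`, where `∓m` are the slopes of `log φ` at the vertex and
`κ = ω - φ(0)^{p-1}`. -/
lemma Represents.vertexValue_eq_zero {hp : 1 < p} {hω0 : 0 < ω}
    (hV : Represents α (potential k hp hω0 α p) V 0) (hk : k ≤ N) (h2k : 2 * k ≠ N)
    (hω : α ^ 2 / ((N : ℝ) - 2 * k) ^ 2 < ω) : vertexValue V = 0 := by
  have two_mul_sub_ne : 2 * (k : ℝ) - N ≠ 0 := sub_ne_zero.2 (by exact_mod_cast h2k)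
  choose d hd using fun j => (hV.hasWeakDeriv_edgeDeriv_of_zero j).exists_boundaryValue
  have sum_mul_slope : (∑ j, d j) * (vertexSlope N k α : 𝕜)
      = ((2 * k - N : ℝ) : 𝕜) * (vertexValue V * vertexPotential N k p α ω) := by
    rw [Finset.sum_mul, Finset.sum_congr rfl fun j _ => hV.boundaryValue_mul_vertexSlope hω (hd j),
      ← Finset.sum_mul, ← RCLike.ofReal_sum, sum_edgeSign hk]
  have α_eq : α = vertexSlope N k α * (2 * k - N) := (div_mul_cancel₀ _ two_mul_sub_ne).symm
  have coefficient_ne : ((2 * k - N : ℝ) : 𝕜)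
      * ((vertexSlope N k α ^ 2 - vertexPotential N k p α ω : ℝ) : 𝕜) ≠ 0 := by
    exact_mod_cast mul_ne_zero two_mul_sub_ne (sub_pos.2 (vertexPotential_lt hp hω)).ne'
  by_contra vertexValue_ne
  have sum_eq : ∑ j, d j = α * vertexValue V :=
    mul_right_cancel₀ (star_ne_zero.2 vertexValue_ne) (hV.sum_boundaryValue_mul_star hd V)
  refine mul_ne_zero coefficient_ne vertexValue_ne ?_
  have α_eq_ofReal : (α : 𝕜) = vertexSlope N k α * ((2 * k - N : ℝ) : 𝕜) := by
    rw [← RCLike.ofReal_mul, ← α_eq]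
  rw [sum_eq, α_eq_ofReal] at sum_mul_slope
  rw [RCLike.ofReal_sub (vertexSlope N k α ^ 2), RCLike.ofReal_pow]
  linear_combination sum_mul_slope

lemma kernel_linOp₁_eq_bot (hp : 1 < p) (hα : α ≠ 0) (hk : k ≤ N) (h2k : 2 * k ≠ N)
    (hω0 : 0 < ω) (hω : α ^ 2 / ((N : ℝ) - 2 * k) ^ 2 < ω) :
    UnboundedOp.kernel (linOp₁ 𝕜 N k α hp hω0) = ⊥ := by
  rw [Submodule.eq_bot_iff]
  intro U hU
  obtain ⟨V, rfl, hV⟩ := mem_kernel_formOperator.1 hU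
  have vertexValue_eq := hV.vertexValue_eq_zero hk h2k hω
  have vertexSlope_ne : (vertexSlope N k α : 𝕜) ≠ 0 := by
    exact_mod_cast div_ne_zero hα (sub_ne_zero.2 (by exact_mod_cast h2k))
  ext1 j
  have hV' := hV.hasWeakDeriv_edgeDeriv_of_zero j
  obtain ⟨d, hd⟩ := hV'.exists_boundaryValue
  have mul_slope := hV.boundaryValue_mul_vertexSlope hω hd
  rw [vertexValue_eq, zero_mul, mul_zero] at mul_slope
  have d_eq := (mul_eq_zero.1 mul_slope).resolve_right vertexSlope_ne
  exact eq_zero_of_boundaryValue_zero (hasWeakDeriv_edgeDeriv j V)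
    (vertexValue_eq ▸ hasBoundaryValue_vertexValue j V) hV' (d_eq ▸ hd)

lemma kernel_linOp₂_eq_span (hp : 1 < p) (hk : k ≤ N) (h2k : 2 * k ≠ N) (hω0 : 0 < ω)
    (hω : α ^ 2 / ((N : ℝ) - 2 * k) ^ 2 < ω) :
    UnboundedOp.kernel (linOp₂ 𝕜 N k α hp hω0)
      = Submodule.span 𝕜 {(profileForm 𝕜 hp hω0 hω : L2Graph 𝕜 N)} := by
  have represents_zero_iff (V : formDomain 𝕜 N) := represents_zero_iff_of_riccati (V := V)
    (hasDerivAt_slopeBCF hp hω0 α) (sum_slope_zero hk h2k hω0 hω p)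
  refine le_antisymm (fun U hU => ?_) ?_
  · obtain ⟨V, rfl, hV⟩ := mem_kernel_formOperator.1 hU
    refine Submodule.mem_span_singleton.2
      ⟨vertexValue V / (profile k p α ω (0 : Fin N) 0 : 𝕜), PiLp.ext fun j => Lp.ext ?_⟩
    have hasWeakDeriv_V := hasWeakDeriv_edgeDeriv j V
    rw [(represents_zero_iff V).1 hV j] at hasWeakDeriv_V
    have V_ae := hasWeakDeriv_V.ae_eq_of_eq_mulL2 (hasBoundaryValue_vertexValue j V)
      (hasDerivAt_profile hp hω0 α j) fun x => (profile_pos hp hω0 α j x).ne'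
    filter_upwards [V_ae, coeFn_profileL2 (𝕜 := 𝕜) hp hω0 α j,
      Lp.coeFn_smul (vertexValue V / (profile k p α ω (0 : Fin N) 0 : 𝕜))
        (profileL2 𝕜 k hp hω0 α j)] with x h₁ h₂ h₃
    refine Eq.trans h₃ ?_
    rw [h₁, Pi.smul_apply, h₂, smul_eq_mul, profile_zero_eq hω0 hω p 0 j]
  · refine (Submodule.span_singleton_le_iff_mem _ _).2 (mem_kernel_formOperator.2
      ⟨_, rfl, (represents_zero_iff _).2 fun j => edgeDeriv_eq ?_⟩)
    exact (isPrimitive_profile hp hω0 α j).hasWeakDeriv (coeFn_profileL2 hp hω0 α j)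

end Kernels

end StarGraph

end

theorem proposition3p5_general {𝕜 : Type*} [RCLike 𝕜] (N : ℕ) [NeZero N] (k : ℕ)
    (hk : k ≤ N) (h2k : 2 * k ≠ N) (p α ω : ℝ) (hp : 1 < p) (hα : α ≠ 0) (hω0 : 0 < ω)
    (hω : α ^ 2 / ((N : ℝ) - 2 * k) ^ 2 < ω) :
    ((∃ Φ : StarGraph.L2Graph 𝕜 N, StarGraph.IsProfile k p α ω Φ ∧
        UnboundedOp.kernel (StarGraph.linOp₂ 𝕜 N k α hp hω0) = Submodule.span 𝕜 {Φ}) ∧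
      UnboundedOp.Nonneg (StarGraph.linOp₂ 𝕜 N k α hp hω0)) ∧
    UnboundedOp.kernel (StarGraph.linOp₁ 𝕜 N k α hp hω0) = ⊥ ∧
    ((∃ δ : ℝ, 0 < δ ∧ ∀ l : ℝ, 0 < l →
        (l : 𝕜) ∈ UnboundedOp.spectrum (StarGraph.linOp₁ 𝕜 N k α hp hω0) → δ ≤ l) ∧
      (∃ δ : ℝ, 0 < δ ∧ ∀ l : ℝ, 0 < l →
        (l : 𝕜) ∈ UnboundedOp.spectrum (StarGraph.linOp₂ 𝕜 N k α hp hω0) → δ ≤ l) ∧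
      UnboundedOp.essentialSpectrum (StarGraph.linOp₁ 𝕜 N k α hp hω0)
        = (fun l : ℝ => (l : 𝕜)) '' Set.Ici ω ∧
      UnboundedOp.essentialSpectrum (StarGraph.linOp₂ 𝕜 N k α hp hω0)
        = (fun l : ℝ => (l : 𝕜)) '' Set.Ici ω) := by
  have tendsto_potential (c : ℝ) := StarGraph.tendsto_potential (N := N) (k := k) hp hω0 α c
  have sum_slope := StarGraph.sum_slope_zero hk h2k hω0 hω p
  exact ⟨⟨⟨StarGraph.profileForm 𝕜 hp hω0 hω, StarGraph.coeFn_profileL2 hp hω0 α,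
        StarGraph.kernel_linOp₂_eq_span hp hk h2k hω0 hω⟩,
      StarGraph.nonneg_of_riccati (StarGraph.hasDerivAt_slopeBCF hp hω0 α) sum_slope⟩,
    StarGraph.kernel_linOp₁_eq_bot hp hα hk h2k hω0 hω,
    StarGraph.exists_spectral_gap α hω0 (tendsto_potential p),
    StarGraph.exists_spectral_gap α hω0 (tendsto_potential 1),
    StarGraph.essentialSpectrum_formOperator α (tendsto_potential p),
    StarGraph.essentialSpectrum_formOperator α (tendsto_potential 1)⟩

theorem proposition3p5 {𝕜 : Type*} [RCLike 𝕜] (N : ℕ) [NeZero N] (k : ℕ)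
    (hk1 : 1 ≤ k) (hk2 : k ≤ (N - 1) / 2) (p α ω : ℝ) (hp : 1 < p) (hα : α ≠ 0)
    -- implied by the last hypothesis; it is an argument of the operators
    (hω0 : 0 < ω)
    (hω : α ^ 2 / ((N : ℝ) - 2 * k) ^ 2 < ω) :
    ((∃ Φ : StarGraph.L2Graph 𝕜 N, StarGraph.IsProfile k p α ω Φ ∧
        UnboundedOp.kernel (StarGraph.linOp₂ 𝕜 N k α hp hω0) = Submodule.span 𝕜 {Φ}) ∧
      UnboundedOp.Nonneg (StarGraph.linOp₂ 𝕜 N k α hp hω0)) ∧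
    UnboundedOp.kernel (StarGraph.linOp₁ 𝕜 N k α hp hω0) = ⊥ ∧
    ((∃ δ : ℝ, 0 < δ ∧ ∀ l : ℝ, 0 < l →
        (l : 𝕜) ∈ UnboundedOp.spectrum (StarGraph.linOp₁ 𝕜 N k α hp hω0) → δ ≤ l) ∧
      (∃ δ : ℝ, 0 < δ ∧ ∀ l : ℝ, 0 < l →
        (l : 𝕜) ∈ UnboundedOp.spectrum (StarGraph.linOp₂ 𝕜 N k α hp hω0) → δ ≤ l) ∧
      UnboundedOp.essentialSpectrum (StarGraph.linOp₁ 𝕜 N k α hp hω0) = (fun l : ℝ => (l : 𝕜)) '' Set.Ici ω ∧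
      UnboundedOp.essentialSpectrum (StarGraph.linOp₂ 𝕜 N k α hp hω0) = (fun l : ℝ => (l : 𝕜)) '' Set.Ici ω) := by
  have N_pos := NeZero.pos N
  exact proposition3p5_general N k (by omega) (by omega) p α ω hp hα hω0 hω
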